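/- Let $X\subset\mathbb R^n$, $Y\subset\mathbb R^m$ be nonempty, convex and compact, and consider $\min_{x\in X}\max_{y\in Y}\{f(x,y): c(x,y)\le 0\}$, where $f$ and each component $c_i$ of $c=(c_1,\dots,c_p)$ are real functions, differentiable at the points of $X\times Y$ with gradients that are Lipschitz continuous on $X\times Y$; for every $x\in X$, $f(x,\cdot)$ is concave on $Y$, every $c_i(x,\cdot)$ is convex on $Y$, and $\{y\in Y: c(x,y)\le0\}\ne\emptyset$. Let $f(x,y)=\mathbb E_{\xi\sim D}[F(x,y;\xi)]$ on $X\times Y$, where the (jointly measurable) stochastic gradients satisfy, for some $\delta,L_F>0$ and all points of $X\times Y$: $\mathbb E[\nabla_xF(x,y;\xi)]=\nabla_xf(x,y)$, $\mathbb E[\nabla_yF(x,y;\xi)]=\nabla_yf(x,y)$, $\mathbb E\|\nabla_xF(x,y;\xi)-\nabla_xf(x,y)\|^2\le\delta^2$, $\mathbb E\|\nabla_yF(x,y;\xi)-\nabla_yf(x,y)\|^2\le\delta^2$, and $\mathbb E\|\nabla_xF(x_1,y_1;\xi)-\nabla_xF(x_2,y_2;\xi)\|^2\le L_F^2(\|x_1-x_2\|^2+\|y_1-y_2\|^2)$.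 For $\rho,\sigma>0$ put $\psi_{\rho,\sigma}(x,y)=f(x,y)-\frac\rho2\|[c(x,y)]_+\|^2-\frac\sigma2\|y\|^2$ and $\varphi_{\rho,\sigma}(x)=\max_{y\in Y}\psi_{\rho,\sigma}(x,y)$. Then for all $x\in X$ the maximizer $y^*_{\rho,\sigma}(x)$ of $\psi_{\rho,\sigma}(x,\cdot)$ over $Y$ exists and is unique, and $\varphi_{\rho,\sigma}:X\to\mathbb R$ is differentiable. Given parameter sequences, the algorithm SPACO starts at $(x^0,y^0)\in X\times Y$ and iterates, for $k=0,1,\dots$, $$y^{k+1}=P_Y\big(y^k+\beta_k\nabla_y\Psi_k(x^k,y^k;\xi^y_k)\big),\qquad x^{k+1}=P_X\big(x^k-\alpha_kd_x^k\big),$$ where $\Psi_k(x,y;\xi)=F(x,y;\xi)-\frac{\rho_k}2\|[c(x,y)]_+\|^2-\frac{\sigma_k}2\|y\|^2$, $d_x^0=\nabla_x\Psi_0(x^0,y^1;\xi_0^x)$ and, for $k\ge1$, $d_x^k=(1-\eta_k)\big(d_x^{k-1}-\nabla_x\Psi_{k-1}(x^{k-1},y^k;\xi^x_k)\big)+\nabla_x\Psi_k(x^k,y^{k+1};\xi^x_k)$.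 All samples have law $D$; $\xi_k^y$ is independent of $\mathcal F_k=\sigma(\xi^y_0,\xi^x_0,\dots,\xi^y_{k-1},\xi^x_{k-1})$ and $\xi_k^x$ is independent of $\sigma(\mathcal F_k,\xi_k^y)$. Let $\rho_0,\sigma_0>0$. There is $\bar\beta>0$, depending only on $X,Y,f,c,\rho_0,\sigma_0$, such that the following holds whenever $0<\beta_0\le\bar\beta$, $\alpha_0>0$, $0<\eta_0\le1$, $0<t,s<1$, $s>3t$ and $8t+s<1$. Run SPACO with initial parameters $\sigma_0,\rho_0,\alpha_0,\beta_0$ at $k=0$ and, for $k\ge1$, $$\sigma_k=\sigma_0k^{-t},\quad\rho_k=\rho_0k^{t},\quad\alpha_k=\alpha_0k^{-6t-s},\quad\beta_k=\beta_0k^{-t-s},\quad\eta_k=\eta_0k^{-s}.$$ Write $\varphi_k=\varphi_{\rho_k,\sigma_k}$, $y_k^*=y^*_{\rho_k,\sigma_k}$, $\mathcal G_k(x)=\frac1{\alpha_k}\big(x-P_X(x-\alpha_k\nabla\varphi_k(x))\big)$ and $\tau=\min\{\frac{1-8t-s}2,\frac{s-3t}2,\frac t2\}$. Then there is a constant $C>0$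 independent of $\varepsilon$ such that for every $\varepsilon\in(0,1]$ there is an iterate $k$ with $1\le k\le C\varepsilon^{-1/\tau}$ and $$\max\Big\{\mathbb E\|\mathcal G_k(x^k)\|,\ \mathbb E\|y^k-y_k^*(x^k)\|,\ \mathbb E\|[c(x^k,y^k)]_+\|\Big\}\le\varepsilon,$$ all three quantities being integrable. -/

import Mathlib

open MeasureTheory ProbabilityTheory

namespace SPACO

noncomputable section

/-- Euclidean space `ℝⁿ`. -/
abbrev Eu (n : ℕ) := EuclideanSpace ℝ (Fin n)

/-- The Euclidean projection onto `C`: a nearest point of `C` (it exists and is unique when `C` is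
nonempty, closed and convex). -/
def proj {n : ℕ} (C : Set (Eu n)) (z : Eu n) : Eu n :=
  Classical.epsilon fun p => p ∈ C ∧ ∀ q ∈ C, dist z p ≤ dist z q

/-- The componentwise positive part `[v]₊`. -/
def posPart {p : ℕ} (v : Eu p) : Eu p := WithLp.toLp 2 fun i => max (v i) 0

/-- The regularized penalized objective
`g(x,y) - (ρ/2) ‖[c(x,y)]₊‖² - (σ/2) ‖y‖²`.
With `g = f` it is `ψ_{ρ,σ}`; with `g = F(·,·;ξ)` it is the stochastic estimator `Ψ(·,·;ξ)`. -/
def penalized {n m p : ℕ} (g : Eu n → Eu m → ℝ) (c : Eu n → Eu m → Eu p) (ρ σ : ℝ)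
    (x : Eu n) (y : Eu m) : ℝ :=
  g x y - ρ / 2 * ‖posPart (c x y)‖ ^ 2 - σ / 2 * ‖y‖ ^ 2

/-- The partial gradient `∇ₓ g(x,y)`. -/
def gradX {n m : ℕ} (g : Eu n → Eu m → ℝ) (x : Eu n) (y : Eu m) : Eu n :=
  gradient (fun x' => g x' y) x

/-- The partial gradient `∇_y g(x,y)`. -/
def gradY {n m : ℕ} (g : Eu n → Eu m → ℝ) (x : Eu n) (y : Eu m) : Eu m :=
  gradient (fun y' => g x y') y

/-- The maximum value `max_{y ∈ Y} g(x,y)`, as a function of `x`. -/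
def maxValue {n m : ℕ} (Y : Set (Eu m)) (g : Eu n → Eu m → ℝ) (x : Eu n) : ℝ :=
  sSup ((fun y => g x y) '' Y)

/-- A maximizer of `g(x,·)` over `Y`. -/
def maximizer {n m : ℕ} (Y : Set (Eu m)) (g : Eu n → Eu m → ℝ) (x : Eu n) : Eu m :=
  Classical.epsilon fun y => y ∈ Y ∧ IsMaxOn (fun y' => g x y') Y y

/-- The generalized gradient residual `(x - P_X(x - α ∇φ(x))) / α` of `min_{x ∈ X} φ(x)`. The
gradient is the one of `φ : X → ℝ`, that is, relative to `X`. -/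
def residual {n : ℕ} (X : Set (Eu n)) (φ : Eu n → ℝ) (α : ℝ) (x : Eu n) : Eu n :=
  α⁻¹ • (x - proj X (x - α • gradientWithin φ X x))

/-- The polynomial schedule with value `a k ^ e` for `k ≥ 1` and the initial value `a` at
`k = 0`. -/
def schedule (a e : ℝ) (k : ℕ) : ℝ := if k = 0 then a else a * (k : ℝ) ^ e

/-- The standing assumptions on the problem
`min_{x ∈ X} max_{y ∈ Y} { f(x,y) : c(x,y) ≤ 0 }`. -/
structure StandingAssumptions {n m p : ℕ} (X : Set (Eu n)) (Y : Set (Eu m))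
    (f : Eu n → Eu m → ℝ) (c : Eu n → Eu m → Eu p) : Prop where
  X_nonempty : X.Nonempty
  X_convex : Convex ℝ X
  X_compact : IsCompact X
  Y_nonempty : Y.Nonempty
  Y_convex : Convex ℝ Y
  Y_compact : IsCompact Y
  f_diff : ∀ z ∈ X ×ˢ Y, DifferentiableAt ℝ (fun w : Eu n × Eu m => f w.1 w.2) z
  f_lip : ∃ L, LipschitzOnWith L (fderiv ℝ fun w : Eu n × Eu m => f w.1 w.2) (X ×ˢ Y)
  f_concave : ∀ x ∈ X, ConcaveOn ℝ Y (f x)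
  c_diff : ∀ i, ∀ z ∈ X ×ˢ Y, DifferentiableAt ℝ (fun w : Eu n × Eu m => c w.1 w.2 i) z
  c_lip : ∀ i, ∃ L, LipschitzOnWith L (fderiv ℝ fun w : Eu n × Eu m => c w.1 w.2 i) (X ×ˢ Y)
  c_convex : ∀ i, ∀ x ∈ X, ConvexOn ℝ Y fun y => c x y i
  feasible : ∀ x ∈ X, ∃ y ∈ Y, ∀ i, c x y i ≤ 0

/-- The objective is `f(x,y) = 𝔼_{ξ ∼ D} F(x,y;ξ)`, and the stochastic gradient oracles `∇ₓF`,
`∇_yF` are (jointly measurable,) unbiased, of bounded variance, and `∇ₓF` is mean-squared smooth. -/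
structure OracleAssumptions {n m : ℕ} {Ξ : Type*} [MeasurableSpace Ξ] (D : Measure Ξ)
    (X : Set (Eu n)) (Y : Set (Eu m)) (f : Eu n → Eu m → ℝ) (F : Ξ → Eu n → Eu m → ℝ) : Prop where
  integrable : ∀ x ∈ X, ∀ y ∈ Y, Integrable (fun ξ => F ξ x y) D
  mean : ∀ x ∈ X, ∀ y ∈ Y, f x y = ∫ ξ, F ξ x y ∂D
  diff_x : ∀ ξ, ∀ x ∈ X, ∀ y ∈ Y, DifferentiableAt ℝ (fun x' => F ξ x' y) x
  diff_y : ∀ ξ, ∀ x ∈ X, ∀ y ∈ Y, DifferentiableAt ℝ (fun y' => F ξ x y') y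
  measurable_x : Measurable fun z : X × Y × Ξ => gradX (F z.2.2) z.1 z.2.1
  measurable_y : Measurable fun z : X × Y × Ξ => gradY (F z.2.2) z.1 z.2.1
  unbiased_x : ∀ x ∈ X, ∀ y ∈ Y, Integrable (fun ξ => gradX (F ξ) x y) D ∧
    ∫ ξ, gradX (F ξ) x y ∂D = gradX f x y
  unbiased_y : ∀ x ∈ X, ∀ y ∈ Y, Integrable (fun ξ => gradY (F ξ) x y) D ∧
    ∫ ξ, gradY (F ξ) x y ∂D = gradY f x y
  variance : ∃ δ : ℝ, 0 < δ ∧ ∀ x ∈ X, ∀ y ∈ Y,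
    (Integrable (fun ξ => ‖gradX (F ξ) x y - gradX f x y‖ ^ 2) D ∧
      ∫ ξ, ‖gradX (F ξ) x y - gradX f x y‖ ^ 2 ∂D ≤ δ ^ 2) ∧
    (Integrable (fun ξ => ‖gradY (F ξ) x y - gradY f x y‖ ^ 2) D ∧
      ∫ ξ, ‖gradY (F ξ) x y - gradY f x y‖ ^ 2 ∂D ≤ δ ^ 2)
  smooth : ∃ LF : ℝ, 0 < LF ∧ ∀ x₁ ∈ X, ∀ y₁ ∈ Y, ∀ x₂ ∈ X, ∀ y₂ ∈ Y,
    Integrable (fun ξ => ‖gradX (F ξ) x₁ y₁ - gradX (F ξ) x₂ y₂‖ ^ 2) D ∧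
    ∫ ξ, ‖gradX (F ξ) x₁ y₁ - gradX (F ξ) x₂ y₂‖ ^ 2 ∂D
      ≤ LF ^ 2 * (‖x₁ - x₂‖ ^ 2 + ‖y₁ - y₂‖ ^ 2)

/-- `ℱ_k = σ(ξ₀ʸ, ξ₀ˣ, …, ξ_{k-1}ʸ, ξ_{k-1}ˣ)`. -/
@[reducible] def past {Ω Ξ : Type*} [MeasurableSpace Ξ] (ξx ξy : ℕ → Ω → Ξ) (k : ℕ) : MeasurableSpace Ω :=
  ⨆ j : Fin k, MeasurableSpace.comap (ξy j) inferInstance ⊔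
    MeasurableSpace.comap (ξx j) inferInstance

/-- `ℱ_{k+1/2} = σ(ℱ_k, ξ_kʸ)`. -/
@[reducible] def pastHalf {Ω Ξ : Type*} [MeasurableSpace Ξ] (ξx ξy : ℕ → Ω → Ξ) (k : ℕ) : MeasurableSpace Ω :=
  past ξx ξy k ⊔ MeasurableSpace.comap (ξy k) inferInstance

/-- The samples have law `D`; `ξ_kʸ` is independent of `ℱ_k` and `ξ_kˣ` of `ℱ_{k+1/2}`. -/
structure IsSampling {Ω Ξ : Type*} [MeasurableSpace Ω] [MeasurableSpace Ξ] (P : Measure Ω)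
    (D : Measure Ξ) (ξx ξy : ℕ → Ω → Ξ) : Prop where
  measurable_x : ∀ k, Measurable (ξx k)
  measurable_y : ∀ k, Measurable (ξy k)
  law_x : ∀ k, P.map (ξx k) = D
  law_y : ∀ k, P.map (ξy k) = D
  indep_y : ∀ k, Indep (MeasurableSpace.comap (ξy k) inferInstance) (past ξx ξy k) P
  indep_x : ∀ k, Indep (MeasurableSpace.comap (ξx k) inferInstance) (pastHalf ξx ξy k) P

/-- `x`, `y`, `d` are the iterates and the `x`-directions generated, from the initial point
`(x₀, y₀)`, by the single-loop stochastic penalty algorithm with penalty parameters `ρ`,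
regularization parameters `σ`, step sizes `α`, `β` and momentum parameters `η`. -/
structure IsRun {n m p : ℕ} {Ω Ξ : Type*} (X : Set (Eu n)) (Y : Set (Eu m))
    (c : Eu n → Eu m → Eu p) (F : Ξ → Eu n → Eu m → ℝ) (ρ σ α β η : ℕ → ℝ)
    (ξx ξy : ℕ → Ω → Ξ) (x₀ : Eu n) (y₀ : Eu m)
    (x : ℕ → Ω → Eu n) (y : ℕ → Ω → Eu m) (d : ℕ → Ω → Eu n) : Prop where
  x_zero : ∀ ω, x 0 ω = x₀
  y_zero : ∀ ω, y 0 ω = y₀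
  y_succ : ∀ k ω, y (k + 1) ω =
    proj Y (y k ω + β k • gradY (penalized (F (ξy k ω)) c (ρ k) (σ k)) (x k ω) (y k ω))
  d_zero : ∀ ω, d 0 ω = gradX (penalized (F (ξx 0 ω)) c (ρ 0) (σ 0)) (x 0 ω) (y 1 ω)
  d_succ : ∀ k ω, d (k + 1) ω =
    (1 - η (k + 1)) •
        (d k ω - gradX (penalized (F (ξx (k + 1) ω)) c (ρ k) (σ k)) (x k ω) (y (k + 1) ω))
      + gradX (penalized (F (ξx (k + 1) ω)) c (ρ (k + 1)) (σ (k + 1)))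
          (x (k + 1) ω) (y (k + 2) ω)
  x_succ : ∀ k ω, x (k + 1) ω = proj X (x k ω - α k • d k ω)

end

end SPACO

/-! The term `-(σ/2)‖y‖²` makes the inner problem `σ_k`-strongly concave. So `y_k*(x)` is unique and
Lipschitz in `x` with constant of order `ρ_k/σ_k ~ k^(2t)`. Danskin's argument then gives `∇φ_k(x) =
∇ₓψ_k(x, y_k*(x))` relative to `X`, with a quadratic upper bound whose constant is of order
`ρ_k²/σ_k ~ k^(3t)`.

Write `δ_k = 𝔼‖y^k - y_k*(x^k)‖²`, `u_k = 𝔼‖y^(k+1) - y_k*(x^k)‖²`, `S_k = 𝔼‖x^(k+1) - x^k‖²`, and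
let `w_k` be the mean square error of `d_x^k` as an estimator of `∇ₓψ_k(x^k, y^(k+1))`. Up to
constants, for large `k`: (a) `𝔼φ_k(x^k)` changes by at most `k^(-6t-s) w_k + k^(-4t-s) u_k +
k^(-t-1) - k^(6t+s) S_k` (`rate_descent`); (b) the projected ascent step contracts, `u_k ≤ (1 -
k^(-2t-s)) δ_k + k^(-2t-2s)` (`rate_contraction`); (c) the maximizer drifts, `δ_(k+1) ≤ (1 +
k^(-2t-s)/2) u_k + k^(6t+s) S_k + k^(6t+s-2)` (`rate_tracking`); (d) the momentum correction leaves
`w_(k+1) ≤ (1 - k^(-s)) w_k + S_k + k^(-2s)` (`rate_dirError`).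

In `V_k = 𝔼φ_k(x^k) + A k^(-2t) δ_k + E k^(-6t) w_k` the weights match the decrease in (b)-(d) to
the positive terms of (a), while the terms in `S_k` they create are smaller by `k^(-2t)` and are
absorbed for large `k`. With `T_k = 𝔼‖𝒢_k(x^k)‖² + δ_k` and `θ = 2τ`, this gives `k^(-(6t+s)) T_k ≤
M₁ (V_k - V_(k+1)) + O(k^(-(6t+s+θ)))` (`lyapunov_step`).

Since `V` is bounded below and `6t + s + θ < 1`, summing up to `2N` forces some `k` in `[N, 2N)` to
have `T_k = O(N^(-θ))` (`exists_le_of_lyapunov`); Jensen's inequality takes the square root.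
Comparing with a feasible point gives `ρ_k ‖[c(x, y_k*(x))]₊‖² = O(1)`, so the violation at `y^k` is
`O(k^(-t/2))` plus a multiple of the tracking error (`integral_constraint`). Taking `N ~ ε^(-1/τ)`
concludes. -/

namespace SPACO
open Set Filter Topology
open scoped RealInnerProductSpace

/-! ### Euclidean projection onto a closed convex set. -/

section Projection

variable {n : ℕ} {C : Set (Eu n)}

lemma proj_spec (hne : C.Nonempty) (hcl : IsClosed C) (z : Eu n) :
    proj C z ∈ C ∧ ∀ q ∈ C, dist z (proj C z) ≤ dist z q := by
  have h : ∃ p, p ∈ C ∧ ∀ q ∈ C, dist z p ≤ dist z q := by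
    obtain ⟨p, hp, h⟩ := hcl.exists_infDist_eq_dist hne z
    exact ⟨p, hp, fun q hq => h ▸ Metric.infDist_le_dist_of_mem hq⟩
  exact Classical.epsilon_spec h

lemma proj_mem (hne : C.Nonempty) (hcl : IsClosed C) (z : Eu n) : proj C z ∈ C :=
  (proj_spec hne hcl z).1

lemma inner_sub_proj_nonpos (hne : C.Nonempty) (hcl : IsClosed C) (hc : Convex ℝ C) (z : Eu n)
    {q : Eu n} (hq : q ∈ C) : ⟪z - proj C z, q - proj C z⟫ ≤ 0 := by
  obtain ⟨hp, hmin⟩ := proj_spec hne hcl z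
  have : Nonempty C := hne.to_subtype
  refine (norm_eq_iInf_iff_real_inner_le_zero hc hp).1 ?_ q hq
  refine le_antisymm (le_ciInf fun w => ?_) (ciInf_le ⟨0, ?_⟩ (⟨_, hp⟩ : C))
  · simpa [dist_eq_norm] using hmin w w.2
  · rintro _ ⟨w, rfl⟩
    exact norm_nonneg _

/-- A point of `C` satisfying the variational inequality of the projection is the projection. -/
lemma eq_proj_of_inner_nonpos (hne : C.Nonempty) (hcl : IsClosed C) (hc : Convex ℝ C)
    {z p : Eu n} (hp : p ∈ C) (h : ∀ q ∈ C, ⟪z - p, q - p⟫ ≤ 0) : p = proj C z := by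
  have h1 := h _ (proj_mem hne hcl z)
  have h2 := inner_sub_proj_nonpos hne hcl hc z hp
  have h3 : ⟪proj C z - p, proj C z - p⟫ = ⟪z - p, proj C z - p⟫ + ⟪z - proj C z, p - proj C z⟫ := by
    have e1 : proj C z - p = (z - p) - (z - proj C z) := by abel
    have e2 : p - proj C z = -(proj C z - p) := by abel
    rw [e2, inner_neg_right, ← sub_eq_add_neg, ← inner_sub_left, ← e1]
  have h4 : ‖proj C z - p‖ ^ 2 ≤ 0 := by rw [← real_inner_self_eq_norm_sq]; linarith
  have h5 : proj C z - p = 0 := by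
    rw [← norm_eq_zero]; exact pow_eq_zero_iff (two_ne_zero) |>.1 (le_antisymm h4 (sq_nonneg _))
  exact (sub_eq_zero.1 h5).symm

/-- Adding the variational inequalities at the two projections `p`, `q` yields `‖p - q‖² ≤ ⟪z - w, p
- q⟫`; Cauchy–Schwarz finishes. -/
lemma norm_proj_sub_proj_le (hne : C.Nonempty) (hcl : IsClosed C) (hc : Convex ℝ C) (z w : Eu n) :
    ‖proj C z - proj C w‖ ≤ ‖z - w‖ := by
  have h1 := inner_sub_proj_nonpos hne hcl hc z (proj_mem hne hcl w)
  have h2 := inner_sub_proj_nonpos hne hcl hc w (proj_mem hne hcl z)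
  set p := proj C z
  set q := proj C w
  have h3 : ⟪p - q, p - q⟫ = ⟪z - w, p - q⟫ + ⟪z - p, q - p⟫ + ⟪w - q, p - q⟫ := by
    have e2 : q - p = -(p - q) := by abel
    rw [e2, inner_neg_right, ← sub_eq_add_neg, ← inner_sub_left, ← inner_add_left]
    congr 1; abel
  have h4 : ‖p - q‖ ^ 2 ≤ ‖z - w‖ * ‖p - q‖ := by
    rw [← real_inner_self_eq_norm_sq]
    linarith [real_inner_le_norm (z - w) (p - q)]
  by_contra hlt
  push Not at hlt
  nlinarith [norm_nonneg (z - w), norm_nonneg (p - q)]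

lemma proj_eq_self (hcl : IsClosed C) {z : Eu n} (hz : z ∈ C) : proj C z = z := by
  have := (proj_spec ⟨z, hz⟩ hcl z).2 z hz
  rw [dist_self] at this
  exact (dist_le_zero.1 this).symm

lemma continuous_proj (hne : C.Nonempty) (hcl : IsClosed C) (hc : Convex ℝ C) :
    Continuous (proj C) :=
  (LipschitzWith.of_dist_le_mul (K := 1) fun z w => by
    simpa [dist_eq_norm] using norm_proj_sub_proj_le hne hcl hc z w).continuous

end Projection

/-! ### Partial gradients and uniform bounds on `X × Y`. -/

section Gradient

variable {n m : ℕ} {X : Set (Eu n)} {Y : Set (Eu m)} {g : Eu n → Eu m → ℝ}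

lemma hasGradientAt_gradX {x : Eu n} {y : Eu m}
    (h : DifferentiableAt ℝ (fun x' => g x' y) x) :
    HasGradientAt (fun x' => g x' y) (gradX g x y) x := h.hasGradientAt

lemma hasGradientAt_gradY {x : Eu n} {y : Eu m}
    (h : DifferentiableAt ℝ (fun y' => g x y') y) :
    HasGradientAt (fun y' => g x y') (gradY g x y) y := h.hasGradientAt

lemma differentiableAt_left {x : Eu n} {y : Eu m}
    (h : DifferentiableAt ℝ (fun w : Eu n × Eu m => g w.1 w.2) (x, y)) :
    DifferentiableAt ℝ (fun x' => g x' y) x :=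
  (HasFDerivAt.comp (g := fun w : Eu n × Eu m => g w.1 w.2) (f := fun x' => (x', y)) x
    h.hasFDerivAt (hasFDerivAt_prodMk_left x y)).differentiableAt

lemma differentiableAt_right {x : Eu n} {y : Eu m}
    (h : DifferentiableAt ℝ (fun w : Eu n × Eu m => g w.1 w.2) (x, y)) :
    DifferentiableAt ℝ (fun y' => g x y') y :=
  (HasFDerivAt.comp (g := fun w : Eu n × Eu m => g w.1 w.2) (f := fun y' => (x, y')) y
    h.hasFDerivAt (hasFDerivAt_prodMk_right x y)).differentiableAt

lemma toDual_gradX {x : Eu n} {y : Eu m}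
    (h : DifferentiableAt ℝ (fun w : Eu n × Eu m => g w.1 w.2) (x, y)) :
    InnerProductSpace.toDual ℝ _ (gradX g x y) =
      (fderiv ℝ (fun w : Eu n × Eu m => g w.1 w.2) (x, y)).comp
        (ContinuousLinearMap.inl ℝ (Eu n) (Eu m)) := by
  rw [gradX, toDual_gradient]
  exact (HasFDerivAt.comp (g := fun w : Eu n × Eu m => g w.1 w.2) (f := fun x' => (x', y)) x
    h.hasFDerivAt (hasFDerivAt_prodMk_left x y)).fderiv

lemma toDual_gradY {x : Eu n} {y : Eu m}
    (h : DifferentiableAt ℝ (fun w : Eu n × Eu m => g w.1 w.2) (x, y)) :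
    InnerProductSpace.toDual ℝ _ (gradY g x y) =
      (fderiv ℝ (fun w : Eu n × Eu m => g w.1 w.2) (x, y)).comp
        (ContinuousLinearMap.inr ℝ (Eu n) (Eu m)) := by
  rw [gradY, toDual_gradient]
  exact (HasFDerivAt.comp (g := fun w : Eu n × Eu m => g w.1 w.2) (f := fun y' => (x, y')) y
    h.hasFDerivAt (hasFDerivAt_prodMk_right x y)).fderiv

lemma norm_comp_inl_le (A : (Eu n × Eu m) →L[ℝ] ℝ) :
    ‖A.comp (ContinuousLinearMap.inl ℝ (Eu n) (Eu m))‖ ≤ ‖A‖ := by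
  refine ContinuousLinearMap.opNorm_le_bound _ (norm_nonneg _) fun u => ?_
  simpa using A.le_opNorm (u, 0)

lemma norm_comp_inr_le (A : (Eu n × Eu m) →L[ℝ] ℝ) :
    ‖A.comp (ContinuousLinearMap.inr ℝ (Eu n) (Eu m))‖ ≤ ‖A‖ := by
  refine ContinuousLinearMap.opNorm_le_bound _ (norm_nonneg _) fun u => ?_
  simpa using A.le_opNorm (0, u)

/-- On `X × Y` the function `g` is differentiable, and it and its partial gradients are bounded by
`B` and Lipschitz with constant `B`. -/
structure BoundedSmooth (X : Set (Eu n)) (Y : Set (Eu m)) (g : Eu n → Eu m → ℝ) (B : ℝ) :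
    Prop where
  nonneg : 0 ≤ B
  diff : ∀ x ∈ X, ∀ y ∈ Y, DifferentiableAt ℝ (fun w : Eu n × Eu m => g w.1 w.2) (x, y)
  bdd : ∀ x ∈ X, ∀ y ∈ Y, |g x y| ≤ B
  bdd_x : ∀ x ∈ X, ∀ y ∈ Y, ‖gradX g x y‖ ≤ B
  bdd_y : ∀ x ∈ X, ∀ y ∈ Y, ‖gradY g x y‖ ≤ B
  lip : ∀ x ∈ X, ∀ y ∈ Y, ∀ x' ∈ X, ∀ y' ∈ Y, |g x y - g x' y'| ≤ B * (‖x - x'‖ + ‖y - y'‖)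
  lip_x : ∀ x ∈ X, ∀ y ∈ Y, ∀ x' ∈ X, ∀ y' ∈ Y,
    ‖gradX g x y - gradX g x' y'‖ ≤ B * (‖x - x'‖ + ‖y - y'‖)
  lip_y : ∀ x ∈ X, ∀ y ∈ Y, ∀ x' ∈ X, ∀ y' ∈ Y,
    ‖gradY g x y - gradY g x' y'‖ ≤ B * (‖x - x'‖ + ‖y - y'‖)

lemma norm_prod_sub_le (x x' : Eu n) (y y' : Eu m) :
    ‖((x, y) : Eu n × Eu m) - (x', y')‖ ≤ ‖x - x'‖ + ‖y - y'‖ := by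
  rw [Prod.mk_sub_mk, Prod.norm_mk]
  exact max_le (by linarith [norm_nonneg (y - y')]) (by linarith [norm_nonneg (x - x')])

/-- Compactness bounds the function and its derivative, and convexity of `X × Y` turns the
derivative bound into a Lipschitz bound. The partial gradients are the derivative composed with
`inl` and `inr`, which have norm at most one, so they inherit its bounds. -/
lemma exists_boundedSmooth (hX : IsCompact X) (hY : IsCompact Y) (hXc : Convex ℝ X)
    (hYc : Convex ℝ Y)
    (hd : ∀ z ∈ X ×ˢ Y, DifferentiableAt ℝ (fun w : Eu n × Eu m => g w.1 w.2) z)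
    (hl : ∃ L, LipschitzOnWith L (fderiv ℝ fun w : Eu n × Eu m => g w.1 w.2) (X ×ˢ Y)) :
    ∃ B, BoundedSmooth X Y g B := by
  obtain ⟨L, hL⟩ := hl
  have hK : IsCompact (X ×ˢ Y) := hX.prod hY
  obtain ⟨B₁, hB₁⟩ := hK.exists_bound_of_continuousOn
    (f := fun w : Eu n × Eu m => g w.1 w.2) fun z hz => (hd z hz).continuousAt.continuousWithinAt
  obtain ⟨B₂, hB₂⟩ := hK.exists_bound_of_continuousOn hL.continuousOn
  set B := max (max B₁ B₂) (max L 0)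
  have h1 : B₁ ≤ B := (le_max_left _ _).trans (le_max_left _ _)
  have h2 : B₂ ≤ B := (le_max_right _ _).trans (le_max_left _ _)
  have h3 : (L : ℝ) ≤ B := (le_max_left _ _).trans (le_max_right _ _)
  have h0 : 0 ≤ B := (le_max_right _ _).trans (le_max_right _ _)
  have hLip : ∀ x ∈ X, ∀ y ∈ Y, ∀ x' ∈ X, ∀ y' ∈ Y,
      ‖fderiv ℝ (fun w : Eu n × Eu m => g w.1 w.2) (x, y)
        - fderiv ℝ (fun w : Eu n × Eu m => g w.1 w.2) (x', y')‖
        ≤ B * (‖x - x'‖ + ‖y - y'‖) := fun x hx y hy x' hx' y' hy' => by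
    have := hL.dist_le_mul (x, y) ⟨hx, hy⟩ (x', y') ⟨hx', hy'⟩
    rw [dist_eq_norm, dist_eq_norm] at this
    exact this.trans (mul_le_mul h3 (norm_prod_sub_le x x' y y') (norm_nonneg _) h0)
  refine ⟨B, h0, fun x hx y hy => hd _ ⟨hx, hy⟩, fun x hx y hy => (hB₁ (x, y) ⟨hx, hy⟩).trans h1,
    fun x hx y hy => ?_, fun x hx y hy => ?_, fun x hx y hy x' hx' y' hy' => ?_,
    fun x hx y hy x' hx' y' hy' => ?_, fun x hx y hy x' hx' y' hy' => ?_⟩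
  · rw [← (InnerProductSpace.toDual ℝ _).norm_map, toDual_gradX (hd _ ⟨hx, hy⟩)]
    exact (norm_comp_inl_le _).trans ((hB₂ (x, y) ⟨hx, hy⟩).trans h2)
  · rw [← (InnerProductSpace.toDual ℝ _).norm_map, toDual_gradY (hd _ ⟨hx, hy⟩)]
    exact (norm_comp_inr_le _).trans ((hB₂ (x, y) ⟨hx, hy⟩).trans h2)
  · refine ((hXc.prod hYc).norm_image_sub_le_of_norm_hasFDerivWithin_le
      (fun z hz => (hd z hz).hasFDerivAt.hasFDerivWithinAt)
      (fun z hz => (hB₂ z hz).trans h2) (⟨hx', hy'⟩ : (x', y') ∈ X ×ˢ Y)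
      (⟨hx, hy⟩ : (x, y) ∈ X ×ˢ Y)).trans ?_
    exact mul_le_mul_of_nonneg_left (norm_prod_sub_le x x' y y') h0
  · rw [← (InnerProductSpace.toDual ℝ _).norm_map, map_sub, toDual_gradX (hd _ ⟨hx, hy⟩),
      toDual_gradX (hd _ ⟨hx', hy'⟩), ← ContinuousLinearMap.sub_comp]
    exact (norm_comp_inl_le _).trans (hLip x hx y hy x' hx' y' hy')
  · rw [← (InnerProductSpace.toDual ℝ _).norm_map, map_sub, toDual_gradY (hd _ ⟨hx, hy⟩),
      toDual_gradY (hd _ ⟨hx', hy'⟩), ← ContinuousLinearMap.sub_comp]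
    exact (norm_comp_inr_le _).trans (hLip x hx y hy x' hx' y' hy')

end Gradient

end SPACO

namespace SPACO
open Set Filter Topology
open scoped RealInnerProductSpace

/-! ### The squared positive part is `C^{1,1}`. -/

section Penalty

/-- Second-order Taylor estimate for `v ↦ [v]₊²/2`, valid across the kink at `0`; it is what makes
the penalty differentiable there. -/
lemma abs_half_sq_max_sub_le (u v : ℝ) :
    |(max v 0) ^ 2 / 2 - (max u 0) ^ 2 / 2 - max u 0 * (v - u)| ≤ (v - u) ^ 2 / 2 := by
  rcases le_total v 0 with hv | hv <;> rcases le_total u 0 with hu | hu <;>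
    simp only [max_eq_left, max_eq_right, hu, hv] <;> rw [abs_le] <;> constructor <;> nlinarith

lemma hasDerivAt_half_sq_max (u : ℝ) :
    HasDerivAt (fun v : ℝ => (max v 0) ^ 2 / 2) (max u 0) u := by
  have h : (fun v : ℝ => (max v 0) ^ 2 / 2 - (max u 0) ^ 2 / 2 - max u 0 * (v - u))
      =O[𝓝 u] fun v => ‖v - u‖ ^ 2 := by
    refine Asymptotics.IsBigO.of_bound 1 (Eventually.of_forall fun v => ?_)
    rw [Real.norm_eq_abs, Real.norm_eq_abs, Real.norm_eq_abs, sq_abs, abs_sq]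
    linarith [abs_half_sq_max_sub_le u v, sq_nonneg (v - u)]
  have h1 := (h.hasFDerivAt (by norm_num)).hasDerivAt
  have h2 := (h1.add (((hasDerivAt_id u).sub_const u).const_mul (max u 0))).add_const
    ((max u 0) ^ 2 / 2)
  simp only [zero_apply, zero_add, mul_one] at h2
  refine h2.congr_of_eventuallyEq (Eventually.of_forall fun v => ?_)
  simp

variable {E : Type*} [NormedAddCommGroup E] [NormedSpace ℝ E]

lemma hasFDerivAt_half_sq_max {g : E → ℝ} {z : E} (h : DifferentiableAt ℝ g z) :
    HasFDerivAt (fun w => (max (g w) 0) ^ 2 / 2) (max (g z) 0 • fderiv ℝ g z) z :=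
  (hasDerivAt_half_sq_max (g z)).comp_hasFDerivAt z h.hasFDerivAt

/-- The derivative is the product `[g]₊ · Dg` of two bounded Lipschitz maps on `K`: `[g]₊` is
Lipschitz by the mean value inequality and `Dg` by hypothesis. -/
lemma lipschitzOnWith_fderiv_half_sq_max {K : Set E} (hK : IsCompact K) (hKc : Convex ℝ K)
    {g : E → ℝ} (hd : ∀ z ∈ K, DifferentiableAt ℝ g z)
    (hl : ∃ L, LipschitzOnWith L (fderiv ℝ g) K) :
    ∃ L, LipschitzOnWith L (fderiv ℝ fun w => (max (g w) 0) ^ 2 / 2) K := by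
  obtain ⟨L, hL⟩ := hl
  obtain ⟨B₁, hB₁⟩ := hK.exists_bound_of_continuousOn
    fun z hz => (hd z hz).continuousAt.continuousWithinAt
  obtain ⟨B₂, hB₂⟩ := hK.exists_bound_of_continuousOn hL.continuousOn
  refine ⟨(|B₂| * |B₂| + |B₁| * L).toNNReal, LipschitzOnWith.of_dist_le_mul fun z hz w hw => ?_⟩
  rw [Real.coe_toNNReal _ (by positivity), (hasFDerivAt_half_sq_max (hd z hz)).fderiv,
    (hasFDerivAt_half_sq_max (hd w hw)).fderiv, dist_eq_norm, dist_eq_norm]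
  have e : max (g z) 0 • fderiv ℝ g z - max (g w) 0 • fderiv ℝ g w
      = (max (g z) 0 - max (g w) 0) • fderiv ℝ g z + max (g w) 0 • (fderiv ℝ g z - fderiv ℝ g w) := by
    rw [sub_smul, smul_sub]; abel
  have h1 : |max (g z) 0 - max (g w) 0| ≤ |B₂| * ‖z - w‖ := by
    refine (abs_max_sub_max_le_abs _ _ _).trans ?_
    exact hKc.norm_image_sub_le_of_norm_hasFDerivWithin_le
      (fun z hz => (hd z hz).hasFDerivAt.hasFDerivWithinAt)
      (fun z hz => (hB₂ z hz).trans (le_abs_self _)) hw hz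
  have h2 : |max (g w) 0| ≤ |B₁| := by
    have h := (hB₁ w hw).trans (le_abs_self _)
    rw [Real.norm_eq_abs] at h
    rw [abs_of_nonneg (le_max_right _ _)]
    exact max_le ((le_abs_self _).trans h) (abs_nonneg _)
  have h3 : ‖fderiv ℝ g z - fderiv ℝ g w‖ ≤ L * ‖z - w‖ := by
    simpa [dist_eq_norm] using hL.dist_le_mul z hz w hw
  rw [e]
  calc _ ≤ |max (g z) 0 - max (g w) 0| * ‖fderiv ℝ g z‖
        + |max (g w) 0| * ‖fderiv ℝ g z - fderiv ℝ g w‖ := by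
        refine (norm_add_le _ _).trans ?_
        rw [norm_smul, norm_smul, Real.norm_eq_abs, Real.norm_eq_abs]
    _ ≤ (|B₂| * ‖z - w‖) * |B₂| + |B₁| * (L * ‖z - w‖) := by
        gcongr
        exact (hB₂ z hz).trans (le_abs_self _)
    _ = _ := by ring

end Penalty

/-! ### The penalized objective and its gradients. -/

section Penalized

variable {n m p : ℕ} {X : Set (Eu n)} {Y : Set (Eu m)} {f g : Eu n → Eu m → ℝ}
  {c : Eu n → Eu m → Eu p} {B ρ σ : ℝ}

/-- The quadratic penalty `½ ‖[c(x,y)]₊‖²`. -/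
noncomputable def penalty (c : Eu n → Eu m → Eu p) (x : Eu n) (y : Eu m) : ℝ := ‖posPart (c x y)‖ ^ 2 / 2

lemma penalized_eq (g : Eu n → Eu m → ℝ) (c : Eu n → Eu m → Eu p) (ρ σ : ℝ) (x : Eu n)
    (y : Eu m) : penalized g c ρ σ x y = g x y - ρ * penalty c x y - σ / 2 * ‖y‖ ^ 2 := by
  simp only [penalized, penalty]; ring

lemma penalty_eq_sum (x : Eu n) (y : Eu m) :
    penalty c x y = ∑ i, (max (c x y i) 0) ^ 2 / 2 := by
  simp [penalty, EuclideanSpace.norm_sq_eq, posPart, Finset.sum_div]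

lemma penalty_nonneg (x : Eu n) (y : Eu m) : 0 ≤ penalty c x y := by
  unfold penalty; positivity

lemma exists_boundedSmooth_penalty (h : StandingAssumptions X Y f c) :
    ∃ B, BoundedSmooth X Y (penalty c) B := by
  have e : (fun w : Eu n × Eu m => penalty c w.1 w.2)
      = fun w => ∑ i, (max (c w.1 w.2 i) 0) ^ 2 / 2 := funext fun w => penalty_eq_sum _ _
  have hK := h.X_compact.prod h.Y_compact
  have hKc := h.X_convex.prod h.Y_convex
  have hd : ∀ i, ∀ z ∈ X ×ˢ Y,
      DifferentiableAt ℝ (fun w : Eu n × Eu m => (max (c w.1 w.2 i) 0) ^ 2 / 2) z :=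
    fun i z hz => (hasFDerivAt_half_sq_max (h.c_diff i z hz)).differentiableAt
  refine exists_boundedSmooth h.X_compact h.Y_compact h.X_convex h.Y_convex ?_ ?_
  · intro z hz
    rw [e]
    exact DifferentiableAt.fun_sum fun i _ => hd i z hz
  · choose L hL using fun i =>
      lipschitzOnWith_fderiv_half_sq_max hK hKc (h.c_diff i) (h.c_lip i)
    refine ⟨∑ i, L i, LipschitzOnWith.of_dist_le_mul fun z hz w hw => ?_⟩
    rw [e, fderiv_fun_sum fun i _ => hd i z hz, fderiv_fun_sum fun i _ => hd i w hw, dist_eq_norm,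
      ← Finset.sum_sub_distrib, NNReal.coe_sum, Finset.sum_mul]
    refine (norm_sum_le _ _).trans (Finset.sum_le_sum fun i _ => ?_)
    rw [← dist_eq_norm]
    exact (hL i).dist_le_mul z hz w hw

/-- Each `[c_i]₊` is a supremum of convex functions and is nonnegative, so its square is convex as
well. -/
lemma convexOn_penalty (h : StandingAssumptions X Y f c) {x : Eu n} (hx : x ∈ X) :
    ConvexOn ℝ Y (penalty c x) := by
  have e : penalty c x = fun y => ∑ i, (max (c x y i) 0) ^ 2 / 2 := funext fun y => penalty_eq_sum _ _
  rw [e]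
  have hsum : ∀ s : Finset (Fin p), (∀ i ∈ s, ConvexOn ℝ Y fun y => (max (c x y i) 0) ^ 2 / 2) →
      ConvexOn ℝ Y fun y => ∑ i ∈ s, (max (c x y i) 0) ^ 2 / 2 := by
    classical
    intro s
    induction s using Finset.induction_on with
    | empty => exact fun _ => by simpa using convexOn_const 0 h.Y_convex
    | insert a s ha ih =>
      intro hs
      simp only [Finset.sum_insert ha]
      exact (hs a (Finset.mem_insert_self a s)).add
        (ih fun i hi => hs i (Finset.mem_insert_of_mem hi))
  refine hsum Finset.univ fun i _ => ?_
  have h1 : ConvexOn ℝ Y fun y => max (c x y i) 0 :=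
    (h.c_convex i x hx).sup (convexOn_const 0 h.Y_convex)
  have h2 := (h1.pow (fun _ _ => le_max_right _ _) 2).smul (c := (1 / 2 : ℝ)) (by norm_num)
  refine h2.congr fun y _ => ?_
  simp; ring

lemma norm_posPart_sub_le (u v : Eu p) : ‖posPart u - posPart v‖ ≤ ∑ i, |u i - v i| := by
  have h : ‖posPart u - posPart v‖ ^ 2 ≤ (∑ i, |u i - v i|) ^ 2 := by
    rw [EuclideanSpace.norm_sq_eq]
    refine le_trans (Finset.sum_le_sum fun i _ => ?_)
      (Finset.sum_sq_le_sq_sum_of_nonneg fun i _ => abs_nonneg _)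
    rw [Real.norm_eq_abs]
    exact pow_le_pow_left₀ (abs_nonneg _) (abs_max_sub_max_le_abs _ _ _) 2
  exact le_of_sq_le_sq h (Finset.sum_nonneg fun i _ => abs_nonneg _)

lemma BoundedSmooth.mono {B B' : ℝ} (h : BoundedSmooth X Y g B) (hB : B ≤ B') :
    BoundedSmooth X Y g B' where
  nonneg := h.nonneg.trans hB
  diff := h.diff
  bdd x hx y hy := (h.bdd x hx y hy).trans hB
  bdd_x x hx y hy := (h.bdd_x x hx y hy).trans hB
  bdd_y x hx y hy := (h.bdd_y x hx y hy).trans hB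
  lip x hx y hy x' hx' y' hy' := (h.lip x hx y hy x' hx' y' hy').trans (mul_le_mul_of_nonneg_right hB (by positivity))
  lip_x x hx y hy x' hx' y' hy' := (h.lip_x x hx y hy x' hx' y' hy').trans (mul_le_mul_of_nonneg_right hB (by positivity))
  lip_y x hx y hy x' hx' y' hy' := (h.lip_y x hx y hy x' hx' y' hy').trans (mul_le_mul_of_nonneg_right hB (by positivity))

/-- The standing assumptions in quantitative form, with a single constant `B`. -/
structure Regular (X : Set (Eu n)) (Y : Set (Eu m)) (f : Eu n → Eu m → ℝ)
    (c : Eu n → Eu m → Eu p) (B : ℝ) : Prop where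
  one_le : 1 ≤ B
  X_nonempty : X.Nonempty
  X_convex : Convex ℝ X
  X_closed : IsClosed X
  Y_nonempty : Y.Nonempty
  Y_convex : Convex ℝ Y
  Y_compact : IsCompact Y
  X_bdd : ∀ x ∈ X, ‖x‖ ≤ B
  Y_bdd : ∀ y ∈ Y, ‖y‖ ≤ B
  smooth_f : BoundedSmooth X Y f B
  smooth_q : BoundedSmooth X Y (penalty c) B
  f_concave : ∀ x ∈ X, ConcaveOn ℝ Y (f x)
  q_convex : ∀ x ∈ X, ConvexOn ℝ Y (penalty c x)
  feasible : ∀ x ∈ X, ∃ y ∈ Y, penalty c x y = 0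
  lip_posPart : ∀ x ∈ X, ∀ y ∈ Y, ∀ x' ∈ X, ∀ y' ∈ Y,
    ‖posPart (c x y) - posPart (c x' y')‖ ≤ B * (‖x - x'‖ + ‖y - y'‖)

lemma StandingAssumptions.exists_regular (h : StandingAssumptions X Y f c) :
    ∃ B, Regular X Y f c B := by
  obtain ⟨B₁, h₁⟩ := exists_boundedSmooth h.X_compact h.Y_compact h.X_convex h.Y_convex h.f_diff
    h.f_lip
  obtain ⟨B₂, h₂⟩ := exists_boundedSmooth_penalty h
  have h₃' : ∀ i, ∃ B, BoundedSmooth X Y (fun x y => c x y i) B := fun i =>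
    exists_boundedSmooth h.X_compact h.Y_compact h.X_convex h.Y_convex (h.c_diff i) (h.c_lip i)
  choose B₃ h₃ using h₃'
  obtain ⟨B₄, h₄⟩ := h.X_compact.isBounded.exists_norm_le
  obtain ⟨B₅, h₅⟩ := h.Y_compact.isBounded.exists_norm_le
  set S := ∑ i, B₃ i
  have hS : 0 ≤ S := Finset.sum_nonneg fun i _ => (h₃ i).nonneg
  set B := 1 + B₁ + B₂ + S + |B₄| + |B₅|
  have a₁ := h₁.nonneg
  have a₂ := h₂.nonneg
  have a₄ := abs_nonneg B₄
  have a₅ := abs_nonneg B₅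
  refine ⟨B, by linarith, h.X_nonempty, h.X_convex, h.X_compact.isClosed, h.Y_nonempty, h.Y_convex,
    h.Y_compact, fun x hx => (h₄ x hx).trans (by linarith [le_abs_self B₄]),
    fun y hy => (h₅ y hy).trans (by linarith [le_abs_self B₅]), h₁.mono (by linarith),
    h₂.mono (by linarith), h.f_concave, fun x hx => convexOn_penalty h hx, fun x hx => ?_,
    fun x hx y hy x' hx' y' hy' => ?_⟩
  · obtain ⟨y, hy, hc⟩ := h.feasible x hx
    refine ⟨y, hy, ?_⟩
    rw [penalty_eq_sum]
    exact Finset.sum_eq_zero fun i _ => by simp [max_eq_right (hc i)]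
  · refine (norm_posPart_sub_le _ _).trans
      ((Finset.sum_le_sum fun i _ => (h₃ i).lip x hx y hy x' hx' y' hy').trans ?_)
    rw [← Finset.sum_mul]
    exact mul_le_mul_of_nonneg_right (by linarith) (by positivity)

lemma gradX_penalized {x : Eu n} {y : Eu m} (hg : DifferentiableAt ℝ (fun x' => g x' y) x)
    (hq : DifferentiableAt ℝ (fun x' => penalty c x' y) x) :
    gradX (penalized g c ρ σ) x y = gradX g x y - ρ • gradX (penalty c) x y := by
  have h : HasFDerivAt (fun x' => g x' y - ρ * penalty c x' y - σ / 2 * ‖y‖ ^ 2)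
      (fderiv ℝ (fun x' => g x' y) x - ρ • fderiv ℝ (fun x' => penalty c x' y) x) x :=
    (hg.hasFDerivAt.sub (hq.hasFDerivAt.const_mul ρ)).sub_const _
  have e : (fun x' => penalized g c ρ σ x' y)
      = fun x' => g x' y - ρ * penalty c x' y - σ / 2 * ‖y‖ ^ 2 :=
    funext fun x' => penalized_eq _ _ _ _ _ _
  simp only [gradX, gradient, e, h.fderiv, map_sub, map_smul]

lemma gradY_penalized {x : Eu n} {y : Eu m} (hg : DifferentiableAt ℝ (fun y' => g x y') y)
    (hq : DifferentiableAt ℝ (fun y' => penalty c x y') y) :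
    gradY (penalized g c ρ σ) x y = gradY g x y - ρ • gradY (penalty c) x y - σ • y := by
  have h1 : HasFDerivAt (fun y' : Eu m => ‖y'‖ ^ 2) (2 • innerSL ℝ y) y :=
    (hasStrictFDerivAt_norm_sq y).hasFDerivAt
  have h : HasFDerivAt (fun y' => g x y' - ρ * penalty c x y' - σ / 2 * ‖y'‖ ^ 2)
      (fderiv ℝ (fun y' => g x y') y - ρ • fderiv ℝ (fun y' => penalty c x y') y
        - (σ / 2) • (2 • innerSL ℝ y)) y :=
    (hg.hasFDerivAt.sub (hq.hasFDerivAt.const_mul ρ)).sub (h1.const_mul _)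
  have e : (fun y' => penalized g c ρ σ x y')
      = fun y' => g x y' - ρ * penalty c x y' - σ / 2 * ‖y'‖ ^ 2 :=
    funext fun x' => penalized_eq _ _ _ _ _ _
  have e2 : (σ / 2) • ((2 : ℕ) • innerSL ℝ y) = σ • InnerProductSpace.toDual ℝ (Eu m) y := by
    ext v
    simp; ring
  simp only [gradY, gradient, e, h.fderiv, map_sub, map_smul, e2,
    LinearIsometryEquiv.symm_apply_apply]

end Penalized

/-! ### First-order characterization of concavity. -/

section Concave

/-- On the segment from `y` to `y'` this is the one-variable fact that a chord slope is at most the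
derivative at the left end. -/
lemma concaveOn_le_add_inner {m : ℕ} {Y : Set (Eu m)} {g : Eu m → ℝ} (h : ConcaveOn ℝ Y g)
    {y y' v : Eu m} (hy : y ∈ Y) (hy' : y' ∈ Y) (hg : HasGradientAt g v y) :
    g y' ≤ g y + ⟪v, y' - y⟫ := by
  have h1 : ConcaveOn ℝ (Icc (0 : ℝ) 1) (g ∘ AffineMap.lineMap y y') :=
    (h.comp_affineMap (AffineMap.lineMap y y')).subset
      (fun t ht => h.1.lineMap_mem hy hy' ht) (convex_Icc 0 1)
  have h2 : HasDerivAt (g ∘ AffineMap.lineMap y y') ⟪v, y' - y⟫ (0 : ℝ) := by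
    have hg' : HasFDerivAt g (InnerProductSpace.toDual ℝ _ v) (AffineMap.lineMap y y' (0 : ℝ)) := by
      simpa using hg.hasFDerivAt
    have := hg'.comp_hasDerivAt (0 : ℝ) (AffineMap.hasDerivAt_lineMap (a := y) (b := y'))
    simpa using this
  have h3 := h1.slope_le_of_hasDerivWithinAt (x := 0) (y := 1) (by simp) (by simp) one_pos
    h2.hasDerivWithinAt
  simp [slope_def_field] at h3
  linarith

end Concave

end SPACO

namespace SPACO
open Set Filter Topology
open scoped RealInnerProductSpace

/-! ### Strong concavity, stability of the maximizer, and Danskin's theorem. -/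

namespace Regular

variable {n m p : ℕ} {X : Set (Eu n)} {Y : Set (Eu m)} {f : Eu n → Eu m → ℝ}
  {c : Eu n → Eu m → Eu p} {B ρ σ ρ' σ' : ℝ} {x x' : Eu n} {y y' : Eu m}

lemma gradX_eq (hr : Regular X Y f c B) (hx : x ∈ X) (hy : y ∈ Y) :
    gradX (penalized f c ρ σ) x y = gradX f x y - ρ • gradX (penalty c) x y :=
  gradX_penalized (differentiableAt_left (hr.smooth_f.diff x hx y hy))
    (differentiableAt_left (hr.smooth_q.diff x hx y hy))

lemma gradY_eq (hr : Regular X Y f c B) (hx : x ∈ X) (hy : y ∈ Y) :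
    gradY (penalized f c ρ σ) x y = gradY f x y - ρ • gradY (penalty c) x y - σ • y :=
  gradY_penalized (differentiableAt_right (hr.smooth_f.diff x hx y hy))
    (differentiableAt_right (hr.smooth_q.diff x hx y hy))

lemma hasGradientAt_x (hr : Regular X Y f c B) (hx : x ∈ X) (hy : y ∈ Y) :
    HasGradientAt (fun x' => penalized f c ρ σ x' y) (gradX (penalized f c ρ σ) x y) x := by
  refine hasGradientAt_gradX ?_
  have e : (fun x' => penalized f c ρ σ x' y)
      = fun x' => f x' y - ρ * penalty c x' y - σ / 2 * ‖y‖ ^ 2 :=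
    funext fun x' => penalized_eq _ _ _ _ _ _
  rw [e]
  exact ((differentiableAt_left (hr.smooth_f.diff x hx y hy)).sub
    ((differentiableAt_left (hr.smooth_q.diff x hx y hy)).const_mul ρ)).sub_const _

lemma hasGradientAt_y (hr : Regular X Y f c B) (hx : x ∈ X) (hy : y ∈ Y) :
    HasGradientAt (fun y' => penalized f c ρ σ x y') (gradY (penalized f c ρ σ) x y) y := by
  refine hasGradientAt_gradY ?_
  have e : (fun y' => penalized f c ρ σ x y')
      = fun y' => f x y' - ρ * penalty c x y' - σ / 2 * ‖y'‖ ^ 2 :=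
    funext fun x' => penalized_eq _ _ _ _ _ _
  rw [e]
  exact ((differentiableAt_right (hr.smooth_f.diff x hx y hy)).sub
    ((differentiableAt_right (hr.smooth_q.diff x hx y hy)).const_mul ρ)).sub
    ((differentiableAt_id.norm_sq ℝ).const_mul _)

lemma nonneg (hr : Regular X Y f c B) : 0 ≤ B := zero_le_one.trans hr.one_le

lemma lip_gradX (hr : Regular X Y f c B) (hρ : 0 < ρ) (hx : x ∈ X) (hy : y ∈ Y)
    (hx' : x' ∈ X) (hy' : y' ∈ Y) :
    ‖gradX (penalized f c ρ σ) x y - gradX (penalized f c ρ σ) x' y'‖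
      ≤ B * (1 + ρ) * (‖x - x'‖ + ‖y - y'‖) := by
  rw [hr.gradX_eq hx hy, hr.gradX_eq hx' hy']
  have e : gradX f x y - ρ • gradX (penalty c) x y - (gradX f x' y' - ρ • gradX (penalty c) x' y')
      = (gradX f x y - gradX f x' y') - ρ • (gradX (penalty c) x y - gradX (penalty c) x' y') := by
    rw [smul_sub]; abel
  rw [e]
  refine (norm_sub_le _ _).trans ?_
  rw [norm_smul, Real.norm_eq_abs, abs_of_pos hρ]
  have h1 := hr.smooth_f.lip_x x hx y hy x' hx' y' hy'
  have h2 := mul_le_mul_of_nonneg_left (hr.smooth_q.lip_x x hx y hy x' hx' y' hy') hρ.le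
  linarith

/-- The base point and the parameters move together at a fixed `y`. This is the perturbation that
displaces the maximizer from one iteration to the next. -/
lemma gradY_sub_le (hr : Regular X Y f c B) (hρ : 0 < ρ) (hx : x ∈ X) (hy : y ∈ Y)
    (hx' : x' ∈ X) :
    ‖gradY (penalized f c ρ σ) x y - gradY (penalized f c ρ' σ') x' y‖
      ≤ B * (1 + ρ) * ‖x - x'‖ + B * (|ρ' - ρ| + |σ' - σ|) := by
  rw [hr.gradY_eq hx hy, hr.gradY_eq hx' hy]
  have e : gradY f x y - ρ • gradY (penalty c) x y - σ • y
        - (gradY f x' y - ρ' • gradY (penalty c) x' y - σ' • y)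
      = (gradY f x y - gradY f x' y) + (-ρ) • (gradY (penalty c) x y - gradY (penalty c) x' y)
        + (ρ' - ρ) • gradY (penalty c) x' y + (σ' - σ) • y := by
    module
  rw [e]
  refine (norm_add_le _ _).trans ?_
  refine (add_le_add_left ((norm_add_le _ _).trans
    (add_le_add_left (norm_add_le _ _) _)) _).trans ?_
  rw [norm_smul, norm_smul, norm_smul, norm_neg, Real.norm_eq_abs, Real.norm_eq_abs,
    Real.norm_eq_abs, abs_of_pos hρ]
  have h1 := hr.smooth_f.lip_y x hx y hy x' hx' y hy
  have h2 := mul_le_mul_of_nonneg_left (hr.smooth_q.lip_y x hx y hy x' hx' y hy) hρ.le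
  have h3 := mul_le_mul_of_nonneg_left (hr.smooth_q.bdd_y x' hx' y hy) (abs_nonneg (ρ' - ρ))
  have h4 := mul_le_mul_of_nonneg_left (hr.Y_bdd y hy) (abs_nonneg (σ' - σ))
  rw [sub_self, norm_zero, add_zero] at h1 h2
  linarith

lemma lip_gradY (hr : Regular X Y f c B) (hρ : 0 < ρ) (hσ : 0 < σ) (hx : x ∈ X) (hy : y ∈ Y)
    (hy' : y' ∈ Y) :
    ‖gradY (penalized f c ρ σ) x y - gradY (penalized f c ρ σ) x y'‖
      ≤ B * (1 + ρ + σ) * ‖y - y'‖ := by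
  rw [hr.gradY_eq hx hy, hr.gradY_eq hx hy']
  have e : gradY f x y - ρ • gradY (penalty c) x y - σ • y
        - (gradY f x y' - ρ • gradY (penalty c) x y' - σ • y')
      = (gradY f x y - gradY f x y') + (-ρ) • (gradY (penalty c) x y - gradY (penalty c) x y')
        + (-σ) • (y - y') := by
    module
  rw [e]
  refine (norm_add_le _ _).trans ?_
  refine (add_le_add_left (norm_add_le _ _) _).trans ?_
  rw [norm_smul, norm_smul, norm_neg, norm_neg, Real.norm_eq_abs, Real.norm_eq_abs,
    abs_of_pos hρ, abs_of_pos hσ]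
  have h1 := hr.smooth_f.lip_y x hx y hy x hx y' hy'
  have h2 := mul_le_mul_of_nonneg_left (hr.smooth_q.lip_y x hx y hy x hx y' hy') hρ.le
  have h3 : σ * ‖y - y'‖ ≤ B * σ * ‖y - y'‖ := by
    rw [mul_assoc]
    exact le_mul_of_one_le_left (by positivity) hr.one_le
  rw [sub_self, norm_zero, zero_add] at h1 h2
  linarith

lemma norm_gradY_le (hr : Regular X Y f c B) (hρ : 0 < ρ) (hσ : 0 < σ) (hx : x ∈ X) (hy : y ∈ Y) :
    ‖gradY (penalized f c ρ σ) x y‖ ≤ B * (1 + ρ + σ) := by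
  rw [hr.gradY_eq hx hy]
  refine (norm_sub_le _ _).trans ?_
  refine (add_le_add_left (norm_sub_le _ _) _).trans ?_
  rw [norm_smul, norm_smul, Real.norm_eq_abs, Real.norm_eq_abs, abs_of_pos hρ, abs_of_pos hσ]
  have h1 := hr.smooth_f.bdd_y x hx y hy
  have h2 := mul_le_mul_of_nonneg_left (hr.smooth_q.bdd_y x hx y hy) hρ.le
  have h3 := mul_le_mul_of_nonneg_left (hr.Y_bdd y hy) hσ.le
  linarith

/-- Quadratic two-sided expansion of `ψ(·, y)` on `X`. -/
lemma abs_expansion_x_le (hr : Regular X Y f c B) (hρ : 0 < ρ) (hx : x ∈ X) (hx' : x' ∈ X)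
    (hy : y ∈ Y) :
    |penalized f c ρ σ x' y - penalized f c ρ σ x y
      - ⟪gradX (penalized f c ρ σ) x y, x' - x⟫| ≤ B * (1 + ρ) * ‖x' - x‖ ^ 2 := by
  have hseg : segment ℝ x x' ⊆ X := hr.X_convex.segment_subset hx hx'
  have hB := hr.nonneg
  have h := (convex_segment x x').norm_image_sub_le_of_norm_hasFDerivWithin_le'
    (f := fun x' => penalized f c ρ σ x' y)
    (φ := InnerProductSpace.toDual ℝ _ (gradX (penalized f c ρ σ) x y))
    (C := B * (1 + ρ) * ‖x' - x‖)
    (fun z hz => (hr.hasGradientAt_x (hseg hz) hy).hasFDerivAt.hasFDerivWithinAt)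
    (fun z hz => by
      rw [← map_sub, (InnerProductSpace.toDual ℝ _).norm_map]
      refine (hr.lip_gradX hρ (hseg hz) hy hx hy).trans ?_
      rw [sub_self, norm_zero, add_zero]
      gcongr
      rw [norm_sub_rev]
      obtain ⟨t, ht, rfl⟩ := (segment_eq_image' ℝ x x') ▸ hz
      rw [sub_add_cancel_left, norm_neg, norm_smul, Real.norm_eq_abs, abs_of_nonneg ht.1]
      exact mul_le_of_le_one_left (norm_nonneg _) ht.2)
    (left_mem_segment ℝ x x') (right_mem_segment ℝ x x')
  rw [InnerProductSpace.toDual_apply_apply, Real.norm_eq_abs] at h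
  linarith

/-- The first-order inequalities at `y` and `y'` add up to monotonicity of the gradients of `f` and
of the penalty; the regularizer contributes exactly `-σ‖y - y'‖²`. -/
lemma strongMono (hr : Regular X Y f c B) (hρ : 0 < ρ) (hx : x ∈ X) (hy : y ∈ Y)
    (hy' : y' ∈ Y) :
    ⟪gradY (penalized f c ρ σ) x y - gradY (penalized f c ρ σ) x y', y - y'⟫
      ≤ -σ * ‖y - y'‖ ^ 2 := by
  have f1 := concaveOn_le_add_inner (hr.f_concave x hx) hy hy'
    (hasGradientAt_gradY (differentiableAt_right (hr.smooth_f.diff x hx y hy)))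
  have f2 := concaveOn_le_add_inner (hr.f_concave x hx) hy' hy
    (hasGradientAt_gradY (differentiableAt_right (hr.smooth_f.diff x hx y' hy')))
  have hq : ∀ z ∈ Y, HasGradientAt (-penalty c x) (-gradY (penalty c) x z) z := fun z hz => by
    have := (hasGradientAt_gradY (differentiableAt_right (hr.smooth_q.diff x hx z hz))).hasFDerivAt.neg
    rw [hasGradientAt_iff_hasFDerivAt, map_neg]
    exact this
  have q1 := concaveOn_le_add_inner (hr.q_convex x hx).neg hy hy' (hq y hy)
  have q2 := concaveOn_le_add_inner (hr.q_convex x hx).neg hy' hy (hq y' hy')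
  rw [hr.gradY_eq hx hy, hr.gradY_eq hx hy']
  have e : gradY f x y - ρ • gradY (penalty c) x y - σ • y
        - (gradY f x y' - ρ • gradY (penalty c) x y' - σ • y')
      = (gradY f x y - gradY f x y') - ρ • (gradY (penalty c) x y - gradY (penalty c) x y')
        - σ • (y - y') := by
    module
  have e' : y' - y = -(y - y') := by abel
  rw [e, inner_sub_left, inner_sub_left, inner_smul_left, inner_smul_left,
    real_inner_self_eq_norm_sq, inner_sub_left, inner_sub_left]
  rw [e', inner_neg_right] at f1
  rw [e', inner_neg_right, inner_neg_left, Pi.neg_apply, Pi.neg_apply] at q1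
  rw [inner_neg_left, Pi.neg_apply, Pi.neg_apply] at q2
  simp only [RCLike.conj_to_real]
  have : 0 ≤ ρ * (⟪gradY (penalty c) x y, y - y'⟫ - ⟪gradY (penalty c) x y', y - y'⟫) :=
    mul_nonneg hρ.le (by linarith)
  linarith

lemma exists_isMaxOn (hr : Regular X Y f c B) (ρ σ : ℝ) (hx : x ∈ X) :
    ∃ y, y ∈ Y ∧ IsMaxOn (fun y' => penalized f c ρ σ x y') Y y :=
  hr.Y_compact.exists_isMaxOn hr.Y_nonempty fun _ hy =>
    (hr.hasGradientAt_y hx hy).differentiableAt.continuousAt.continuousWithinAt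

lemma maximizer_mem (hr : Regular X Y f c B) (ρ σ : ℝ) (hx : x ∈ X) :
    maximizer Y (penalized f c ρ σ) x ∈ Y :=
  (Classical.epsilon_spec (hr.exists_isMaxOn ρ σ hx)).1

lemma isMaxOn_maximizer (hr : Regular X Y f c B) (ρ σ : ℝ) (hx : x ∈ X) :
    IsMaxOn (fun y' => penalized f c ρ σ x y') Y (maximizer Y (penalized f c ρ σ) x) :=
  (Classical.epsilon_spec (hr.exists_isMaxOn ρ σ hx)).2

lemma inner_gradY_nonpos (hr : Regular X Y f c B) (hx : x ∈ X) (hy : y ∈ Y)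
    (hmax : IsMaxOn (fun y' => penalized f c ρ σ x y') Y y) (hy' : y' ∈ Y) :
    ⟪gradY (penalized f c ρ σ) x y, y' - y⟫ ≤ 0 := by
  have := hmax.localize.hasFDerivWithinAt_nonpos
    (hr.hasGradientAt_y hx hy).hasFDerivAt.hasFDerivWithinAt
    (sub_mem_posTangentConeAt_of_segment_subset (hr.Y_convex.segment_subset hy hy'))
  rwa [InnerProductSpace.toDual_apply_apply] at this

/-- Perturbation bound for the maximizers of two strongly concave problems. -/
lemma mul_norm_sub_le_of_isMaxOn (hr : Regular X Y f c B) (hρ : 0 < ρ)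
    (hx : x ∈ X) (hy : y ∈ Y) (hmax : IsMaxOn (fun z => penalized f c ρ σ x z) Y y)
    (hx' : x' ∈ X) (hy' : y' ∈ Y) (hmax' : IsMaxOn (fun z => penalized f c ρ' σ' x' z) Y y') :
    σ * ‖y - y'‖ ≤ B * (1 + ρ) * ‖x - x'‖ + B * (|ρ' - ρ| + |σ' - σ|) := by
  have h1 := hr.inner_gradY_nonpos hx hy hmax hy'
  have h2 := hr.inner_gradY_nonpos hx' hy' hmax' hy
  have h3 := hr.strongMono (σ := σ) hρ hx hy hy'
  have e : y' - y = -(y - y') := by abel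
  rw [e, inner_neg_right] at h1
  -- Both gradients are taken at `y'`, the maximizer of the second problem. Strong monotonicity of
  -- the first problem covers the passage from `y` to `y'`, so only its modulus `σ` enters.
  have h4 : ⟪gradY (penalized f c ρ σ) x y' - gradY (penalized f c ρ' σ') x' y', y - y'⟫
      ≤ (B * (1 + ρ) * ‖x - x'‖ + B * (|ρ' - ρ| + |σ' - σ|)) * ‖y - y'‖ :=
    (real_inner_le_norm _ _).trans
      (mul_le_mul_of_nonneg_right (hr.gradY_sub_le hρ hx hy' hx') (norm_nonneg _))
  rw [inner_sub_left] at h3 h4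
  rcases (norm_nonneg (y - y')).eq_or_lt with h0 | h0
  · rw [← h0, mul_zero]
    have := hr.nonneg
    positivity
  · refine le_of_mul_le_mul_right ?_ h0
    rw [pow_two] at h3
    linarith

lemma existsUnique_maximizer (hr : Regular X Y f c B) (hρ : 0 < ρ) (hσ : 0 < σ) (hx : x ∈ X) :
    ∃! y, y ∈ Y ∧ IsMaxOn (fun y' => penalized f c ρ σ x y') Y y := by
  obtain ⟨y, hy, hm⟩ := hr.exists_isMaxOn ρ σ hx
  refine ⟨y, ⟨hy, hm⟩, fun z ⟨hz, hzm⟩ => ?_⟩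
  have h := hr.mul_norm_sub_le_of_isMaxOn hρ hx hz hzm hx hy hm
  simp only [sub_self, norm_zero, abs_zero, mul_zero, add_zero] at h
  have h1 : ‖z - y‖ = 0 := le_antisymm (nonpos_of_mul_nonpos_right h hσ) (norm_nonneg _)
  exact sub_eq_zero.1 (norm_eq_zero.1 h1)

lemma norm_maximizer_sub_le (hr : Regular X Y f c B) (hρ : 0 < ρ) (hσ : 0 < σ) (hx : x ∈ X)
    (hx' : x' ∈ X) :
    ‖maximizer Y (penalized f c ρ σ) x - maximizer Y (penalized f c ρ' σ') x'‖
      ≤ B * (1 + ρ) / σ * ‖x - x'‖ + B * (|ρ' - ρ| + |σ' - σ|) / σ := by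
  have h := hr.mul_norm_sub_le_of_isMaxOn hρ hx (hr.maximizer_mem ρ σ hx)
    (hr.isMaxOn_maximizer ρ σ hx) hx' (hr.maximizer_mem ρ' σ' hx') (hr.isMaxOn_maximizer ρ' σ' hx')
  rw [div_mul_eq_mul_div, ← add_div, le_div_iff₀ hσ]
  linarith

lemma lip_maximizer (hr : Regular X Y f c B) (hρ : 0 < ρ) (hσ : 0 < σ) (hx : x ∈ X)
    (hx' : x' ∈ X) :
    ‖maximizer Y (penalized f c ρ σ) x - maximizer Y (penalized f c ρ σ) x'‖
      ≤ B * (1 + ρ) / σ * ‖x - x'‖ := by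
  have h := hr.norm_maximizer_sub_le (ρ' := ρ) (σ' := σ) hρ hσ hx hx'
  simpa using h

lemma maxValue_eq (hr : Regular X Y f c B) (ρ σ : ℝ) (hx : x ∈ X) :
    maxValue Y (penalized f c ρ σ) x
      = penalized f c ρ σ x (maximizer Y (penalized f c ρ σ) x) := by
  have h : IsGreatest ((fun y => penalized f c ρ σ x y) '' Y)
      (penalized f c ρ σ x (maximizer Y (penalized f c ρ σ) x)) := by
    refine ⟨⟨_, hr.maximizer_mem ρ σ hx, rfl⟩, ?_⟩
    rintro _ ⟨y, hy, rfl⟩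
    exact hr.isMaxOn_maximizer ρ σ hx hy
  exact h.csSup_eq

lemma le_maxValue (hr : Regular X Y f c B) (hx : x ∈ X) (hy : y ∈ Y) :
    penalized f c ρ σ x y ≤ maxValue Y (penalized f c ρ σ) x := by
  rw [hr.maxValue_eq ρ σ hx]
  exact hr.isMaxOn_maximizer ρ σ hx hy

/-- A larger penalty only lowers the value, so when the parameters are updated the value function
can grow only through the smaller `σ`. These increments telescope, whereas an estimate through `|ρ'
- ρ|` would not be summable. -/
lemma maxValue_le_of_le (hr : Regular X Y f c B) (hρ : ρ ≤ ρ') (hx : x ∈ X) (hσ : σ' ≤ σ) :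
    maxValue Y (penalized f c ρ' σ') x
      ≤ maxValue Y (penalized f c ρ σ) x + (σ - σ') / 2 * B ^ 2 := by
  have hy := hr.maximizer_mem ρ' σ' hx
  have h1 := hr.le_maxValue (ρ := ρ) (σ := σ) hx hy
  rw [hr.maxValue_eq ρ' σ' hx]
  rw [penalized_eq] at h1 ⊢
  set y := maximizer Y (penalized f c ρ' σ') x
  have h2 : ‖y‖ ^ 2 ≤ B ^ 2 := pow_le_pow_left₀ (norm_nonneg _) (hr.Y_bdd y hy) 2
  have h3 : (σ - σ') / 2 * ‖y‖ ^ 2 ≤ (σ - σ') / 2 * B ^ 2 :=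
    mul_le_mul_of_nonneg_left h2 (by linarith)
  have h4 := mul_le_mul_of_nonneg_right hρ (penalty_nonneg (c := c) x y)
  linarith

lemma maxValue_le (hr : Regular X Y f c B) (hρ : 0 < ρ) (hσ : 0 < σ) (hx : x ∈ X) :
    maxValue Y (penalized f c ρ σ) x ≤ B := by
  have hy := hr.maximizer_mem ρ σ hx
  rw [hr.maxValue_eq ρ σ hx, penalized_eq]
  have h1 := (abs_le.1 (hr.smooth_f.bdd x hx _ hy)).2
  have h2 := mul_nonneg hρ.le (penalty_nonneg (c := c) x (maximizer Y (penalized f c ρ σ) x))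
  have h3 : 0 ≤ σ / 2 * ‖maximizer Y (penalized f c ρ σ) x‖ ^ 2 := by positivity
  linarith

/-- A feasible `y` has zero penalty, hence the lower bound does not depend on `ρ`. It bounds the
Lyapunov function from below and yields `penalty_maximizer_le`. -/
lemma neg_le_maxValue (hr : Regular X Y f c B) (hσ : 0 < σ) (hx : x ∈ X) :
    -(B + σ / 2 * B ^ 2) ≤ maxValue Y (penalized f c ρ σ) x := by
  obtain ⟨y, hy, h0⟩ := hr.feasible x hx
  refine le_trans ?_ (hr.le_maxValue hx hy)
  rw [penalized_eq, h0]
  have h1 := (abs_le.1 (hr.smooth_f.bdd x hx _ hy)).1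
  have h2 : ‖y‖ ^ 2 ≤ B ^ 2 := pow_le_pow_left₀ (norm_nonneg _) (hr.Y_bdd y hy) 2
  have h3 : σ / 2 * ‖y‖ ^ 2 ≤ σ / 2 * B ^ 2 := mul_le_mul_of_nonneg_left h2 (by linarith)
  linarith

lemma penalty_maximizer_le (hr : Regular X Y f c B) (hσ : 0 < σ) (hx : x ∈ X) :
    ρ * penalty c x (maximizer Y (penalized f c ρ σ) x) ≤ 2 * B + σ / 2 * B ^ 2 := by
  have h1 := hr.neg_le_maxValue (ρ := ρ) hσ hx
  have hy := hr.maximizer_mem ρ σ hx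
  rw [hr.maxValue_eq ρ σ hx, penalized_eq] at h1
  have h2 := (abs_le.1 (hr.smooth_f.bdd x hx _ hy)).2
  have h3 : 0 ≤ σ / 2 * ‖maximizer Y (penalized f c ρ σ) x‖ ^ 2 := by positivity
  linarith

/-- The gradient of the value function `φ`. -/
noncomputable def _root_.SPACO.gradMax (Y : Set (Eu m)) (g : Eu n → Eu m → ℝ) (x : Eu n) : Eu n :=
  gradX g x (maximizer Y g x)

/-- Expand `ψ(·, y')` at `x`, where `y'` is the maximizer at `x'`, and use `ψ(x, y') ≤ φ(x)`.
Replacing `∇ₓψ(x, y')` by `∇ₓψ(x, y)` costs the Lipschitz constant of the gradient times that of the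
maximizer, which is the first quadratic coefficient; the second comes from the expansion. -/
lemma maxValue_le_expansion (hr : Regular X Y f c B) (hρ : 0 < ρ) (hσ : 0 < σ) (hx : x ∈ X)
    (hx' : x' ∈ X) :
    maxValue Y (penalized f c ρ σ) x' ≤ maxValue Y (penalized f c ρ σ) x
      + ⟪gradMax Y (penalized f c ρ σ) x, x' - x⟫
      + (B * (1 + ρ) * (B * (1 + ρ) / σ) + B * (1 + ρ)) * ‖x' - x‖ ^ 2 := by
  have hy := hr.maximizer_mem ρ σ hx
  have hy' := hr.maximizer_mem ρ σ hx'
  have h1 := hr.le_maxValue (ρ := ρ) (σ := σ) hx hy'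
  have h2 := (abs_le.1 (hr.abs_expansion_x_le (σ := σ) hρ hx hx' hy')).2
  have h3 := hr.lip_gradX (σ := σ) hρ hx hy' hx hy
  have h4 := hr.lip_maximizer hρ hσ hx' hx
  rw [hr.maxValue_eq ρ σ hx', gradMax]
  set y := maximizer Y (penalized f c ρ σ) x
  set y' := maximizer Y (penalized f c ρ σ) x'
  have hB := hr.nonneg
  rw [sub_self, norm_zero, zero_add] at h3
  have h5 : ⟪gradX (penalized f c ρ σ) x y' - gradX (penalized f c ρ σ) x y, x' - x⟫
      ≤ B * (1 + ρ) * (B * (1 + ρ) / σ * ‖x' - x‖) * ‖x' - x‖ :=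
    (real_inner_le_norm _ _).trans (mul_le_mul_of_nonneg_right
      (h3.trans (mul_le_mul_of_nonneg_left h4 (by positivity))) (norm_nonneg _))
  rw [inner_sub_left] at h5
  nlinarith

/-- Here the maximizer at `x` is kept as a competitor at `x'`, so no stability of the maximizer is
needed. With the upper expansion this sandwiches `φ` up to a quadratic error, which is Danskin's
theorem on `X`. -/
lemma expansion_le_maxValue (hr : Regular X Y f c B) (hρ : 0 < ρ) (hx : x ∈ X)
    (hx' : x' ∈ X) :
    maxValue Y (penalized f c ρ σ) x + ⟪gradMax Y (penalized f c ρ σ) x, x' - x⟫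
      - B * (1 + ρ) * ‖x' - x‖ ^ 2 ≤ maxValue Y (penalized f c ρ σ) x' := by
  have hy := hr.maximizer_mem ρ σ hx
  have h1 := hr.le_maxValue (ρ := ρ) (σ := σ) hx' hy
  have h2 := (abs_le.1 (hr.abs_expansion_x_le (σ := σ) hρ hx hx' hy)).1
  rw [hr.maxValue_eq ρ σ hx, gradMax]
  linarith

lemma hasGradientWithinAt_maxValue (hr : Regular X Y f c B) (hρ : 0 < ρ) (hσ : 0 < σ)
    (hx : x ∈ X) :
    HasGradientWithinAt (maxValue Y (penalized f c ρ σ)) (gradMax Y (penalized f c ρ σ) x) X x := by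
  have hB := hr.nonneg
  set φ := maxValue Y (penalized f c ρ σ)
  set v := gradMax Y (penalized f c ρ σ) x
  have h : (fun x' => φ x' - φ x - ⟪v, x' - x⟫) =O[𝓝[X] x] fun x' => ‖x' - x‖ ^ 2 := by
    refine Asymptotics.IsBigO.of_bound (B * (1 + ρ) * (B * (1 + ρ) / σ) + B * (1 + ρ)) ?_
    filter_upwards [self_mem_nhdsWithin] with x' hx'
    have h1 := hr.maxValue_le_expansion hρ hσ hx hx'
    have h2 := hr.expansion_le_maxValue (σ := σ) hρ hx hx'
    have h3 : 0 ≤ B * (1 + ρ) * (B * (1 + ρ) / σ) * ‖x' - x‖ ^ 2 := by positivity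
    rw [Real.norm_eq_abs, Real.norm_eq_abs, abs_of_nonneg (sq_nonneg ‖x' - x‖), abs_le]
    constructor <;> linarith
  have h1 := Asymptotics.IsBigO.hasFDerivWithinAt (𝕜 := ℝ) h hx (by norm_num)
  have h2 : HasFDerivWithinAt (fun x' => ⟪v, x' - x⟫) (InnerProductSpace.toDual ℝ _ v) X x := by
    have := ((InnerProductSpace.toDual ℝ _ v).hasFDerivWithinAt (s := X) (x := x)).sub_const ⟪v, x⟫
    refine HasFDerivWithinAt.congr' this (fun z _ => ?_) hx
    rw [InnerProductSpace.toDual_apply_apply, inner_sub_right]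
  rw [hasGradientWithinAt_iff_hasFDerivWithinAt]
  have h3 := (h1.add h2).add_const (φ x)
  rw [zero_add] at h3
  refine HasFDerivWithinAt.congr' h3 (fun z _ => ?_) hx
  simp

lemma differentiableOn_maxValue (hr : Regular X Y f c B) (hρ : 0 < ρ) (hσ : 0 < σ) :
    DifferentiableOn ℝ (maxValue Y (penalized f c ρ σ)) X := fun _ hx =>
  (hr.hasGradientWithinAt_maxValue hρ hσ hx).hasFDerivWithinAt.differentiableWithinAt

/-- Two gradients within a convex set agree along the directions of the set. -/
lemma _root_.SPACO.inner_eq_of_hasGradientWithinAt {φ : Eu n → ℝ} {a b z : Eu n} (hX : Convex ℝ X)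
    (hx : x ∈ X) (ha : HasGradientWithinAt φ a X x) (hb : HasGradientWithinAt φ b X x)
    (hz : z ∈ X) : ⟪a, z - x⟫ = ⟪b, z - x⟫ := by
  have key : ∀ a b : Eu n, HasGradientWithinAt φ a X x → HasGradientWithinAt φ b X x →
      ⟪a, z - x⟫ ≤ ⟪b, z - x⟫ := fun a b ha hb => by
    have h1 := ha.hasFDerivWithinAt.sub hb.hasFDerivWithinAt
    have h2 : IsLocalMaxOn (φ - φ) X x := by
      rw [sub_self]
      exact Eventually.of_forall fun _ => le_rfl
    have h3 := h2.hasFDerivWithinAt_nonpos h1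
      (sub_mem_posTangentConeAt_of_segment_subset (hX.segment_subset hx hz))
    rw [← map_sub, InnerProductSpace.toDual_apply_apply, inner_sub_left] at h3
    linarith
  exact le_antisymm (key a b ha hb) (key b a hb ha)

/-- When `X` has empty interior a gradient relative to `X` is not unique, so `gradientWithin` may
differ from `gradMax`. The two agree on all `q - x` with `q ∈ X`, hence on the differences `q - P`
tested by the variational inequality of the projection, and the projected points coincide. -/
lemma residual_eq (hr : Regular X Y f c B) (hρ : 0 < ρ) (hσ : 0 < σ) (hx : x ∈ X) (α : ℝ) :
    residual X (maxValue Y (penalized f c ρ σ)) α x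
      = α⁻¹ • (x - proj X (x - α • gradMax Y (penalized f c ρ σ) x)) := by
  have hb := hr.hasGradientWithinAt_maxValue hρ hσ hx
  have ha : HasGradientWithinAt (maxValue Y (penalized f c ρ σ))
      (gradientWithin (maxValue Y (penalized f c ρ σ)) X x) X x :=
    DifferentiableWithinAt.hasGradientWithinAt (𝕜 := ℝ) hb.differentiableWithinAt
  set a := gradientWithin (maxValue Y (penalized f c ρ σ)) X x
  set b := gradMax Y (penalized f c ρ σ) x
  have h : proj X (x - α • b) = proj X (x - α • a) := by
    refine eq_proj_of_inner_nonpos hr.X_nonempty hr.X_closed hr.X_convex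
      (proj_mem hr.X_nonempty hr.X_closed _) fun q hq => ?_
    have hp := proj_mem hr.X_nonempty hr.X_closed (x - α • b)
    have h0 := inner_sub_proj_nonpos hr.X_nonempty hr.X_closed hr.X_convex (x - α • b) hq
    set P := proj X (x - α • b)
    have h1 := inner_eq_of_hasGradientWithinAt hr.X_convex hx ha hb hq
    have h2 := inner_eq_of_hasGradientWithinAt hr.X_convex hx ha hb hp
    have e1 : x - α • a - P = (x - α • b - P) - α • (a - b) := by module
    have e2 : q - P = (q - x) - (P - x) := by abel
    have h3 : ⟪a - b, q - P⟫ = 0 := by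
      rw [e2, inner_sub_right, inner_sub_left, inner_sub_left, h1, h2]; ring
    rw [e1, inner_sub_left, inner_smul_left, h3]
    simpa using h0
  simp only [residual]
  rw [h]

end Regular

end SPACO

namespace SPACO
open Set Filter Topology
open scoped RealInnerProductSpace

/-! ### Freezing an independent state; mean-zero perturbations. -/

section Independence

variable {Ω Ξ S : Type*} {G mΩ : MeasurableSpace Ω} [MeasurableSpace Ξ] [MeasurableSpace S]
  {P : Measure Ω} [IsProbabilityMeasure P] {D : Measure Ξ} [IsProbabilityMeasure D]

/-- Freezing lemma: a bound on the mean of `h w ξ` for every fixed `w` can be integrated over a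
`W` independent of `ξ`. -/
lemma integral_le_of_indep (hG : G ≤ mΩ) {W : Ω → S}
    (hW : Measurable[G] W) {ξ : Ω → Ξ} (hξ : Measurable ξ) (hlaw : P.map ξ = D)
    (hind : Indep (MeasurableSpace.comap ξ inferInstance) G P) {h : S → Ξ → ℝ}
    (hm : Measurable (Function.uncurry h)) (h0 : ∀ w e, 0 ≤ h w e) {v : S → ℝ}
    (hint : ∀ w, Integrable (h w) D) (hle : ∀ w, ∫ e, h w e ∂D ≤ v w)
    (hv : Integrable (fun ω => v (W ω)) P) :
    Integrable (fun ω => h (W ω) (ξ ω)) P ∧ ∫ ω, h (W ω) (ξ ω) ∂P ≤ ∫ ω, v (W ω) ∂P := by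
  have hW' : Measurable W := hW.mono hG le_rfl
  have hindep : IndepFun W ξ P := by
    rw [IndepFun_iff_Indep]
    exact (indep_of_indep_of_le_right hind hW.comap_le).symm
  have hmap : P.map (fun ω => (W ω, ξ ω)) = (P.map W).prod D := by
    rw [← hlaw]
    exact (indepFun_iff_map_prod_eq_prod_map_map hW'.aemeasurable hξ.aemeasurable).1 hindep
  have hv0 : ∀ w, 0 ≤ v w := fun w => (integral_nonneg (h0 w)).trans (hle w)
  have hm' : Measurable fun ω => h (W ω) (ξ ω) := hm.comp (hW'.prodMk hξ)
  have key : ∫⁻ ω, ENNReal.ofReal (h (W ω) (ξ ω)) ∂P ≤ ENNReal.ofReal (∫ ω, v (W ω) ∂P) := by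
    calc ∫⁻ ω, ENNReal.ofReal (h (W ω) (ξ ω)) ∂P
        = ∫⁻ z, ENNReal.ofReal (Function.uncurry h z) ∂(P.map fun ω => (W ω, ξ ω)) :=
          (lintegral_map hm.ennreal_ofReal (hW'.prodMk hξ)).symm
      _ = ∫⁻ w, ∫⁻ e, ENNReal.ofReal (h w e) ∂D ∂(P.map W) := by
          rw [hmap, lintegral_prod _ hm.ennreal_ofReal.aemeasurable]
          rfl
      _ ≤ ∫⁻ w, ENNReal.ofReal (v w) ∂(P.map W) := by
          refine lintegral_mono fun w => ?_
          rw [← ofReal_integral_eq_lintegral_ofReal (hint w) (Eventually.of_forall (h0 w))]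
          exact ENNReal.ofReal_le_ofReal (hle w)
      -- Only an inequality is available, as `v` is not assumed measurable; it goes in the needed
      -- direction.
      _ ≤ ∫⁻ ω, ENNReal.ofReal (v (W ω)) ∂P := lintegral_map_le _ _
      _ = _ := (ofReal_integral_eq_lintegral_ofReal hv
          (Eventually.of_forall fun ω => hv0 _)).symm
  have hI : Integrable (fun ω => h (W ω) (ξ ω)) P := by
    refine ⟨hm'.aestronglyMeasurable, ?_⟩
    rw [hasFiniteIntegral_iff_ofReal (Eventually.of_forall fun ω => h0 _ _)]
    exact key.trans_lt ENNReal.ofReal_lt_top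
  refine ⟨hI, ?_⟩
  rw [← ofReal_integral_eq_lintegral_ofReal hI (Eventually.of_forall fun ω => h0 _ _)] at key
  exact (ENNReal.ofReal_le_ofReal_iff (integral_nonneg fun ω => hv0 _)).1 key

lemma integral_norm_add_sq {n : ℕ} {Z : Ξ → Eu n} (hZ : Integrable Z D) (h0 : ∫ e, Z e ∂D = 0)
    (hZ2 : Integrable (fun e => ‖Z e‖ ^ 2) D) (u : Eu n) :
    Integrable (fun e => ‖u + Z e‖ ^ 2) D ∧
      ∫ e, ‖u + Z e‖ ^ 2 ∂D = ‖u‖ ^ 2 + ∫ e, ‖Z e‖ ^ 2 ∂D := by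
  have e1 : (fun e => ‖u + Z e‖ ^ 2) = fun e => ‖u‖ ^ 2 + 2 * ⟪u, Z e⟫ + ‖Z e‖ ^ 2 :=
    funext fun e => norm_add_sq_real u (Z e)
  have i1 : Integrable (fun e => 2 * ⟪u, Z e⟫) D := (hZ.const_inner u).const_mul 2
  have i2 : Integrable (fun e => ‖u‖ ^ 2 + 2 * ⟪u, Z e⟫) D := (integrable_const _).add i1
  rw [e1]
  refine ⟨i2.add hZ2, ?_⟩
  rw [integral_add i2 hZ2, integral_add (integrable_const _) i1, integral_const_mul,
    integral_inner hZ u, h0]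
  simp

end Independence

/-! ### Measurability of gradients and maximizers along random points of `X × Y`. -/

section Measurability

variable {n m p : ℕ} {X : Set (Eu n)} {Y : Set (Eu m)} {f g : Eu n → Eu m → ℝ}
  {c : Eu n → Eu m → Eu p} {B ρ σ : ℝ} {A : Type*} {mA : MeasurableSpace A}
  {x : A → Eu n} {y : A → Eu m}

/-- Regularity is known only on `X × Y`. The random points stay there, so the composition factors
through the subtype, on which `G` is continuous. -/
lemma measurable_comp_of_lip {E : Type*} [NormedAddCommGroup E] [MeasurableSpace E] [BorelSpace E]
    {G : Eu n → Eu m → E} (hG : ∀ x ∈ X, ∀ y ∈ Y, ∀ x' ∈ X, ∀ y' ∈ Y,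
      ‖G x y - G x' y'‖ ≤ B * (‖x - x'‖ + ‖y - y'‖))
    (hx : Measurable x) (hxX : ∀ a, x a ∈ X) (hy : Measurable y) (hyY : ∀ a, y a ∈ Y) :
    Measurable fun a => G (x a) (y a) := by
  have hc : Continuous fun z : X × Y => G z.1 z.2 := by
    refine continuous_iff_continuousAt.2 fun z => ?_
    rw [ContinuousAt, tendsto_iff_norm_sub_tendsto_zero]
    have h1 : Tendsto (fun w : X × Y => B * (‖(w.1 : Eu n) - z.1‖ + ‖(w.2 : Eu m) - z.2‖)) (𝓝 z)
        (𝓝 0) := by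
      have : Continuous fun w : X × Y => B * (‖(w.1 : Eu n) - z.1‖ + ‖(w.2 : Eu m) - z.2‖) := by
        fun_prop
      simpa using this.tendsto z
    exact squeeze_zero (fun _ => norm_nonneg _)
      (fun w => hG _ w.1.2 _ w.2.2 _ z.1.2 _ z.2.2) h1
  exact hc.measurable.comp ((hx.subtype_mk (h := hxX)).prodMk (hy.subtype_mk (h := hyY)))

lemma BoundedSmooth.measurable_gradX (h : BoundedSmooth X Y g B)
    (hx : Measurable x) (hxX : ∀ a, x a ∈ X) (hy : Measurable y) (hyY : ∀ a, y a ∈ Y) :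
    Measurable fun a => gradX g (x a) (y a) :=
  measurable_comp_of_lip h.lip_x hx hxX hy hyY

lemma BoundedSmooth.measurable_gradY (h : BoundedSmooth X Y g B)
    (hx : Measurable x) (hxX : ∀ a, x a ∈ X) (hy : Measurable y) (hyY : ∀ a, y a ∈ Y) :
    Measurable fun a => gradY g (x a) (y a) :=
  measurable_comp_of_lip h.lip_y hx hxX hy hyY

lemma Regular.measurable_maximizer (hr : Regular X Y f c B) (hρ : 0 < ρ) (hσ : 0 < σ)
    (hx : Measurable x) (hxX : ∀ a, x a ∈ X) :
    Measurable fun a => maximizer Y (penalized f c ρ σ) (x a) := by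
  obtain ⟨y₀, hy₀⟩ := hr.Y_nonempty
  have hB := hr.nonneg
  refine measurable_comp_of_lip (X := X) (Y := Y) (B := B * (1 + ρ) / σ)
    (G := fun x _ => maximizer Y (penalized f c ρ σ) x) (fun x hx y _ x' hx' y' _ => ?_) hx hxX
    (measurable_const (a := y₀)) (fun _ => hy₀)
  exact (hr.lip_maximizer hρ hσ hx hx').trans
    (mul_le_mul_of_nonneg_left (by linarith [norm_nonneg (y - y')]) (by positivity))

lemma Regular.measurable_gradX (hr : Regular X Y f c B) (hρ : 0 < ρ)
    (hx : Measurable x) (hxX : ∀ a, x a ∈ X) (hy : Measurable y) (hyY : ∀ a, y a ∈ Y) :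
    Measurable fun a => gradX (penalized f c ρ σ) (x a) (y a) :=
  measurable_comp_of_lip (fun _ hx _ hy _ hx' _ hy' => hr.lip_gradX hρ hx hy hx' hy') hx hxX hy hyY

lemma Regular.measurable_maxValue (hr : Regular X Y f c B) (hρ : 0 < ρ) (hσ : 0 < σ)
    (hx : Measurable x) (hxX : ∀ a, x a ∈ X) :
    Measurable fun a => maxValue Y (penalized f c ρ σ) (x a) := by
  have h1 : ContinuousOn (maxValue Y (penalized f c ρ σ)) X :=
    (hr.differentiableOn_maxValue hρ hσ).continuousOn
  exact (continuousOn_iff_continuous_domRestrict.1 h1).measurable.comp (hx.subtype_mk (h := hxX))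

end Measurability

/-! ### Conditional one-step estimates, with the current state frozen. -/

section OneStep

variable {n m p : ℕ} {X : Set (Eu n)} {Y : Set (Eu m)} {f : Eu n → Eu m → ℝ}
  {c : Eu n → Eu m → Eu p} {B ρ σ : ℝ} {Ξ : Type*} [MeasurableSpace Ξ] {D : Measure Ξ}
  {F : Ξ → Eu n → Eu m → ℝ}

/-- Quantitative form of the oracle assumptions. -/
structure OracleBound (D : Measure Ξ) (X : Set (Eu n)) (Y : Set (Eu m)) (f : Eu n → Eu m → ℝ)
    (F : Ξ → Eu n → Eu m → ℝ) (K : ℝ) : Prop where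
  base : OracleAssumptions D X Y f F
  nonneg : 0 ≤ K
  var_x : ∀ x ∈ X, ∀ y ∈ Y, Integrable (fun ξ => ‖gradX (F ξ) x y - gradX f x y‖ ^ 2) D ∧
    ∫ ξ, ‖gradX (F ξ) x y - gradX f x y‖ ^ 2 ∂D ≤ K
  var_y : ∀ x ∈ X, ∀ y ∈ Y, Integrable (fun ξ => ‖gradY (F ξ) x y - gradY f x y‖ ^ 2) D ∧
    ∫ ξ, ‖gradY (F ξ) x y - gradY f x y‖ ^ 2 ∂D ≤ K
  smooth : ∀ x₁ ∈ X, ∀ y₁ ∈ Y, ∀ x₂ ∈ X, ∀ y₂ ∈ Y,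
    Integrable (fun ξ => ‖gradX (F ξ) x₁ y₁ - gradX (F ξ) x₂ y₂‖ ^ 2) D ∧
    ∫ ξ, ‖gradX (F ξ) x₁ y₁ - gradX (F ξ) x₂ y₂‖ ^ 2 ∂D
      ≤ K * (‖x₁ - x₂‖ ^ 2 + ‖y₁ - y₂‖ ^ 2)

lemma OracleAssumptions.exists_bound (h : OracleAssumptions D X Y f F) :
    ∃ K, OracleBound D X Y f F K := by
  obtain ⟨δ, hδ, hv⟩ := h.variance
  obtain ⟨L, hL, hs⟩ := h.smooth
  refine ⟨δ ^ 2 + L ^ 2, h, by positivity, fun x hx y hy => ⟨(hv x hx y hy).1.1,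
    (hv x hx y hy).1.2.trans (by nlinarith)⟩, fun x hx y hy => ⟨(hv x hx y hy).2.1,
    (hv x hx y hy).2.2.trans (by nlinarith)⟩, fun x₁ h₁ y₁ h₁' x₂ h₂ y₂ h₂' =>
    ⟨(hs x₁ h₁ y₁ h₁' x₂ h₂ y₂ h₂').1, (hs x₁ h₁ y₁ h₁' x₂ h₂ y₂ h₂').2.trans ?_⟩⟩
  exact mul_le_mul_of_nonneg_right (by nlinarith) (by positivity)

variable {K : ℝ} {x x' : Eu n} {y y' : Eu m}

/-- The penalty and the regularizer are deterministic, so the noise is that of `∇ₓF` alone and its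
variance does not grow with `ρ`. -/
lemma OracleBound.gradX_eq (ho : OracleBound D X Y f F K) (hr : Regular X Y f c B) (hx : x ∈ X)
    (hy : y ∈ Y) (e : Ξ) : gradX (penalized (F e) c ρ σ) x y
      = gradX (penalized f c ρ σ) x y + (gradX (F e) x y - gradX f x y) := by
  rw [hr.gradX_eq hx hy, gradX_penalized (ho.base.diff_x e x hx y hy)
    (differentiableAt_left (hr.smooth_q.diff x hx y hy))]
  abel

lemma OracleBound.gradY_eq (ho : OracleBound D X Y f F K) (hr : Regular X Y f c B) (hx : x ∈ X)
    (hy : y ∈ Y) (e : Ξ) : gradY (penalized (F e) c ρ σ) x y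
      = gradY (penalized f c ρ σ) x y + (gradY (F e) x y - gradY f x y) := by
  rw [hr.gradY_eq hx hy, gradY_penalized (ho.base.diff_y e x hx y hy)
    (differentiableAt_right (hr.smooth_q.diff x hx y hy))]
  abel

section Measurability

variable {A : Type*} {mA : MeasurableSpace A} {x : A → Eu n} {y : A → Eu m} {e : A → Ξ}

lemma OracleBound.measurable_gradX_oracle (ho : OracleBound D X Y f F K) (hx : Measurable x)
    (hxX : ∀ a, x a ∈ X) (hy : Measurable y) (hyY : ∀ a, y a ∈ Y) (he : Measurable e) :
    Measurable fun a => gradX (F (e a)) (x a) (y a) :=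
  ho.base.measurable_x.comp
    ((hx.subtype_mk (h := hxX)).prodMk ((hy.subtype_mk (h := hyY)).prodMk he))

lemma OracleBound.measurable_gradX (ho : OracleBound D X Y f F K) (hr : Regular X Y f c B)
    (hx : Measurable x) (hxX : ∀ a, x a ∈ X) (hy : Measurable y) (hyY : ∀ a, y a ∈ Y)
    (he : Measurable e) :
    Measurable fun a => gradX (penalized (F (e a)) c ρ σ) (x a) (y a) := by
  have h : ∀ a, gradX (penalized (F (e a)) c ρ σ) (x a) (y a)
      = gradX (F (e a)) (x a) (y a) - ρ • gradX (penalty c) (x a) (y a) := fun a =>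
    gradX_penalized (ho.base.diff_x _ _ (hxX a) _ (hyY a))
      (differentiableAt_left (hr.smooth_q.diff _ (hxX a) _ (hyY a)))
  simp only [h]
  exact (ho.measurable_gradX_oracle hx hxX hy hyY he).sub
    ((hr.smooth_q.measurable_gradX hx hxX hy hyY).const_smul ρ)

lemma OracleBound.measurable_gradY (ho : OracleBound D X Y f F K) (hr : Regular X Y f c B)
    (hx : Measurable x) (hxX : ∀ a, x a ∈ X) (hy : Measurable y) (hyY : ∀ a, y a ∈ Y)
    (he : Measurable e) :
    Measurable fun a => gradY (penalized (F (e a)) c ρ σ) (x a) (y a) := by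
  have h : ∀ a, gradY (penalized (F (e a)) c ρ σ) (x a) (y a)
      = gradY (F (e a)) (x a) (y a) - ρ • gradY (penalty c) (x a) (y a) - σ • y a := fun a =>
    gradY_penalized (ho.base.diff_y _ _ (hxX a) _ (hyY a))
      (differentiableAt_right (hr.smooth_q.diff _ (hxX a) _ (hyY a)))
  simp only [h]
  exact ((ho.base.measurable_y.comp
    ((hx.subtype_mk (h := hxX)).prodMk ((hy.subtype_mk (h := hyY)).prodMk he))).sub
    ((hr.smooth_q.measurable_gradY hx hxX hy hyY).const_smul ρ)).sub (hy.const_smul σ)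

end Measurability

variable [IsProbabilityMeasure D]

lemma OracleBound.noise_y (ho : OracleBound D X Y f F K) (hx : x ∈ X) (hy : y ∈ Y) :
    Integrable (fun e => gradY (F e) x y - gradY f x y) D ∧
      ∫ e, (gradY (F e) x y - gradY f x y) ∂D = 0 := by
  obtain ⟨h1, h2⟩ := ho.base.unbiased_y x hx y hy
  refine ⟨h1.sub (integrable_const _), ?_⟩
  rw [integral_sub h1 (integrable_const _), h2]
  simp

lemma OracleBound.noise_x (ho : OracleBound D X Y f F K) (hx : x ∈ X) (hy : y ∈ Y) :
    Integrable (fun e => gradX (F e) x y - gradX f x y) D ∧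
      ∫ e, (gradX (F e) x y - gradX f x y) ∂D = 0 := by
  obtain ⟨h1, h2⟩ := ho.base.unbiased_x x hx y hy
  refine ⟨h1.sub (integrable_const _), ?_⟩
  rw [integral_sub h1 (integrable_const _), h2]
  simp

lemma OracleBound.aestronglyMeasurable_proj (ho : OracleBound D X Y f F K)
    (hr : Regular X Y f c B) (hx : x ∈ X) (hy : y ∈ Y) (β : ℝ) (z : Eu m) :
    AEStronglyMeasurable
      (fun e => ‖proj Y (y + β • gradY (penalized (F e) c ρ σ) x y) - z‖ ^ 2) D := by
  have h : Continuous fun v : Eu m =>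
      ‖proj Y (y + β • (gradY (penalized f c ρ σ) x y + v)) - z‖ ^ 2 := by
    have := continuous_proj hr.Y_nonempty hr.Y_compact.isClosed hr.Y_convex
    fun_prop
  simp only [ho.gradY_eq hr hx hy]
  exact h.comp_aestronglyMeasurable (ho.noise_y hx hy).1.aestronglyMeasurable

/-- A generic step `P_Y(y + β (v + noise))` against a reference point `P_Y w`. -/
lemma OracleBound.integral_proj_sub_le (ho : OracleBound D X Y f F K) (hr : Regular X Y f c B)
    (hx : x ∈ X) (hy : y ∈ Y) (β : ℝ) (w : Eu m) :
    Integrable (fun e =>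
        ‖proj Y (y + β • gradY (penalized (F e) c ρ σ) x y) - proj Y w‖ ^ 2) D ∧
      ∫ e, ‖proj Y (y + β • gradY (penalized (F e) c ρ σ) x y) - proj Y w‖ ^ 2 ∂D
        ≤ ‖y + β • gradY (penalized f c ρ σ) x y - w‖ ^ 2 + β ^ 2 * K := by
  obtain ⟨h1, h2⟩ := ho.noise_y hx hy
  obtain ⟨h3, h4⟩ := ho.var_y x hx y hy
  set u := y + β • gradY (penalized f c ρ σ) x y - w
  set Z : Ξ → Eu m := fun e => β • (gradY (F e) x y - gradY f x y)
  have eZ : ∀ e, ‖Z e‖ ^ 2 = β ^ 2 * ‖gradY (F e) x y - gradY f x y‖ ^ 2 := fun e => by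
    rw [norm_smul, mul_pow, Real.norm_eq_abs, sq_abs]
  obtain ⟨h5, h6⟩ := integral_norm_add_sq (D := D) (Z := Z) (h1.smul β)
    (by rw [integral_smul, h2, smul_zero]) (by simp only [eZ]; exact h3.const_mul _) u
  have hle : ∀ e, ‖proj Y (y + β • gradY (penalized (F e) c ρ σ) x y) - proj Y w‖ ^ 2
      ≤ ‖u + Z e‖ ^ 2 := fun e => by
    refine pow_le_pow_left₀ (norm_nonneg _) ((norm_proj_sub_proj_le hr.Y_nonempty
      hr.Y_compact.isClosed hr.Y_convex _ _).trans (le_of_eq ?_)) 2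
    rw [ho.gradY_eq hr hx hy]
    congr 1
    simp only [u, Z, smul_add]
    abel
  have hI := h5.mono' (ho.aestronglyMeasurable_proj (ρ := ρ) (σ := σ) hr hx hy β (proj Y w))
    (Eventually.of_forall fun e => by
      rw [Real.norm_eq_abs, abs_of_nonneg (sq_nonneg _)]; exact hle e)
  refine ⟨hI, (integral_mono hI h5 hle).trans ?_⟩
  rw [h6]
  simp only [eZ]
  rw [integral_const_mul]
  exact add_le_add le_rfl (mul_le_mul_of_nonneg_left h4 (sq_nonneg β))

lemma Regular.proj_maximizer (hr : Regular X Y f c B) (hx : x ∈ X) {β : ℝ} (hβ : 0 < β) :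
    proj Y (maximizer Y (penalized f c ρ σ) x
        + β • gradY (penalized f c ρ σ) x (maximizer Y (penalized f c ρ σ) x))
      = maximizer Y (penalized f c ρ σ) x := by
  refine (eq_proj_of_inner_nonpos hr.Y_nonempty hr.Y_compact.isClosed hr.Y_convex
    (hr.maximizer_mem ρ σ hx) fun q hq => ?_).symm
  rw [add_sub_cancel_left, inner_smul_left]
  exact mul_nonpos_of_nonneg_of_nonpos hβ.le
    (hr.inner_gradY_nonpos hx (hr.maximizer_mem ρ σ hx) (hr.isMaxOn_maximizer ρ σ hx) hq)

/-- The maximizer is a fixed point of the exact projected ascent step, so nonexpansiveness compares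
two exact steps plus a mean-zero noise. Expanding the square, strong monotonicity gives `-2βσ` and
the Lipschitz bound gives the `β²` term. -/
lemma OracleBound.integral_contraction (ho : OracleBound D X Y f F K) (hr : Regular X Y f c B)
    (hρ : 0 < ρ) (hσ : 0 < σ) (hx : x ∈ X) (hy : y ∈ Y) {β : ℝ} (hβ : 0 < β) :
    Integrable (fun e => ‖proj Y (y + β • gradY (penalized (F e) c ρ σ) x y)
        - maximizer Y (penalized f c ρ σ) x‖ ^ 2) D ∧
      ∫ e, ‖proj Y (y + β • gradY (penalized (F e) c ρ σ) x y)
        - maximizer Y (penalized f c ρ σ) x‖ ^ 2 ∂D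
        ≤ (1 - 2 * β * σ + β ^ 2 * (B * (1 + ρ + σ)) ^ 2)
          * ‖y - maximizer Y (penalized f c ρ σ) x‖ ^ 2 + β ^ 2 * K := by
  have hfix := hr.proj_maximizer (ρ := ρ) (σ := σ) hx hβ
  have hz := hr.maximizer_mem ρ σ hx
  set z := maximizer Y (penalized f c ρ σ) x
  have h := ho.integral_proj_sub_le (ρ := ρ) (σ := σ) hr hx hy β
    (z + β • gradY (penalized f c ρ σ) x z)
  rw [hfix] at h
  refine ⟨h.1, h.2.trans (add_le_add ?_ le_rfl)⟩
  have e : y + β • gradY (penalized f c ρ σ) x y - (z + β • gradY (penalized f c ρ σ) x z)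
      = (y - z) + β • (gradY (penalized f c ρ σ) x y - gradY (penalized f c ρ σ) x z) := by
    module
  have h1 := hr.strongMono (σ := σ) hρ hx hy hz
  have h2 := hr.lip_gradY hρ hσ hx hy hz
  rw [e, norm_add_sq_real, inner_smul_right, norm_smul, real_inner_comm, mul_pow,
    Real.norm_eq_abs, sq_abs]
  have h3 := pow_le_pow_left₀ (norm_nonneg _) h2 2
  rw [mul_pow] at h3
  have h4 := mul_le_mul_of_nonneg_left h3 (sq_nonneg β)
  have h5 := mul_le_mul_of_nonneg_left h1 hβ.le
  linarith

/-- The reference point is `y` itself, which `P_Y` fixes. -/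
lemma OracleBound.integral_displacement (ho : OracleBound D X Y f F K) (hr : Regular X Y f c B)
    (hρ : 0 < ρ) (hσ : 0 < σ) (hx : x ∈ X) (hy : y ∈ Y) (β : ℝ) :
    Integrable (fun e => ‖proj Y (y + β • gradY (penalized (F e) c ρ σ) x y) - y‖ ^ 2) D ∧
      ∫ e, ‖proj Y (y + β • gradY (penalized (F e) c ρ σ) x y) - y‖ ^ 2 ∂D
        ≤ β ^ 2 * ((B * (1 + ρ + σ)) ^ 2 + K) := by
  have h := ho.integral_proj_sub_le (ρ := ρ) (σ := σ) hr hx hy β y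
  rw [proj_eq_self hr.Y_compact.isClosed hy] at h
  refine ⟨h.1, h.2.trans ?_⟩
  rw [add_sub_cancel_left, norm_smul, mul_pow, Real.norm_eq_abs, sq_abs, mul_add]
  have := pow_le_pow_left₀ (norm_nonneg _) (hr.norm_gradY_le hρ hσ hx hy) 2
  gcongr

/-- One step of the momentum recursion for the error of the `x`-direction. -/
lemma OracleBound.integral_momentum (ho : OracleBound D X Y f F K) (hr : Regular X Y f c B)
    (hx : x ∈ X) (hy : y ∈ Y) (hx' : x' ∈ X) (hy' : y' ∈ Y) {η : ℝ} (h0 : 0 ≤ η) (h1 : η ≤ 1)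
    (u : Eu n) :
    Integrable (fun e => ‖u + ((gradX (F e) x' y' - gradX f x' y')
        - (1 - η) • (gradX (F e) x y - gradX f x y))‖ ^ 2) D ∧
      ∫ e, ‖u + ((gradX (F e) x' y' - gradX f x' y')
        - (1 - η) • (gradX (F e) x y - gradX f x y))‖ ^ 2 ∂D
        ≤ ‖u‖ ^ 2 + (2 * η ^ 2 * K + (4 * K + 8 * B ^ 2) * (‖x' - x‖ ^ 2 + ‖y' - y‖ ^ 2)) := by
  obtain ⟨a1, a2⟩ := ho.noise_x hx hy
  obtain ⟨b1, b2⟩ := ho.noise_x hx' hy'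
  obtain ⟨v1, v2⟩ := ho.var_x x' hx' y' hy'
  obtain ⟨s1, s2⟩ := ho.smooth x' hx' y' hy' x hx y hy
  set Z : Ξ → Eu n := fun e => (gradX (F e) x' y' - gradX f x' y')
    - (1 - η) • (gradX (F e) x y - gradX f x y)
  have a3 : Integrable (fun e => (1 - η) • (gradX (F e) x y - gradX f x y)) D := a1.smul (1 - η)
  have hZ : Integrable Z D := b1.sub a3
  have hZ0 : ∫ e, Z e ∂D = 0 := by
    rw [integral_sub b1 a3, integral_smul, a2, b2]; simp
  set R := B ^ 2 * (2 * (‖x' - x‖ ^ 2 + ‖y' - y‖ ^ 2))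
  have hR : ‖gradX f x' y' - gradX f x y‖ ^ 2 ≤ R := by
    refine (pow_le_pow_left₀ (norm_nonneg _) (hr.smooth_f.lip_x x' hx' y' hy' x hx y hy) 2).trans ?_
    rw [mul_pow]
    refine mul_le_mul_of_nonneg_left ?_ (sq_nonneg B)
    nlinarith [sq_nonneg (‖x' - x‖ - ‖y' - y‖)]
  have two : ∀ a b : Eu n, ‖a + b‖ ^ 2 ≤ 2 * ‖a‖ ^ 2 + 2 * ‖b‖ ^ 2 := fun a b => by
    nlinarith [norm_add_le a b, norm_nonneg (a + b), sq_nonneg (‖a‖ - ‖b‖), norm_nonneg a,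
      norm_nonneg b]
  have hle : ∀ e, ‖Z e‖ ^ 2 ≤ 2 * η ^ 2 * ‖gradX (F e) x' y' - gradX f x' y'‖ ^ 2
      + (4 * ‖gradX (F e) x' y' - gradX (F e) x y‖ ^ 2 + 4 * R) := fun e => by
    -- The point of the momentum correction: fresh noise enters with the small factor `η`, and the
    -- rest is a difference of gradients under one sample, controlled by mean-squared smoothness.
    have e1 : Z e = η • (gradX (F e) x' y' - gradX f x' y')
        + (1 - η) • ((gradX (F e) x' y' - gradX (F e) x y)
          + -(gradX f x' y' - gradX f x y)) := by
      simp only [Z]; module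
    rw [e1]
    refine (two _ _).trans ?_
    rw [norm_smul, norm_smul, mul_pow, mul_pow, Real.norm_eq_abs, Real.norm_eq_abs, sq_abs, sq_abs]
    have h3 := two (gradX (F e) x' y' - gradX (F e) x y) (-(gradX f x' y' - gradX f x y))
    rw [norm_neg] at h3
    have h4 : (1 - η) ^ 2 ≤ 1 := by nlinarith
    have h5 := mul_le_of_le_one_left (sq_nonneg ‖(gradX (F e) x' y' - gradX (F e) x y)
      + -(gradX f x' y' - gradX f x y)‖) h4
    linarith
  have i1 : Integrable (fun e => 2 * η ^ 2 * ‖gradX (F e) x' y' - gradX f x' y'‖ ^ 2) D :=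
    v1.const_mul _
  have i2 : Integrable (fun e => 4 * ‖gradX (F e) x' y' - gradX (F e) x y‖ ^ 2 + 4 * R) D :=
    (s1.const_mul _).add (integrable_const _)
  have hZ2 : Integrable (fun e => ‖Z e‖ ^ 2) D := (i1.add i2).mono'
    (hZ.aestronglyMeasurable.norm.pow 2)
    (Eventually.of_forall fun e => by
      rw [Real.norm_eq_abs, abs_of_nonneg (sq_nonneg _)]; exact hle e)
  obtain ⟨h5, h6⟩ := integral_norm_add_sq hZ hZ0 hZ2 u
  refine ⟨h5, h6.le.trans (add_le_add le_rfl ((integral_mono hZ2 (i1.add i2) hle).trans ?_))⟩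
  rw [integral_add' i1 i2, integral_const_mul, integral_add (s1.const_mul _) (integrable_const _),
    integral_const_mul, integral_const, probReal_univ, one_smul]
  have := mul_le_mul_of_nonneg_left v2 (by positivity : (0 : ℝ) ≤ 2 * η ^ 2)
  have e : 4 * R = 8 * B ^ 2 * (‖x' - x‖ ^ 2 + ‖y' - y‖ ^ 2) := by simp only [R]; ring
  rw [e]
  linarith

end OneStep

end SPACO

namespace SPACO
open Set Filter Topology
open scoped RealInnerProductSpace

/-! ### Adaptedness of the iterates and mean-square recursions along a run. -/

section Run

variable {n m p : ℕ} {Ω Ξ : Type*} {mΩ : MeasurableSpace Ω} [MeasurableSpace Ξ]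

lemma measurable_past_x (ξx ξy : ℕ → Ω → Ξ) (k : ℕ) : Measurable[past ξx ξy (k + 1)] (ξx k) :=
  Measurable.of_comap_le (le_sup_right.trans (le_iSup (fun j : Fin (k + 1) =>
    MeasurableSpace.comap (ξy j) inferInstance ⊔ MeasurableSpace.comap (ξx j) inferInstance)
    (Fin.last k)))

lemma past_mono (ξx ξy : ℕ → Ω → Ξ) (k : ℕ) : past ξx ξy k ≤ past ξx ξy (k + 1) :=
  iSup_le fun j => le_iSup (fun j : Fin (k + 1) =>
    MeasurableSpace.comap (ξy j) inferInstance ⊔ MeasurableSpace.comap (ξx j) inferInstance)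
    j.castSucc

lemma pastHalf_le_past (ξx ξy : ℕ → Ω → Ξ) (k : ℕ) : pastHalf ξx ξy k ≤ past ξx ξy (k + 1) :=
  sup_le (past_mono ξx ξy k) (le_sup_left.trans (le_iSup (fun j : Fin (k + 1) =>
    MeasurableSpace.comap (ξy j) inferInstance ⊔ MeasurableSpace.comap (ξx j) inferInstance)
    (Fin.last k)))

lemma measurable_pastHalf_y (ξx ξy : ℕ → Ω → Ξ) (k : ℕ) : Measurable[pastHalf ξx ξy k] (ξy k) :=
  Measurable.of_comap_le le_sup_right

variable {X : Set (Eu n)} {Y : Set (Eu m)} {f : Eu n → Eu m → ℝ} {c : Eu n → Eu m → Eu p}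
  {B K : ℝ} {D : Measure Ξ} {F : Ξ → Eu n → Eu m → ℝ} {ρ σ α β η : ℕ → ℝ} {P : Measure Ω}
  {ξx ξy : ℕ → Ω → Ξ} {x₀ : Eu n} {y₀ : Eu m} {x : ℕ → Ω → Eu n} {y : ℕ → Ω → Eu m}
  {d : ℕ → Ω → Eu n}

lemma IsSampling.past_le (h : IsSampling P D ξx ξy) (k : ℕ) : past ξx ξy k ≤ mΩ :=
  iSup_le fun j => sup_le (h.measurable_y j).comap_le (h.measurable_x j).comap_le

lemma IsSampling.pastHalf_le (h : IsSampling P D ξx ξy) (k : ℕ) : pastHalf ξx ξy k ≤ mΩ :=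
  (pastHalf_le_past ξx ξy k).trans (h.past_le (k + 1))

/-- A run of the algorithm on a regular problem, with admissible parameters. -/
structure AdmissibleRun (X : Set (Eu n)) (Y : Set (Eu m)) (f : Eu n → Eu m → ℝ)
    (c : Eu n → Eu m → Eu p) (B K : ℝ) (D : Measure Ξ) (F : Ξ → Eu n → Eu m → ℝ)
    (ρ σ α β η : ℕ → ℝ) (P : Measure Ω) (ξx ξy : ℕ → Ω → Ξ) (x₀ : Eu n) (y₀ : Eu m)
    (x : ℕ → Ω → Eu n) (y : ℕ → Ω → Eu m) (d : ℕ → Ω → Eu n) : Prop where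
  regular : Regular X Y f c B
  oracle : OracleBound D X Y f F K
  sampling : IsSampling P D ξx ξy
  run : IsRun X Y c F ρ σ α β η ξx ξy x₀ y₀ x y d
  x₀_mem : x₀ ∈ X
  y₀_mem : y₀ ∈ Y
  ρ_pos : ∀ k, 0 < ρ k
  σ_pos : ∀ k, 0 < σ k
  α_pos : ∀ k, 0 < α k
  β_pos : ∀ k, 0 < β k
  η_nonneg : ∀ k, 0 ≤ η k
  η_le_one : ∀ k, η k ≤ 1

/-- The error of the direction `d_k` as an estimator of `∇ₓψ_k(x_k, y_{k+1})`. -/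
noncomputable def dirError (f : Eu n → Eu m → ℝ) (c : Eu n → Eu m → Eu p) (ρ σ : ℕ → ℝ)
    (x : ℕ → Ω → Eu n) (y : ℕ → Ω → Eu m) (d : ℕ → Ω → Eu n) (k : ℕ) (ω : Ω) : Eu n :=
  d k ω - gradX (penalized f c (ρ k) (σ k)) (x k ω) (y (k + 1) ω)

/-- The inner maximizer `y*_k(x_k)`. -/
noncomputable def innerMax (Y : Set (Eu m)) (f : Eu n → Eu m → ℝ) (c : Eu n → Eu m → Eu p)
    (ρ σ : ℕ → ℝ) (x : ℕ → Ω → Eu n) (k : ℕ) (ω : Ω) : Eu m :=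
  maximizer Y (penalized f c (ρ k) (σ k)) (x k ω)

namespace AdmissibleRun

lemma x_mem (h : AdmissibleRun X Y f c B K D F ρ σ α β η P ξx ξy x₀ y₀ x y d) (k : ℕ) (ω : Ω) :
    x k ω ∈ X := by
  cases k with
  | zero => rw [h.run.x_zero]; exact h.x₀_mem
  | succ k => rw [h.run.x_succ]; exact proj_mem h.regular.X_nonempty h.regular.X_closed _

lemma y_mem (h : AdmissibleRun X Y f c B K D F ρ σ α β η P ξx ξy x₀ y₀ x y d) (k : ℕ) (ω : Ω) :
    y k ω ∈ Y := by
  cases k with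
  | zero => rw [h.run.y_zero]; exact h.y₀_mem
  | succ k =>
    rw [h.run.y_succ]; exact proj_mem h.regular.Y_nonempty h.regular.Y_compact.isClosed _

lemma measurable_y_succ (h : AdmissibleRun X Y f c B K D F ρ σ α β η P ξx ξy x₀ y₀ x y d) {k : ℕ}
    (hx : Measurable[past ξx ξy k] (x k)) (hy : Measurable[past ξx ξy k] (y k)) :
    Measurable[pastHalf ξx ξy k] (y (k + 1)) := by
  have hx' : Measurable[pastHalf ξx ξy k] (x k) := hx.mono le_sup_left le_rfl
  have hy' : Measurable[pastHalf ξx ξy k] (y k) := hy.mono le_sup_left le_rfl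
  rw [funext (h.run.y_succ k)]
  exact (continuous_proj h.regular.Y_nonempty h.regular.Y_compact.isClosed
    h.regular.Y_convex).measurable.comp (hy'.add ((h.oracle.measurable_gradY h.regular hx'
      (h.x_mem k) hy' (h.y_mem k) (measurable_pastHalf_y ξx ξy k)).const_smul (β k)))

/-- The direction `d k` already uses both samples of step `k`, hence the shifted index `k + 1` of
its filtration. -/
lemma measurable_iterates (h : AdmissibleRun X Y f c B K D F ρ σ α β η P ξx ξy x₀ y₀ x y d)
    (k : ℕ) : Measurable[past ξx ξy k] (x k) ∧ Measurable[past ξx ξy k] (y k) ∧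
      Measurable[past ξx ξy (k + 1)] (d k) := by
  induction k with
  | zero =>
    have hx : Measurable[past ξx ξy 0] (x 0) := by
      rw [funext h.run.x_zero]; exact measurable_const
    have hy : Measurable[past ξx ξy 0] (y 0) := by
      rw [funext h.run.y_zero]; exact measurable_const
    refine ⟨hx, hy, ?_⟩
    rw [funext h.run.d_zero]
    exact h.oracle.measurable_gradX h.regular (hx.mono (past_mono ξx ξy 0) le_rfl) (h.x_mem 0)
      ((h.measurable_y_succ hx hy).mono (pastHalf_le_past ξx ξy 0) le_rfl) (h.y_mem 1)
      (measurable_past_x ξx ξy 0)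
  | succ k ih =>
    obtain ⟨hx, hy, hd⟩ := ih
    have hx1 : Measurable[past ξx ξy (k + 1)] (x k) := hx.mono (past_mono ξx ξy k) le_rfl
    have hX : Measurable[past ξx ξy (k + 1)] (x (k + 1)) := by
      rw [funext (h.run.x_succ k)]
      exact (continuous_proj h.regular.X_nonempty h.regular.X_closed
        h.regular.X_convex).measurable.comp (hx1.sub (hd.const_smul (α k)))
    have hY : Measurable[past ξx ξy (k + 1)] (y (k + 1)) :=
      (h.measurable_y_succ hx hy).mono (pastHalf_le_past ξx ξy k) le_rfl
    have hm := past_mono ξx ξy (k + 1)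
    have hY2 : Measurable[past ξx ξy (k + 2)] (y (k + 2)) :=
      (h.measurable_y_succ hX hY).mono (pastHalf_le_past ξx ξy (k + 1)) le_rfl
    refine ⟨hX, hY, ?_⟩
    rw [funext (h.run.d_succ k)]
    have e := measurable_past_x ξx ξy (k + 1)
    exact (((hd.mono hm le_rfl).sub (h.oracle.measurable_gradX h.regular (hx1.mono hm le_rfl)
      (h.x_mem k) (hY.mono hm le_rfl) (h.y_mem (k + 1)) e)).const_smul (1 - η (k + 1))).add
      (h.oracle.measurable_gradX h.regular (hX.mono hm le_rfl) (h.x_mem (k + 1)) hY2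
        (h.y_mem (k + 2)) e)

lemma measurable_x (h : AdmissibleRun X Y f c B K D F ρ σ α β η P ξx ξy x₀ y₀ x y d) (k : ℕ) :
    Measurable (x k) := (h.measurable_iterates k).1.mono (h.sampling.past_le k) le_rfl

lemma measurable_y (h : AdmissibleRun X Y f c B K D F ρ σ α β η P ξx ξy x₀ y₀ x y d) (k : ℕ) :
    Measurable (y k) := (h.measurable_iterates k).2.1.mono (h.sampling.past_le k) le_rfl

lemma measurable_innerMax (h : AdmissibleRun X Y f c B K D F ρ σ α β η P ξx ξy x₀ y₀ x y d)
    (k : ℕ) : Measurable (innerMax Y f c ρ σ x k) :=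
  h.regular.measurable_maximizer (h.ρ_pos k) (h.σ_pos k) (h.measurable_x k) (h.x_mem k)

lemma innerMax_mem (h : AdmissibleRun X Y f c B K D F ρ σ α β η P ξx ξy x₀ y₀ x y d)
    (k : ℕ) (ω : Ω) : innerMax Y f c ρ σ x k ω ∈ Y := h.regular.maximizer_mem _ _ (h.x_mem k ω)

lemma measurable_dirError (h : AdmissibleRun X Y f c B K D F ρ σ α β η P ξx ξy x₀ y₀ x y d)
    (k : ℕ) : Measurable[past ξx ξy (k + 1)] (dirError f c ρ σ x y d k) := by
  obtain ⟨h1, h2, h3⟩ := h.measurable_iterates k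
  exact h3.sub (h.regular.measurable_gradX (h.ρ_pos k) (h1.mono (past_mono ξx ξy k) le_rfl)
    (h.x_mem k) (h.measurable_iterates (k + 1)).2.1 (h.y_mem (k + 1)))

lemma dirError_zero (h : AdmissibleRun X Y f c B K D F ρ σ α β η P ξx ξy x₀ y₀ x y d) (ω : Ω) :
    dirError f c ρ σ x y d 0 ω
      = gradX (F (ξx 0 ω)) (x 0 ω) (y 1 ω) - gradX f (x 0 ω) (y 1 ω) := by
  rw [dirError, h.run.d_zero, h.oracle.gradX_eq h.regular (h.x_mem 0 ω) (h.y_mem 1 ω),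
    add_sub_cancel_left]

/-- The correction in `d` uses the old parameters at the old point and the new ones at the new
point, so the deterministic parts cancel exactly. No error from the change of `ρ` or `σ` enters. -/
lemma dirError_succ (h : AdmissibleRun X Y f c B K D F ρ σ α β η P ξx ξy x₀ y₀ x y d) (k : ℕ)
    (ω : Ω) : dirError f c ρ σ x y d (k + 1) ω = (1 - η (k + 1)) • dirError f c ρ σ x y d k ω
      + ((gradX (F (ξx (k + 1) ω)) (x (k + 1) ω) (y (k + 2) ω)
          - gradX f (x (k + 1) ω) (y (k + 2) ω))
        - (1 - η (k + 1)) • (gradX (F (ξx (k + 1) ω)) (x k ω) (y (k + 1) ω)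
          - gradX f (x k ω) (y (k + 1) ω))) := by
  rw [dirError, dirError, h.run.d_succ, h.oracle.gradX_eq h.regular (h.x_mem k ω) (h.y_mem _ ω),
    h.oracle.gradX_eq h.regular (h.x_mem _ ω) (h.y_mem _ ω)]
  module

variable [IsProbabilityMeasure P]

lemma integrable_norm_sq_sub (_h : AdmissibleRun X Y f c B K D F ρ σ α β η P ξx ξy x₀ y₀ x y d)
    {l : ℕ} {u v : Ω → Eu l} (hu : Measurable u) (hv : Measurable v) (hub : ∀ ω, ‖u ω‖ ≤ B)
    (hvb : ∀ ω, ‖v ω‖ ≤ B) : Integrable (fun ω => ‖u ω - v ω‖ ^ 2) P := by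
  refine Integrable.of_bound ((hu.sub hv).norm.pow_const 2).aestronglyMeasurable ((B + B) ^ 2)
    (Eventually.of_forall fun ω => ?_)
  rw [Real.norm_eq_abs, abs_of_nonneg (sq_nonneg _)]
  exact pow_le_pow_left₀ (norm_nonneg _)
    ((norm_sub_le _ _).trans (add_le_add (hub ω) (hvb ω))) 2

lemma integrable_x_sub (h : AdmissibleRun X Y f c B K D F ρ σ α β η P ξx ξy x₀ y₀ x y d)
    (k l : ℕ) : Integrable (fun ω => ‖x k ω - x l ω‖ ^ 2) P :=
  h.integrable_norm_sq_sub (h.measurable_x k) (h.measurable_x l)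
    (fun ω => h.regular.X_bdd _ (h.x_mem k ω)) (fun ω => h.regular.X_bdd _ (h.x_mem l ω))

lemma integrable_y_sub_innerMax
    (h : AdmissibleRun X Y f c B K D F ρ σ α β η P ξx ξy x₀ y₀ x y d)
    (k l : ℕ) : Integrable (fun ω => ‖y k ω - innerMax Y f c ρ σ x l ω‖ ^ 2) P :=
  h.integrable_norm_sq_sub (h.measurable_y k) (h.measurable_innerMax l)
    (fun ω => h.regular.Y_bdd _ (h.y_mem k ω)) (fun ω => h.regular.Y_bdd _ (h.innerMax_mem l ω))

variable [IsProbabilityMeasure D]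

/-- The state `(x_k, y_k)` is frozen as a point of the subtype `X × Y`, where the one-step bound
holds for every value, and is then averaged against the independent sample `ξ_kʸ`. -/
lemma integral_contraction (h : AdmissibleRun X Y f c B K D F ρ σ α β η P ξx ξy x₀ y₀ x y d)
    (k : ℕ) : ∫ ω, ‖y (k + 1) ω - innerMax Y f c ρ σ x k ω‖ ^ 2 ∂P
      ≤ (1 - 2 * β k * σ k + β k ^ 2 * (B * (1 + ρ k + σ k)) ^ 2)
        * ∫ ω, ‖y k ω - innerMax Y f c ρ σ x k ω‖ ^ 2 ∂P + β k ^ 2 * K := by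
  obtain ⟨hx, hy, -⟩ := h.measurable_iterates k
  have hmain := (integral_le_of_indep (h.sampling.past_le k)
    (W := fun ω => ((⟨x k ω, h.x_mem k ω⟩, ⟨y k ω, h.y_mem k ω⟩) : X × Y))
    ((hx.subtype_mk).prodMk (hy.subtype_mk)) (h.sampling.measurable_y k) (h.sampling.law_y k)
    (h.sampling.indep_y k) (D := D)
    (h := fun w e => ‖proj Y ((w.2 : Eu m) + β k • gradY (penalized (F e) c (ρ k) (σ k)) w.1 w.2)
        - maximizer Y (penalized f c (ρ k) (σ k)) w.1‖ ^ 2)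
    (v := fun w => (1 - 2 * β k * σ k + β k ^ 2 * (B * (1 + ρ k + σ k)) ^ 2)
          * ‖(w.2 : Eu m) - maximizer Y (penalized f c (ρ k) (σ k)) w.1‖ ^ 2 + β k ^ 2 * K)
    ?_ (fun _ _ => sq_nonneg _)
    (fun w => (h.oracle.integral_contraction h.regular (h.ρ_pos k) (h.σ_pos k) w.1.2 w.2.2
      (h.β_pos k)).1)
    (fun w => (h.oracle.integral_contraction h.regular (h.ρ_pos k) (h.σ_pos k) w.1.2 w.2.2
      (h.β_pos k)).2)
    (((h.integrable_y_sub_innerMax k k).const_mul _).add (integrable_const _))).2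
  · simp only [← h.run.y_succ] at hmain
    refine hmain.trans (le_of_eq ?_)
    change ∫ ω, ((1 - 2 * β k * σ k + β k ^ 2 * (B * (1 + ρ k + σ k)) ^ 2)
      * ‖y k ω - innerMax Y f c ρ σ x k ω‖ ^ 2 + β k ^ 2 * K) ∂P = _
    rw [integral_add ((h.integrable_y_sub_innerMax k k).const_mul _) (integrable_const _),
      integral_const_mul, integral_const, probReal_univ, one_smul]
  · have m1 : Measurable fun z : (X × Y) × Ξ => (z.1.1 : Eu n) :=
      measurable_subtype_coe.comp (measurable_fst.comp measurable_fst)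
    have m2 : Measurable fun z : (X × Y) × Ξ => (z.1.2 : Eu m) :=
      measurable_subtype_coe.comp (measurable_snd.comp measurable_fst)
    have m3 := h.oracle.measurable_gradY (ρ := ρ k) (σ := σ k) h.regular m1 (fun z => z.1.1.2) m2
      (fun z => z.1.2.2) measurable_snd
    have m4 := h.regular.measurable_maximizer (h.ρ_pos k) (h.σ_pos k) m1 (fun z => z.1.1.2)
    exact ((((continuous_proj h.regular.Y_nonempty h.regular.Y_compact.isClosed
      h.regular.Y_convex).measurable.comp (m2.add (m3.const_smul (β k)))).sub m4).norm).pow_const 2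

lemma integral_y_step (h : AdmissibleRun X Y f c B K D F ρ σ α β η P ξx ξy x₀ y₀ x y d)
    (k : ℕ) : ∫ ω, ‖y (k + 1) ω - y k ω‖ ^ 2 ∂P
      ≤ β k ^ 2 * ((B * (1 + ρ k + σ k)) ^ 2 + K) := by
  obtain ⟨hx, hy, -⟩ := h.measurable_iterates k
  have hmain := (integral_le_of_indep (h.sampling.past_le k)
    (W := fun ω => ((⟨x k ω, h.x_mem k ω⟩, ⟨y k ω, h.y_mem k ω⟩) : X × Y))
    ((hx.subtype_mk).prodMk (hy.subtype_mk)) (h.sampling.measurable_y k) (h.sampling.law_y k)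
    (h.sampling.indep_y k) (D := D)
    (h := fun w e => ‖proj Y ((w.2 : Eu m) + β k • gradY (penalized (F e) c (ρ k) (σ k)) w.1 w.2)
        - (w.2 : Eu m)‖ ^ 2)
    (v := fun _ => β k ^ 2 * ((B * (1 + ρ k + σ k)) ^ 2 + K))
    ?_ (fun _ _ => sq_nonneg _)
    (fun w => (h.oracle.integral_displacement h.regular (h.ρ_pos k) (h.σ_pos k) w.1.2 w.2.2
      (β k)).1)
    (fun w => (h.oracle.integral_displacement h.regular (h.ρ_pos k) (h.σ_pos k) w.1.2 w.2.2
      (β k)).2)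
    (integrable_const _)).2
  · simp only [← h.run.y_succ] at hmain
    refine hmain.trans (le_of_eq ?_)
    rw [integral_const, probReal_univ, one_smul]
  · have m1 : Measurable fun z : (X × Y) × Ξ => (z.1.1 : Eu n) :=
      measurable_subtype_coe.comp (measurable_fst.comp measurable_fst)
    have m2 : Measurable fun z : (X × Y) × Ξ => (z.1.2 : Eu m) :=
      measurable_subtype_coe.comp (measurable_snd.comp measurable_fst)
    have m3 := h.oracle.measurable_gradY (ρ := ρ k) (σ := σ k) h.regular m1 (fun z => z.1.1.2) m2
      (fun z => z.1.2.2) measurable_snd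
    exact ((((continuous_proj h.regular.Y_nonempty h.regular.Y_compact.isClosed
      h.regular.Y_convex).measurable.comp (m2.add (m3.const_smul (β k)))).sub m2).norm).pow_const 2

/-- The generic momentum step, from a state `(x, y, x', y', u)` known before the sample. -/
lemma integral_noise_le (h : AdmissibleRun X Y f c B K D F ρ σ α β η P ξx ξy x₀ y₀ x y d)
    (k : ℕ) {a a' : Ω → Eu n} {b b' : Ω → Eu m} {u : Ω → Eu n}
    (ha : Measurable[pastHalf ξx ξy k] a) (haX : ∀ ω, a ω ∈ X)
    (hb : Measurable[pastHalf ξx ξy k] b) (hbY : ∀ ω, b ω ∈ Y)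
    (ha' : Measurable[pastHalf ξx ξy k] a') (haX' : ∀ ω, a' ω ∈ X)
    (hb' : Measurable[pastHalf ξx ξy k] b') (hbY' : ∀ ω, b' ω ∈ Y)
    (hu : Measurable[pastHalf ξx ξy k] u) {t : ℝ} (h0 : 0 ≤ t) (h1 : t ≤ 1)
    (hui : Integrable (fun ω => ‖u ω‖ ^ 2) P) :
    Integrable (fun ω => ‖u ω + ((gradX (F (ξx k ω)) (a' ω) (b' ω) - gradX f (a' ω) (b' ω))
        - (1 - t) • (gradX (F (ξx k ω)) (a ω) (b ω) - gradX f (a ω) (b ω)))‖ ^ 2) P ∧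
      ∫ ω, ‖u ω + ((gradX (F (ξx k ω)) (a' ω) (b' ω) - gradX f (a' ω) (b' ω))
        - (1 - t) • (gradX (F (ξx k ω)) (a ω) (b ω) - gradX f (a ω) (b ω)))‖ ^ 2 ∂P
      ≤ ∫ ω, ‖u ω‖ ^ 2 ∂P + (2 * t ^ 2 * K + (4 * K + 8 * B ^ 2)
        * (∫ ω, ‖a' ω - a ω‖ ^ 2 ∂P + ∫ ω, ‖b' ω - b ω‖ ^ 2 ∂P)) := by
  have hG := h.sampling.pastHalf_le k
  have hr := h.regular
  have i1 : Integrable (fun ω => ‖a' ω - a ω‖ ^ 2) P := h.integrable_norm_sq_sub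
    (ha'.mono hG le_rfl) (ha.mono hG le_rfl) (fun ω => hr.X_bdd _ (haX' ω))
    (fun ω => hr.X_bdd _ (haX ω))
  have i2 : Integrable (fun ω => ‖b' ω - b ω‖ ^ 2) P := h.integrable_norm_sq_sub
    (hb'.mono hG le_rfl) (hb.mono hG le_rfl) (fun ω => hr.Y_bdd _ (hbY' ω))
    (fun ω => hr.Y_bdd _ (hbY ω))
  have i12 : Integrable (fun ω => ‖a' ω - a ω‖ ^ 2 + ‖b' ω - b ω‖ ^ 2) P := i1.add i2
  have i3 : Integrable (fun ω => 2 * t ^ 2 * K + (4 * K + 8 * B ^ 2)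
      * (‖a' ω - a ω‖ ^ 2 + ‖b' ω - b ω‖ ^ 2)) P :=
    (integrable_const _).add (i12.const_mul _)
  have hmain := integral_le_of_indep hG
    (W := fun ω => ((⟨a ω, haX ω⟩, ⟨b ω, hbY ω⟩, ⟨a' ω, haX' ω⟩, ⟨b' ω, hbY' ω⟩, u ω) :
      X × Y × X × Y × Eu n))
    ((ha.subtype_mk).prodMk ((hb.subtype_mk).prodMk ((ha'.subtype_mk).prodMk
      ((hb'.subtype_mk).prodMk hu)))) (h.sampling.measurable_x k) (h.sampling.law_x k)
    (h.sampling.indep_x k) (D := D)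
    (h := fun w e => ‖w.2.2.2.2 + ((gradX (F e) w.2.2.1 w.2.2.2.1 - gradX f w.2.2.1 w.2.2.2.1)
        - (1 - t) • (gradX (F e) w.1 w.2.1 - gradX f w.1 w.2.1))‖ ^ 2)
    (v := fun w => ‖w.2.2.2.2‖ ^ 2 + (2 * t ^ 2 * K + (4 * K + 8 * B ^ 2)
        * (‖(w.2.2.1 : Eu n) - w.1‖ ^ 2 + ‖(w.2.2.2.1 : Eu m) - w.2.1‖ ^ 2)))
    ?_ (fun _ _ => sq_nonneg _)
    (fun w => (h.oracle.integral_momentum hr w.1.2 w.2.1.2 w.2.2.1.2 w.2.2.2.1.2 h0 h1 _).1)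
    (fun w => (h.oracle.integral_momentum hr w.1.2 w.2.1.2 w.2.2.1.2 w.2.2.2.1.2 h0 h1 _).2)
    (hui.add i3)
  · refine ⟨hmain.1, hmain.2.trans (le_of_eq ?_)⟩
    rw [integral_add hui i3, integral_add (integrable_const _) (i12.const_mul _),
      integral_const_mul, integral_const_mul, integral_add i1 i2, integral_const, probReal_univ,
      one_smul]
  · have m1 : Measurable fun z : (X × Y × X × Y × Eu n) × Ξ => (z.1.1 : Eu n) := by fun_prop
    have m2 : Measurable fun z : (X × Y × X × Y × Eu n) × Ξ => (z.1.2.1 : Eu m) := by fun_prop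
    have m3 : Measurable fun z : (X × Y × X × Y × Eu n) × Ξ => (z.1.2.2.1 : Eu n) := by fun_prop
    have m4 : Measurable fun z : (X × Y × X × Y × Eu n) × Ξ => (z.1.2.2.2.1 : Eu m) := by fun_prop
    have m5 : Measurable fun z : (X × Y × X × Y × Eu n) × Ξ => z.1.2.2.2.2 := by fun_prop
    have g1 := h.oracle.measurable_gradX_oracle m1 (fun z => z.1.1.2) m2 (fun z => z.1.2.1.2)
      measurable_snd
    have g2 := h.oracle.measurable_gradX_oracle m3 (fun z => z.1.2.2.1.2) m4
      (fun z => z.1.2.2.2.1.2) measurable_snd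
    have g3 := hr.smooth_f.measurable_gradX m1 (fun z => z.1.1.2) m2 (fun z => z.1.2.1.2)
    have g4 := hr.smooth_f.measurable_gradX m3 (fun z => z.1.2.2.1.2) m4 (fun z => z.1.2.2.2.1.2)
    exact ((m5.add ((g2.sub g4).sub ((g1.sub g3).const_smul (1 - t)))).norm).pow_const 2

lemma integrable_dirError (h : AdmissibleRun X Y f c B K D F ρ σ α β η P ξx ξy x₀ y₀ x y d)
    (k : ℕ) : Integrable (fun ω => ‖dirError f c ρ σ x y d k ω‖ ^ 2) P := by
  induction k with
  | zero =>
    have hx : Measurable[pastHalf ξx ξy 0] (x 0) :=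
      (h.measurable_iterates 0).1.mono le_sup_left le_rfl
    have hy := h.measurable_y_succ (h.measurable_iterates 0).1 (h.measurable_iterates 0).2.1
    -- The initial error is the generic momentum step with factor `1` and `u = 0`: the old noise
    -- drops out.
    have := (h.integral_noise_le 0 hx (h.x_mem 0) hy (h.y_mem 1) hx (h.x_mem 0) hy (h.y_mem 1)
      (u := fun _ => 0) measurable_const zero_le_one le_rfl (by simp)).1
    refine this.congr (Eventually.of_forall fun ω => ?_)
    simp only [h.dirError_zero, sub_self, zero_smul, sub_zero, zero_add]
  | succ k ih =>
    have hx : Measurable[pastHalf ξx ξy (k + 1)] (x k) :=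
      (h.measurable_iterates k).1.mono ((past_mono ξx ξy k).trans le_sup_left) le_rfl
    have hX : Measurable[pastHalf ξx ξy (k + 1)] (x (k + 1)) :=
      (h.measurable_iterates (k + 1)).1.mono le_sup_left le_rfl
    have hy : Measurable[pastHalf ξx ξy (k + 1)] (y (k + 1)) :=
      (h.measurable_iterates (k + 1)).2.1.mono le_sup_left le_rfl
    have hY := h.measurable_y_succ (h.measurable_iterates (k + 1)).1
      (h.measurable_iterates (k + 1)).2.1
    have hu : Measurable[pastHalf ξx ξy (k + 1)]
        (fun ω => (1 - η (k + 1)) • dirError f c ρ σ x y d k ω) :=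
      ((h.measurable_dirError k).mono le_sup_left le_rfl).const_smul (1 - η (k + 1))
    have hui : Integrable (fun ω => ‖(1 - η (k + 1)) • dirError f c ρ σ x y d k ω‖ ^ 2) P := by
      simp only [norm_smul, mul_pow]
      exact ih.const_mul _
    have := (h.integral_noise_le (k + 1) hx (h.x_mem k) hy (h.y_mem _) hX (h.x_mem _) hY
      (h.y_mem _) hu (h.η_nonneg (k + 1)) (h.η_le_one (k + 1)) hui).1
    refine this.congr (Eventually.of_forall fun ω => ?_)
    simp only [h.dirError_succ]

lemma integral_dirError_succ (h : AdmissibleRun X Y f c B K D F ρ σ α β η P ξx ξy x₀ y₀ x y d)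
    (k : ℕ) : ∫ ω, ‖dirError f c ρ σ x y d (k + 1) ω‖ ^ 2 ∂P
      ≤ (1 - η (k + 1)) * ∫ ω, ‖dirError f c ρ σ x y d k ω‖ ^ 2 ∂P
        + (2 * η (k + 1) ^ 2 * K + (4 * K + 8 * B ^ 2) * (∫ ω, ‖x (k + 1) ω - x k ω‖ ^ 2 ∂P
          + β (k + 1) ^ 2 * ((B * (1 + ρ (k + 1) + σ (k + 1))) ^ 2 + K))) := by
  have hx : Measurable[pastHalf ξx ξy (k + 1)] (x k) :=
    (h.measurable_iterates k).1.mono ((past_mono ξx ξy k).trans le_sup_left) le_rfl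
  have hX : Measurable[pastHalf ξx ξy (k + 1)] (x (k + 1)) :=
    (h.measurable_iterates (k + 1)).1.mono le_sup_left le_rfl
  have hy : Measurable[pastHalf ξx ξy (k + 1)] (y (k + 1)) :=
    (h.measurable_iterates (k + 1)).2.1.mono le_sup_left le_rfl
  have hY := h.measurable_y_succ (h.measurable_iterates (k + 1)).1
    (h.measurable_iterates (k + 1)).2.1
  have hu : Measurable[pastHalf ξx ξy (k + 1)]
      (fun ω => (1 - η (k + 1)) • dirError f c ρ σ x y d k ω) :=
    ((h.measurable_dirError k).mono le_sup_left le_rfl).const_smul (1 - η (k + 1))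
  have e : ∀ ω, ‖(1 - η (k + 1)) • dirError f c ρ σ x y d k ω‖ ^ 2
      = (1 - η (k + 1)) ^ 2 * ‖dirError f c ρ σ x y d k ω‖ ^ 2 := fun ω => by
    rw [norm_smul, mul_pow, Real.norm_eq_abs, sq_abs]
  have hui : Integrable (fun ω => ‖(1 - η (k + 1)) • dirError f c ρ σ x y d k ω‖ ^ 2) P := by
    simp only [e]
    exact (h.integrable_dirError k).const_mul _
  have hmain := (h.integral_noise_le (k + 1) hx (h.x_mem k) hy (h.y_mem _) hX (h.x_mem _) hY
    (h.y_mem _) hu (h.η_nonneg (k + 1)) (h.η_le_one (k + 1)) hui).2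
  simp only [← h.dirError_succ, e, integral_const_mul] at hmain
  refine hmain.trans (add_le_add ?_ ?_)
  · refine mul_le_mul_of_nonneg_right ?_ (integral_nonneg fun _ => sq_nonneg _)
    -- `(1 - η)² ≤ 1 - η`, since `0 ≤ η ≤ 1`.
    nlinarith [h.η_nonneg (k + 1), h.η_le_one (k + 1)]
  · have h1 := h.integral_y_step (k + 1)
    have hK := h.oracle.nonneg
    gcongr

end AdmissibleRun

end Run

end SPACO

namespace SPACO
open Set Filter Topology
open scoped RealInnerProductSpace

/-! ### Descent, drift of the maximizer, residual and constraint violation. -/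

section Run

variable {n m p : ℕ} {Ω Ξ : Type*} {mΩ : MeasurableSpace Ω} [MeasurableSpace Ξ]
  {X : Set (Eu n)} {Y : Set (Eu m)} {f : Eu n → Eu m → ℝ} {c : Eu n → Eu m → Eu p}
  {B K : ℝ} {D : Measure Ξ} {F : Ξ → Eu n → Eu m → ℝ} {ρ σ α β η : ℕ → ℝ} {P : Measure Ω}
  {ξx ξy : ℕ → Ω → Ξ} {x₀ : Eu n} {y₀ : Eu m} {x : ℕ → Ω → Eu n} {y : ℕ → Ω → Eu m}
  {d : ℕ → Ω → Eu n}

lemma norm_add_sq_le_two {n : ℕ} (a b : Eu n) : ‖a + b‖ ^ 2 ≤ 2 * ‖a‖ ^ 2 + 2 * ‖b‖ ^ 2 := by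
  nlinarith [norm_add_le a b, norm_nonneg (a + b), sq_nonneg (‖a‖ - ‖b‖), norm_nonneg a,
    norm_nonneg b]

lemma norm_add_sq_le_young {n : ℕ} (a b : Eu n) {r : ℝ} (hr : 0 < r) :
    ‖a + b‖ ^ 2 ≤ (1 + r) * ‖a‖ ^ 2 + (1 + 1 / r) * ‖b‖ ^ 2 := by
  have h1 : ‖a + b‖ ^ 2 ≤ (‖a‖ + ‖b‖) ^ 2 := pow_le_pow_left₀ (norm_nonneg _) (norm_add_le a b) 2
  have h2 : 0 ≤ (r * ‖a‖ - ‖b‖) ^ 2 / r := by positivity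
  have h3 : (r * ‖a‖ - ‖b‖) ^ 2 / r = r * ‖a‖ ^ 2 - 2 * ‖a‖ * ‖b‖ + 1 / r * ‖b‖ ^ 2 := by
    field_simp; ring
  linarith

lemma sq_integral_le_integral_sq [IsProbabilityMeasure P] {g : Ω → ℝ} (hg : Integrable g P)
    (hg2 : Integrable (fun ω => g ω ^ 2) P) : (∫ ω, g ω ∂P) ^ 2 ≤ ∫ ω, g ω ^ 2 ∂P := by
  set a := ∫ ω, g ω ∂P with ha
  have h0 : 0 ≤ ∫ ω, (g ω - a) ^ 2 ∂P := integral_nonneg fun ω => sq_nonneg _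
  have i1 : Integrable (fun ω => 2 * a * g ω) P := hg.const_mul _
  have i2 : Integrable (fun ω => g ω ^ 2 - 2 * a * g ω) P := hg2.sub i1
  have e : (fun ω => (g ω - a) ^ 2) = fun ω => g ω ^ 2 - 2 * a * g ω + a ^ 2 := by
    funext ω; ring
  rw [e, integral_add i2 (integrable_const _), integral_sub hg2 i1, integral_const_mul, ← ha,
    integral_const, probReal_univ, one_smul] at h0
  linarith

lemma integral_norm_le_of_sq [IsProbabilityMeasure P] {E : Type*} [NormedAddCommGroup E] [MeasurableSpace E] [BorelSpace E]
    {g : Ω → E} (hg : Measurable g) {b : ℝ} (hb : 0 ≤ b)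
    (hi : Integrable (fun ω => ‖g ω‖ ^ 2) P) (hle : ∫ ω, ‖g ω‖ ^ 2 ∂P ≤ b ^ 2) :
    Integrable (fun ω => ‖g ω‖) P ∧ ∫ ω, ‖g ω‖ ∂P ≤ b := by
  have hI : Integrable (fun ω => ‖g ω‖) P :=
    ((integrable_const (1 : ℝ)).add hi).mono' hg.norm.aestronglyMeasurable
      (Eventually.of_forall fun ω => by
        rw [norm_norm]
        simp only [Pi.add_apply]
        nlinarith [sq_nonneg (‖g ω‖ - 1), norm_nonneg (g ω)])
  exact ⟨hI, le_of_sq_le_sq ((sq_integral_le_integral_sq hI hi).trans hle) hb⟩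

namespace AdmissibleRun

/-- The full error of the direction `d_k` as an estimator of `∇φ_k(x_k)`. -/
lemma norm_dir_sub_gradMax_sq_le
    (h : AdmissibleRun X Y f c B K D F ρ σ α β η P ξx ξy x₀ y₀ x y d) (k : ℕ) (ω : Ω) :
    ‖d k ω - gradMax Y (penalized f c (ρ k) (σ k)) (x k ω)‖ ^ 2
      ≤ 2 * ‖dirError f c ρ σ x y d k ω‖ ^ 2
        + 2 * (B * (1 + ρ k)) ^ 2 * ‖y (k + 1) ω - innerMax Y f c ρ σ x k ω‖ ^ 2 := by
  have e : d k ω - gradMax Y (penalized f c (ρ k) (σ k)) (x k ω) = dirError f c ρ σ x y d k ω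
      + (gradX (penalized f c (ρ k) (σ k)) (x k ω) (y (k + 1) ω)
        - gradX (penalized f c (ρ k) (σ k)) (x k ω) (innerMax Y f c ρ σ x k ω)) := by
    rw [dirError, gradMax, innerMax]; abel
  rw [e]
  refine (norm_add_sq_le_two _ _).trans ?_
  have h1 := h.regular.lip_gradX (σ := σ k) (h.ρ_pos k) (h.x_mem k ω) (h.y_mem (k + 1) ω)
    (h.x_mem k ω) (h.innerMax_mem k ω)
  rw [sub_self, norm_zero, zero_add] at h1
  have h2 := pow_le_pow_left₀ (norm_nonneg _) h1 2
  rw [mul_pow] at h2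
  linarith

/-- The residual measures the step along the exact gradient. Nonexpansiveness puts that step within
`α_k ‖d_k - ∇φ_k‖` of the step actually taken, and the direction error splits into momentum and
tracking errors. -/
lemma norm_residual_sq_le (h : AdmissibleRun X Y f c B K D F ρ σ α β η P ξx ξy x₀ y₀ x y d)
    (k : ℕ) (ω : Ω) :
    ‖residual X (maxValue Y (penalized f c (ρ k) (σ k))) (α k) (x k ω)‖ ^ 2
      ≤ 2 / α k ^ 2 * ‖x (k + 1) ω - x k ω‖ ^ 2
        + (4 * ‖dirError f c ρ σ x y d k ω‖ ^ 2
        + 4 * (B * (1 + ρ k)) ^ 2 * ‖y (k + 1) ω - innerMax Y f c ρ σ x k ω‖ ^ 2) := by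
  have hr := h.regular
  have ha := h.α_pos k
  have h3 := h.norm_dir_sub_gradMax_sq_le k ω
  rw [hr.residual_eq (h.ρ_pos k) (h.σ_pos k) (h.x_mem k ω)]
  set v := gradMax Y (penalized f c (ρ k) (σ k)) (x k ω)
  have h1 := norm_proj_sub_proj_le hr.X_nonempty hr.X_closed hr.X_convex (x k ω - α k • d k ω)
    (x k ω - α k • v)
  rw [← h.run.x_succ] at h1
  have e1 : x k ω - α k • d k ω - (x k ω - α k • v) = -(α k • (d k ω - v)) := by module
  rw [e1, norm_neg, norm_smul, Real.norm_eq_abs, abs_of_pos ha] at h1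
  have e2 : x k ω - proj X (x k ω - α k • v)
      = -(x (k + 1) ω - x k ω) + (x (k + 1) ω - proj X (x k ω - α k • v)) := by abel
  have h2 := norm_add_sq_le_two (-(x (k + 1) ω - x k ω))
    (x (k + 1) ω - proj X (x k ω - α k • v))
  rw [← e2, norm_neg] at h2
  have h4 := pow_le_pow_left₀ (norm_nonneg _) h1 2
  rw [mul_pow] at h4
  rw [norm_smul, mul_pow, norm_inv, Real.norm_eq_abs, abs_of_pos ha, inv_pow]
  have h5 : ‖x k ω - proj X (x k ω - α k • v)‖ ^ 2
      ≤ 2 * ‖x (k + 1) ω - x k ω‖ ^ 2 + 2 * (α k ^ 2 * ‖d k ω - v‖ ^ 2) := by linarith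
  have h6 := mul_le_mul_of_nonneg_left h5 (by positivity : 0 ≤ (α k ^ 2)⁻¹)
  have e3 : (α k ^ 2)⁻¹ * (2 * ‖x (k + 1) ω - x k ω‖ ^ 2 + 2 * (α k ^ 2 * ‖d k ω - v‖ ^ 2))
      = 2 / α k ^ 2 * ‖x (k + 1) ω - x k ω‖ ^ 2 + 2 * ‖d k ω - v‖ ^ 2 := by
    field_simp
  rw [e3] at h6
  linarith

lemma measurable_residual (h : AdmissibleRun X Y f c B K D F ρ σ α β η P ξx ξy x₀ y₀ x y d)
    (k : ℕ) : Measurable fun ω =>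
      residual X (maxValue Y (penalized f c (ρ k) (σ k))) (α k) (x k ω) := by
  have hr := h.regular
  simp only [fun ω => hr.residual_eq (h.ρ_pos k) (h.σ_pos k) (h.x_mem k ω) (α k)]
  have h1 : Measurable fun ω => gradMax Y (penalized f c (ρ k) (σ k)) (x k ω) :=
    hr.measurable_gradX (h.ρ_pos k) (h.measurable_x k) (h.x_mem k) (h.measurable_innerMax k)
      (h.innerMax_mem k)
  exact ((h.measurable_x k).sub ((continuous_proj hr.X_nonempty hr.X_closed
    hr.X_convex).measurable.comp ((h.measurable_x k).sub (h1.const_smul (α k))))).const_smul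
    (α k)⁻¹

/-- Inexact projected descent: with `Δ` the step in `x`, the projection inequality gives `⟪d_k, Δ⟫ ≤
-‖Δ‖²/α_k`, Young's inequality handles `∇φ_k - d_k`, and `hα` bounds the curvature of `φ_k` by
`1/(4α_k)`. -/
lemma maxValue_succ_le (h : AdmissibleRun X Y f c B K D F ρ σ α β η P ξx ξy x₀ y₀ x y d)
    (k : ℕ) (ω : Ω) (hρ : ρ k ≤ ρ (k + 1)) (hσ : σ (k + 1) ≤ σ k)
    (hα : B * (1 + ρ k) * (B * (1 + ρ k) / σ k) + B * (1 + ρ k) ≤ 1 / (4 * α k)) :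
    maxValue Y (penalized f c (ρ (k + 1)) (σ (k + 1))) (x (k + 1) ω)
      ≤ maxValue Y (penalized f c (ρ k) (σ k)) (x k ω)
        + α k * (2 * ‖dirError f c ρ σ x y d k ω‖ ^ 2
          + 2 * (B * (1 + ρ k)) ^ 2 * ‖y (k + 1) ω - innerMax Y f c ρ σ x k ω‖ ^ 2)
        - 1 / (2 * α k) * ‖x (k + 1) ω - x k ω‖ ^ 2 + (σ k - σ (k + 1)) / 2 * B ^ 2 := by
  have hr := h.regular
  have ha := h.α_pos k
  have h1 := hr.maxValue_le_of_le (ρ := ρ k) (σ := σ k) hρ (h.x_mem (k + 1) ω) hσ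
  have h2 := hr.maxValue_le_expansion (h.ρ_pos k) (h.σ_pos k) (h.x_mem k ω) (h.x_mem (k + 1) ω)
  have h3 := h.norm_dir_sub_gradMax_sq_le k ω
  have h4 := inner_sub_proj_nonpos hr.X_nonempty hr.X_closed hr.X_convex (x k ω - α k • d k ω)
    (h.x_mem k ω)
  rw [← h.run.x_succ] at h4
  set v := gradMax Y (penalized f c (ρ k) (σ k)) (x k ω)
  set Δ := x (k + 1) ω - x k ω
  have e1 : x k ω - α k • d k ω - x (k + 1) ω = -Δ - α k • d k ω := by simp only [Δ]; abel
  have e2 : x k ω - x (k + 1) ω = -Δ := by simp only [Δ]; abel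
  rw [e1, e2, inner_neg_right, inner_sub_left, inner_neg_left, real_inner_self_eq_norm_sq,
    inner_smul_left] at h4
  simp only [RCLike.conj_to_real] at h4
  have h5 : ⟪d k ω, Δ⟫ ≤ -(1 / α k * ‖Δ‖ ^ 2) := by
    have h6 : α k * ⟪d k ω, Δ⟫ ≤ α k * -(1 / α k * ‖Δ‖ ^ 2) := by
      have : α k * -(1 / α k * ‖Δ‖ ^ 2) = -‖Δ‖ ^ 2 := by field_simp
      linarith
    exact le_of_mul_le_mul_left h6 ha
  have h6 : ⟪v - d k ω, Δ⟫ ≤ α k * ‖d k ω - v‖ ^ 2 + 1 / (4 * α k) * ‖Δ‖ ^ 2 := by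
    have h7 := real_inner_le_norm (v - d k ω) Δ
    rw [norm_sub_rev] at h7
    have h8 : 0 ≤ (2 * α k * ‖d k ω - v‖ - ‖Δ‖) ^ 2 / (4 * α k) := by positivity
    have h9 : (2 * α k * ‖d k ω - v‖ - ‖Δ‖) ^ 2 / (4 * α k)
        = α k * ‖d k ω - v‖ ^ 2 - ‖d k ω - v‖ * ‖Δ‖ + 1 / (4 * α k) * ‖Δ‖ ^ 2 := by
      field_simp; ring
    linarith
  rw [inner_sub_left] at h6
  have h7 := mul_le_mul_of_nonneg_right hα (sq_nonneg ‖Δ‖)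
  have h8 := mul_le_mul_of_nonneg_left h3 ha.le
  -- Budget of the decrease: one quarter pays for curvature, one for the direction error, and half
  -- is kept.
  have e3 : 1 / α k * ‖Δ‖ ^ 2 = 1 / (4 * α k) * ‖Δ‖ ^ 2 + 1 / (4 * α k) * ‖Δ‖ ^ 2
      + 1 / (2 * α k) * ‖Δ‖ ^ 2 := by field_simp; ring
  linarith

variable [IsProbabilityMeasure P]

/-- Young's inequality separates the tracking error from the displacement of the maximizer, caused
by the move in `x` and by the parameter update. The free `r` is later half the contraction rate, so
that a net contraction survives. -/
lemma integral_tracking (h : AdmissibleRun X Y f c B K D F ρ σ α β η P ξx ξy x₀ y₀ x y d)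
    (k : ℕ) {r : ℝ} (hr : 0 < r) :
    ∫ ω, ‖y (k + 1) ω - innerMax Y f c ρ σ x (k + 1) ω‖ ^ 2 ∂P
      ≤ (1 + r) * ∫ ω, ‖y (k + 1) ω - innerMax Y f c ρ σ x k ω‖ ^ 2 ∂P
        + (1 + 1 / r) * (2 * (B * (1 + ρ k) / σ k) ^ 2 * ∫ ω, ‖x (k + 1) ω - x k ω‖ ^ 2 ∂P
          + 2 * (B * (|ρ (k + 1) - ρ k| + |σ (k + 1) - σ k|) / σ k) ^ 2) := by
  have i1 := (h.integrable_y_sub_innerMax (k + 1) k).const_mul (1 + r)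
  have i2 := (h.integrable_x_sub (k + 1) k).const_mul (2 * (B * (1 + ρ k) / σ k) ^ 2)
  have i3 : Integrable (fun ω => 2 * (B * (1 + ρ k) / σ k) ^ 2 * ‖x (k + 1) ω - x k ω‖ ^ 2
      + 2 * (B * (|ρ (k + 1) - ρ k| + |σ (k + 1) - σ k|) / σ k) ^ 2) P :=
    i2.add (integrable_const _)
  have hmono := integral_mono (h.integrable_y_sub_innerMax (k + 1) (k + 1))
    (i1.add (i3.const_mul (1 + 1 / r))) (fun ω => ?_)
  · refine hmono.trans (le_of_eq ?_)
    rw [integral_add' i1 (i3.const_mul _), integral_const_mul, integral_const_mul,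
      integral_add i2 (integrable_const _), integral_const_mul, integral_const, probReal_univ,
      one_smul]
  · have e : y (k + 1) ω - innerMax Y f c ρ σ x (k + 1) ω
        = (y (k + 1) ω - innerMax Y f c ρ σ x k ω)
          + (innerMax Y f c ρ σ x k ω - innerMax Y f c ρ σ x (k + 1) ω) := by abel
    have h1 := h.regular.norm_maximizer_sub_le (ρ' := ρ (k + 1)) (σ' := σ (k + 1)) (h.ρ_pos k)
      (h.σ_pos k) (h.x_mem k ω) (h.x_mem (k + 1) ω)
    rw [norm_sub_rev (x k ω)] at h1
    have h2 := pow_le_pow_left₀ (norm_nonneg _) h1 2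
    have h3 := norm_add_sq_le_young (y (k + 1) ω - innerMax Y f c ρ σ x k ω)
      (innerMax Y f c ρ σ x k ω - innerMax Y f c ρ σ x (k + 1) ω) hr
    rw [← e] at h3
    refine h3.trans ?_
    simp only [Pi.add_apply]
    refine add_le_add le_rfl (mul_le_mul_of_nonneg_left (h2.trans ?_) (by positivity))
    set a := B * (1 + ρ k) / σ k
    set b := B * (|ρ (k + 1) - ρ k| + |σ (k + 1) - σ k|) / σ k
    nlinarith [sq_nonneg (a * ‖x (k + 1) ω - x k ω‖ - b)]

lemma integrable_maxValue (h : AdmissibleRun X Y f c B K D F ρ σ α β η P ξx ξy x₀ y₀ x y d)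
    (k l : ℕ) :
    Integrable (fun ω => maxValue Y (penalized f c (ρ k) (σ k)) (x l ω)) P := by
  refine Integrable.of_bound (h.regular.measurable_maxValue (h.ρ_pos k) (h.σ_pos k)
    (h.measurable_x l) (h.x_mem l)).aestronglyMeasurable (B + σ k / 2 * B ^ 2)
    (Eventually.of_forall fun ω => ?_)
  have h1 := h.regular.maxValue_le (h.ρ_pos k) (h.σ_pos k) (h.x_mem l ω)
  have h2 := h.regular.neg_le_maxValue (ρ := ρ k) (h.σ_pos k) (h.x_mem l ω)
  have h3 : 0 ≤ σ k / 2 * B ^ 2 := by have := h.σ_pos k; positivity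
  rw [Real.norm_eq_abs, abs_le]
  constructor <;> linarith

lemma neg_le_integral_maxValue
    (h : AdmissibleRun X Y f c B K D F ρ σ α β η P ξx ξy x₀ y₀ x y d) (k : ℕ) :
    -(B + σ k / 2 * B ^ 2) ≤ ∫ ω, maxValue Y (penalized f c (ρ k) (σ k)) (x k ω) ∂P := by
  have h1 := integral_mono (integrable_const (-(B + σ k / 2 * B ^ 2))) (h.integrable_maxValue k k)
    (fun ω => h.regular.neg_le_maxValue (h.σ_pos k) (h.x_mem k ω))
  rwa [integral_const, probReal_univ, one_smul] at h1

/-- At the maximizer the penalty is `O(1/ρ_k)`, which `M` encodes (the factor `2` undoes the `½` of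
`penalty`); the Lipschitz bound on `[c]₊` transfers this to `y_k`. -/
lemma integral_constraint (h : AdmissibleRun X Y f c B K D F ρ σ α β η P ξx ξy x₀ y₀ x y d)
    (k : ℕ) {M : ℝ} (hM : 0 ≤ M) (hMk : 2 * (2 * B + σ k / 2 * B ^ 2) ≤ ρ k * M ^ 2)
    (hi : Integrable (fun ω => ‖y k ω - innerMax Y f c ρ σ x k ω‖) P) :
    Integrable (fun ω => ‖posPart (c (x k ω) (y k ω))‖) P ∧
      ∫ ω, ‖posPart (c (x k ω) (y k ω))‖ ∂P
        ≤ M + B * ∫ ω, ‖y k ω - innerMax Y f c ρ σ x k ω‖ ∂P := by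
  have hr := h.regular
  have hm : Measurable fun ω => posPart (c (x k ω) (y k ω)) :=
    measurable_comp_of_lip (G := fun a b => posPart (c a b)) hr.lip_posPart (h.measurable_x k)
      (h.x_mem k) (h.measurable_y k) (h.y_mem k)
  have hle : ∀ ω, ‖posPart (c (x k ω) (y k ω))‖ ≤ M + B * ‖y k ω - innerMax Y f c ρ σ x k ω‖ :=
    fun ω => by
    have h1 := hr.lip_posPart _ (h.x_mem k ω) _ (h.y_mem k ω) _ (h.x_mem k ω) _
      (h.innerMax_mem k ω)
    rw [sub_self, norm_zero, zero_add] at h1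
    have h2 := hr.penalty_maximizer_le (ρ := ρ k) (h.σ_pos k) (h.x_mem k ω)
    rw [penalty] at h2
    have h3 : ‖posPart (c (x k ω) (innerMax Y f c ρ σ x k ω))‖ ^ 2 ≤ M ^ 2 := by
      refine le_of_mul_le_mul_left ?_ (h.ρ_pos k)
      rw [innerMax]
      linarith
    have h4 := le_of_sq_le_sq h3 hM
    have h5 := norm_le_norm_add_norm_sub' (posPart (c (x k ω) (y k ω)))
      (posPart (c (x k ω) (innerMax Y f c ρ σ x k ω)))
    linarith
  have i1 : Integrable (fun ω => M + B * ‖y k ω - innerMax Y f c ρ σ x k ω‖) P :=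
    (integrable_const _).add (hi.const_mul _)
  have hI := i1.mono' hm.norm.aestronglyMeasurable
    (Eventually.of_forall fun ω => by rw [norm_norm]; exact hle ω)
  refine ⟨hI, (integral_mono hI i1 hle).trans (le_of_eq ?_)⟩
  rw [integral_add (integrable_const _) (hi.const_mul _), integral_const_mul, integral_const,
    probReal_univ, one_smul]

variable [IsProbabilityMeasure D]

lemma integral_descent (h : AdmissibleRun X Y f c B K D F ρ σ α β η P ξx ξy x₀ y₀ x y d)
    (k : ℕ) (hρ : ρ k ≤ ρ (k + 1)) (hσ : σ (k + 1) ≤ σ k)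
    (hα : B * (1 + ρ k) * (B * (1 + ρ k) / σ k) + B * (1 + ρ k) ≤ 1 / (4 * α k)) :
    ∫ ω, maxValue Y (penalized f c (ρ (k + 1)) (σ (k + 1))) (x (k + 1) ω) ∂P
      ≤ ∫ ω, maxValue Y (penalized f c (ρ k) (σ k)) (x k ω) ∂P
        + α k * (2 * ∫ ω, ‖dirError f c ρ σ x y d k ω‖ ^ 2 ∂P
          + 2 * (B * (1 + ρ k)) ^ 2 * ∫ ω, ‖y (k + 1) ω - innerMax Y f c ρ σ x k ω‖ ^ 2 ∂P)
        - 1 / (2 * α k) * ∫ ω, ‖x (k + 1) ω - x k ω‖ ^ 2 ∂P + (σ k - σ (k + 1)) / 2 * B ^ 2 := by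
  have i0 := h.integrable_maxValue k k
  have i1 := (h.integrable_dirError k).const_mul 2
  have i2 := (h.integrable_y_sub_innerMax (k + 1) k).const_mul (2 * (B * (1 + ρ k)) ^ 2)
  have i12 : Integrable (fun ω => 2 * ‖dirError f c ρ σ x y d k ω‖ ^ 2
      + 2 * (B * (1 + ρ k)) ^ 2 * ‖y (k + 1) ω - innerMax Y f c ρ σ x k ω‖ ^ 2) P := i1.add i2
  have i3 := i12.const_mul (α k)
  have i4 := (h.integrable_x_sub (k + 1) k).const_mul (1 / (2 * α k))
  refine (integral_mono (h.integrable_maxValue (k + 1) (k + 1))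
    (((i0.add i3).sub i4).add (integrable_const ((σ k - σ (k + 1)) / 2 * B ^ 2)))
    (fun ω => h.maxValue_succ_le k ω hρ hσ hα)).trans (le_of_eq ?_)
  rw [integral_add' ((i0.add i3).sub i4) (integrable_const _), integral_sub' (i0.add i3) i4,
    integral_add' i0 i3, integral_const_mul, integral_const_mul, integral_add i1 i2,
    integral_const_mul, integral_const_mul, integral_const, probReal_univ, one_smul]

lemma integral_residual_sq (h : AdmissibleRun X Y f c B K D F ρ σ α β η P ξx ξy x₀ y₀ x y d)
    (k : ℕ) :
    Integrable (fun ω =>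
      ‖residual X (maxValue Y (penalized f c (ρ k) (σ k))) (α k) (x k ω)‖ ^ 2) P ∧
    ∫ ω, ‖residual X (maxValue Y (penalized f c (ρ k) (σ k))) (α k) (x k ω)‖ ^ 2 ∂P
      ≤ 2 / α k ^ 2 * ∫ ω, ‖x (k + 1) ω - x k ω‖ ^ 2 ∂P
        + (4 * ∫ ω, ‖dirError f c ρ σ x y d k ω‖ ^ 2 ∂P
        + 4 * (B * (1 + ρ k)) ^ 2 * ∫ ω, ‖y (k + 1) ω - innerMax Y f c ρ σ x k ω‖ ^ 2 ∂P) := by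
  have i1 := (h.integrable_dirError k).const_mul 4
  have i2 := (h.integrable_y_sub_innerMax (k + 1) k).const_mul (4 * (B * (1 + ρ k)) ^ 2)
  have i12 : Integrable (fun ω => 4 * ‖dirError f c ρ σ x y d k ω‖ ^ 2
      + 4 * (B * (1 + ρ k)) ^ 2 * ‖y (k + 1) ω - innerMax Y f c ρ σ x k ω‖ ^ 2) P := i1.add i2
  have i4 := (h.integrable_x_sub (k + 1) k).const_mul (2 / α k ^ 2)
  have hI := (i4.add i12).mono' ((h.measurable_residual k).norm.pow_const 2).aestronglyMeasurable
    (Eventually.of_forall fun ω => by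
      rw [Real.norm_eq_abs, abs_of_nonneg (sq_nonneg _)]
      exact h.norm_residual_sq_le k ω)
  refine ⟨hI, (integral_mono hI (i4.add i12) (h.norm_residual_sq_le k)).trans (le_of_eq ?_)⟩
  rw [integral_add' i4 i12, integral_const_mul, integral_add i1 i2, integral_const_mul,
    integral_const_mul]

end AdmissibleRun

end Run

end SPACO

namespace SPACO
open Set Filter Topology

/-! ### Deterministic part: Lyapunov inequality and rates on dyadic windows. -/

section Rates

/-- By Bernoulli, `(1 - 1/j)^(1-q) ≤ 1 - (1-q)/j`, so each increment of the right side dominates the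
new term `j^(-q)`. -/
lemma sum_rpow_neg_le {q : ℝ} (hq0 : 0 ≤ q) (hq : q < 1) (N : ℕ) :
    ∑ k ∈ Finset.range N, ((k + 1 : ℕ) : ℝ) ^ (-q) ≤ (1 / (1 - q)) * (N : ℝ) ^ (1 - q) := by
  have hr : 0 < 1 - q := by linarith
  induction N with
  | zero => simp [Real.zero_rpow hr.ne']
  | succ N ih =>
    rw [Finset.sum_range_succ]
    have hj : (0 : ℝ) < ((N + 1 : ℕ) : ℝ) := by positivity
    set j : ℝ := ((N + 1 : ℕ) : ℝ) with hjd
    have e : (N : ℝ) = j * (1 + -(1 / j)) := by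
      rw [mul_add, mul_one, mul_neg, mul_one_div_cancel hj.ne', hjd]; push_cast; ring
    have h1j : 1 / j ≤ 1 := by
      rw [div_le_one hj, hjd]; push_cast; linarith [Nat.cast_nonneg (α := ℝ) N]
    have h1 := rpow_one_add_le_one_add_mul_self (s := -(1 / j)) (by linarith) hr.le
      (by linarith : 1 - q ≤ 1)
    have h2 : (N : ℝ) ^ (1 - q) ≤ j ^ (1 - q) - (1 - q) * j ^ (-q) := by
      rw [e, Real.mul_rpow hj.le (by linarith)]
      have h3 := mul_le_mul_of_nonneg_left h1 (Real.rpow_nonneg hj.le (1 - q))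
      have h4 : j ^ (1 - q) * (1 / j) = j ^ (-q) := by
        rw [one_div, ← Real.rpow_neg_one, ← Real.rpow_add hj]; congr 1; ring
      linear_combination h3 - (1 - q) * h4
    have h5 := mul_le_mul_of_nonneg_left h2 (by positivity : 0 ≤ 1 / (1 - q))
    have h6 : 1 / (1 - q) * (j ^ (1 - q) - (1 - q) * j ^ (-q))
        = 1 / (1 - q) * j ^ (1 - q) - j ^ (-q) := by field_simp
    linarith

lemma eventually_mul_rpow_le (C : ℝ) {a b : ℝ} (hab : a < b) :
    ∀ᶠ k : ℕ in atTop, C * (k : ℝ) ^ a ≤ (k : ℝ) ^ b := by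
  have h := ((tendsto_rpow_neg_atTop (sub_pos.2 hab)).comp
    tendsto_natCast_atTop_atTop).const_mul C
  rw [mul_zero] at h
  filter_upwards [h.eventually (gt_mem_nhds one_pos), eventually_ge_atTop 1] with k hk hk1
  have hk0 : (0 : ℝ) < k := by exact_mod_cast hk1
  have e : (k : ℝ) ^ a = (k : ℝ) ^ (-(b - a)) * (k : ℝ) ^ b := by
    rw [← Real.rpow_add hk0]; congr 1; ring
  rw [e, ← mul_assoc]
  exact mul_le_of_le_one_left (Real.rpow_nonneg hk0.le _) hk.le

/-- From a Lyapunov inequality to a rate along dyadic windows. -/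
lemma exists_le_of_lyapunov {e θ M M₁ C : ℝ} (he : 0 ≤ e) (he1 : e ≤ 1) (hθ : 0 ≤ θ)
    (hq : e + θ < 1) (hM₁ : 0 ≤ M₁) (hC : 0 ≤ C) {T V : ℕ → ℝ} (hV : ∀ k, -M ≤ V k)
    {k₀ : ℕ} (hk₀ : 1 ≤ k₀) (hT : ∀ k, k₀ ≤ k → 0 ≤ T k)
    (hstep : ∀ k, k₀ ≤ k →
      (k : ℝ) ^ (-e) * T k ≤ M₁ * (V k - V (k + 1)) + C * (k : ℝ) ^ (-(e + θ))) :
    ∃ C', 0 < C' ∧ ∀ N, k₀ ≤ N → ∃ k, N ≤ k ∧ k < 2 * N ∧ T k ≤ C' * (N : ℝ) ^ (-θ) := by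
  set r := 1 - (e + θ)
  have hr : 0 < r := by simp only [r]; linarith
  have hVM : 0 ≤ V k₀ + M := by linarith [hV k₀]
  set C₃ := M₁ * (V k₀ + M) + C * (1 / r)
  have hC₃ : 0 ≤ C₃ := by positivity
  -- If the bound failed throughout `[N, 2N)`, the weighted sum would be at least `(2C₃ + 1/2) N^r`,
  -- since `k^(-e) ≥ N^(-e)/2` there; telescoping bounds it by `2C₃ N^r`.
  refine ⟨4 * C₃ + 1, by positivity, fun N hN => ?_⟩
  by_contra! hcon
  have hN0 : (0 : ℝ) < N := by exact_mod_cast hk₀.trans hN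
  have hN1 : (1 : ℝ) ≤ N := by exact_mod_cast hk₀.trans hN
  have htel : ∀ n, k₀ ≤ n → ∑ k ∈ Finset.Ico k₀ n, (k : ℝ) ^ (-e) * T k
      ≤ M₁ * (V k₀ - V n) + C * ∑ k ∈ Finset.Ico k₀ n, (k : ℝ) ^ (-(e + θ)) := by
    intro n hn
    induction n, hn using Nat.le_induction with
    | base => simp
    | succ n hn ih =>
      rw [Finset.sum_Ico_succ_top hn, Finset.sum_Ico_succ_top hn]
      linarith [hstep n hn]
  have hsum : ∑ k ∈ Finset.Ico k₀ (2 * N), (k : ℝ) ^ (-(e + θ))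
      ≤ 1 / r * ((2 * N : ℕ) : ℝ) ^ r := by
    refine le_trans ?_ (sum_rpow_neg_le (by linarith) hq (2 * N))
    rw [Finset.sum_Ico_eq_sum_range]
    have hsub : 2 * N - k₀ ≤ 2 * N := Nat.sub_le _ _
    refine (Finset.sum_le_sum fun i _ => ?_).trans
      (Finset.sum_le_sum_of_subset_of_nonneg (Finset.range_mono hsub) fun i _ _ => by positivity)
    refine Real.rpow_le_rpow_of_nonpos (by positivity) ?_ (by linarith)
    exact_mod_cast (by omega : i + 1 ≤ k₀ + i)
  have h1 := htel (2 * N) (by omega)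
  have hpow : ((2 * N : ℕ) : ℝ) ^ r ≤ 2 * (N : ℝ) ^ r := by
    push_cast
    rw [Real.mul_rpow (by norm_num) hN0.le]
    refine mul_le_mul_of_nonneg_right ?_ (by positivity)
    calc (2 : ℝ) ^ r ≤ 2 ^ (1 : ℝ) :=
          Real.rpow_le_rpow_of_exponent_le (by norm_num) (by simp only [r]; linarith)
      _ = 2 := Real.rpow_one 2
  have hNr : 1 ≤ (N : ℝ) ^ r := Real.one_le_rpow hN1 hr.le
  have hupper : ∑ k ∈ Finset.Ico k₀ (2 * N), (k : ℝ) ^ (-e) * T k ≤ 2 * C₃ * (N : ℝ) ^ r := by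
    have h2 := mul_le_mul_of_nonneg_left (hsum.trans
      (mul_le_mul_of_nonneg_left hpow (by positivity : 0 ≤ 1 / r))) hC
    have h3 : M₁ * (V k₀ - V (2 * N)) ≤ M₁ * (V k₀ + M) * (2 * (N : ℝ) ^ r) := by
      have h4 : M₁ * (V k₀ - V (2 * N)) ≤ M₁ * (V k₀ + M) :=
        mul_le_mul_of_nonneg_left (by linarith [hV (2 * N)]) hM₁
      have h5 : 0 ≤ M₁ * (V k₀ + M) := by positivity
      nlinarith
    have e1 : 2 * C₃ * (N : ℝ) ^ r
        = M₁ * (V k₀ + M) * (2 * (N : ℝ) ^ r) + C * (1 / r * (2 * (N : ℝ) ^ r)) := by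
      simp only [C₃]; ring
    linarith
  have hlower : (N : ℝ) * ((N : ℝ) ^ (-e) / 2 * ((4 * C₃ + 1) * (N : ℝ) ^ (-θ)))
      ≤ ∑ k ∈ Finset.Ico k₀ (2 * N), (k : ℝ) ^ (-e) * T k := by
    calc _ = ∑ _k ∈ Finset.Ico N (2 * N),
          ((N : ℝ) ^ (-e) / 2 * ((4 * C₃ + 1) * (N : ℝ) ^ (-θ))) := by
          rw [Finset.sum_const, Nat.card_Ico, nsmul_eq_mul, (by omega : 2 * N - N = N)]
      _ ≤ ∑ k ∈ Finset.Ico N (2 * N), (k : ℝ) ^ (-e) * T k := by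
          refine Finset.sum_le_sum fun k hk => ?_
          rw [Finset.mem_Ico] at hk
          refine mul_le_mul ?_ (hcon k hk.1 hk.2).le (by positivity) (by positivity)
          have hk0 : (0 : ℝ) < k := hN0.trans_le (by exact_mod_cast hk.1)
          have hk2 : (k : ℝ) ≤ 2 * N := by exact_mod_cast hk.2.le
          calc (N : ℝ) ^ (-e) / 2 ≤ (N : ℝ) ^ (-e) * 2 ^ (-e) := by
                rw [div_eq_mul_inv]
                refine mul_le_mul_of_nonneg_left ?_ (by positivity)
                rw [← Real.rpow_neg_one]
                exact Real.rpow_le_rpow_of_exponent_le (by norm_num) (by linarith)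
            _ = (2 * (N : ℝ)) ^ (-e) := by
                rw [mul_comm, Real.mul_rpow (by norm_num) hN0.le]
            _ ≤ (k : ℝ) ^ (-e) := Real.rpow_le_rpow_of_nonpos hk0 hk2 (by linarith)
      _ ≤ _ := Finset.sum_le_sum_of_subset_of_nonneg
          (Finset.Ico_subset_Ico_left hN) fun k hk _ =>
          mul_nonneg (by positivity) (hT k (Finset.mem_Ico.1 hk).1)
  have e2 : (N : ℝ) * ((N : ℝ) ^ (-e) / 2 * ((4 * C₃ + 1) * (N : ℝ) ^ (-θ)))
      = (2 * C₃ + 1 / 2) * (N : ℝ) ^ r := by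
    have : (N : ℝ) ^ r = N * (N : ℝ) ^ (-e) * (N : ℝ) ^ (-θ) := by
      nth_rewrite 2 [← Real.rpow_one (N : ℝ)]
      rw [← Real.rpow_add hN0, ← Real.rpow_add hN0]; congr 1; simp only [r]; ring
    rw [this]; ring
  rw [e2] at hlower
  nlinarith

/-- One step of the Lyapunov analysis, at time `k = κ`. -/
lemma lyapunov_step {κ t s θ : ℝ} (hκ : 1 ≤ κ) (ht : 0 < t) (hs : 0 < s)
    (hts : 8 * t + s < 1) (hθ₁ : θ ≤ 1 - 8 * t - s) (hθ₂ : θ ≤ s - 3 * t)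
    {c₁ c₂ c₄ C₁ C₂ C₃ C₄ C₅ : ℝ} (hc₁ : 0 < c₁) (hc₂ : 0 < c₂) (hc₄ : 0 < c₄) (hC₁ : 0 ≤ C₁)
    (hC₂ : 0 ≤ C₂) (hC₃ : 0 ≤ C₃) (hC₄ : 0 ≤ C₄) (hC₅ : 0 ≤ C₅)
    {Φ Φ' δ δ' u S w w' Q : ℝ} (hδ : 0 ≤ δ) (hS : 0 ≤ S) (hw : 0 ≤ w)
    (h₁ : Φ' ≤ Φ + C₁ * (κ ^ (-6 * t - s) * w + κ ^ (-4 * t - s) * u + κ ^ (-t - 1))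
      - c₁ * (κ ^ (6 * t + s) * S))
    (h₂ : u ≤ (1 - c₂ * κ ^ (-2 * t - s)) * δ + C₂ * κ ^ (-2 * t - 2 * s))
    (h₃ : δ' ≤ (1 + c₂ / 2 * κ ^ (-2 * t - s)) * u
      + C₃ * (κ ^ (6 * t + s) * S + κ ^ (6 * t + s - 2)))
    (h₄ : w' ≤ (1 - c₄ * κ ^ (-s)) * w + C₄ * (S + κ ^ (-2 * s)))
    (h₅ : Q ≤ C₅ * (κ ^ (12 * t + 2 * s) * S + w + κ ^ (2 * t) * u))
    (hlarge : (C₃ * (2 * (C₁ + 1) / c₂) + C₄ * ((C₁ + 1) / c₄)) * κ ^ (-2 * t) ≤ c₁ / 2) :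
    κ ^ (-(6 * t + s)) * (Q + δ) ≤ (C₅ + 1 + 2 * C₅ / c₁)
        * ((Φ + 2 * (C₁ + 1) / c₂ * κ ^ (-2 * t) * δ + (C₁ + 1) / c₄ * κ ^ (-6 * t) * w)
          - (Φ' + 2 * (C₁ + 1) / c₂ * κ ^ (-2 * t) * δ' + (C₁ + 1) / c₄ * κ ^ (-6 * t) * w'))
      + ((C₅ + 1 + 2 * C₅ / c₁) * (C₁ * (C₂ + 1)
        + 2 * (C₁ + 1) / c₂ * ((1 + c₂ / 2) * C₂ + C₃) + (C₁ + 1) / c₄ * C₄) + C₅ * C₂)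
        * κ ^ (-(6 * t + s + θ)) := by
  have hκ0 : 0 < κ := by linarith
  have hp : ∀ e : ℝ, 0 < κ ^ e := fun e => Real.rpow_pos_of_pos hκ0 e
  have hle : ∀ {a b : ℝ}, a ≤ b → κ ^ a ≤ κ ^ b := fun h =>
    Real.rpow_le_rpow_of_exponent_le hκ h
  have hmul : ∀ {a b e : ℝ}, a + b = e → κ ^ a * κ ^ b = κ ^ e := fun h => by
    rw [← Real.rpow_add hκ0, h]
  set N := κ ^ (-(6 * t + s + θ))
  set X := κ ^ (-2 * t - s) with hX
  -- `A` and `E` make the contractions yield `(C₁ + 1)a` and `(C₁ + 1)b`: they cancel the `C₁(a +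
  -- b)` of the descent and leave `a + b`.
  set A := 2 * (C₁ + 1) / c₂ with hA
  set E := (C₁ + 1) / c₄ with hE
  -- The three quantities on the scale of the descent inequality. The weights satisfy `κ^(-2t)
  -- κ^(-2t-s) = κ^(-4t-s)` and `κ^(-6t) κ^(-s) = κ^(-6t-s)`.
  set a := κ ^ (-4 * t - s) * δ with ha
  set b := κ ^ (-6 * t - s) * w with hb
  set g := κ ^ (6 * t + s) * S with hg
  have hA0 : 0 ≤ A := by positivity
  have hE0 : 0 ≤ E := by positivity
  have ha0 : 0 ≤ a := mul_nonneg (hp _).le hδ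
  have hb0 : 0 ≤ b := mul_nonneg (hp _).le hw
  have hg0 : 0 ≤ g := mul_nonneg (hp _).le hS
  have hN0 : 0 < N := hp _
  have hX0 : 0 < X := hp _
  have hX1 : X ≤ 1 := Real.rpow_le_one_of_one_le_of_nonpos hκ (by linarith)
  have hpa := hp (-2 * t)
  -- the weighted tracking error
  have hδ' : κ ^ (-2 * t) * δ' ≤ κ ^ (-2 * t) * δ - c₂ / 2 * a + (1 + c₂ / 2) * C₂ * N
      + C₃ * (κ ^ (-2 * t) * g + N) := by
    -- `(1 + c₂X/2)(1 - c₂X) ≤ 1 - c₂X/2`: half the contraction survives the Young factor.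
    have k1 : (1 + c₂ / 2 * X) * u ≤ (1 - c₂ / 2 * X) * δ
        + (1 + c₂ / 2) * C₂ * κ ^ (-2 * t - 2 * s) := by
      have l1 := mul_le_mul_of_nonneg_left h₂ (by positivity : 0 ≤ 1 + c₂ / 2 * X)
      have l2 : 0 ≤ c₂ ^ 2 / 2 * X ^ 2 * δ := by positivity
      have l3 : 0 ≤ c₂ / 2 * (1 - X) * (C₂ * κ ^ (-2 * t - 2 * s)) :=
        mul_nonneg (mul_nonneg (by positivity) (by linarith)) (mul_nonneg hC₂ (hp _).le)
      linear_combination l1 + l2 + l3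
    have k2 := mul_le_mul_of_nonneg_left (h₃.trans (add_le_add k1 le_rfl)) hpa.le
    have m1 : κ ^ (-2 * t) * X = κ ^ (-4 * t - s) := hmul (by ring)
    have m2 : κ ^ (-2 * t) * κ ^ (-2 * t - 2 * s) ≤ N := by
      rw [hmul rfl]; exact hle (by linarith)
    have m3 : κ ^ (-2 * t) * κ ^ (6 * t + s - 2) ≤ N := by
      rw [hmul rfl]; exact hle (by linarith)
    have m4 := mul_le_mul_of_nonneg_left m2 (by positivity : 0 ≤ (1 + c₂ / 2) * C₂)
    have m5 := mul_le_mul_of_nonneg_left m3 hC₃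
    have m6 : c₂ / 2 * a = c₂ / 2 * (κ ^ (-2 * t) * X) * δ := by rw [m1, ha]; ring
    linarith
  -- the weighted direction error
  have hw' : κ ^ (-6 * t) * w' ≤ κ ^ (-6 * t) * w - c₄ * b + C₄ * (κ ^ (-2 * t) * g + N) := by
    have k2 := mul_le_mul_of_nonneg_left h₄ (hp (-6 * t)).le
    have m1 : c₄ * b = c₄ * (κ ^ (-6 * t) * κ ^ (-s)) * w := by
      rw [hmul (show -6 * t + -s = -6 * t - s by ring), hb]; ring
    have m2 : κ ^ (-6 * t) * κ ^ (-2 * s) ≤ N := by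
      rw [hmul rfl]; exact hle (by linarith)
    have m3 : κ ^ (-6 * t) * S ≤ κ ^ (-2 * t) * g := by
      rw [hg, ← mul_assoc, hmul rfl]
      exact mul_le_mul_of_nonneg_right (hle (by linarith)) hS
    have m4 := mul_le_mul_of_nonneg_left (add_le_add m3 m2) hC₄
    linarith
  have hu : κ ^ (-4 * t - s) * u ≤ a + C₂ * N := by
    have k1 : u ≤ δ + C₂ * κ ^ (-2 * t - 2 * s) := by
      have : 0 ≤ c₂ * X * δ := by positivity
      linarith
    have k2 := mul_le_mul_of_nonneg_left k1 (hp (-4 * t - s)).le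
    have m2 : κ ^ (-4 * t - s) * κ ^ (-2 * t - 2 * s) ≤ N := by
      rw [hmul rfl]; exact hle (by linarith)
    have m3 := mul_le_mul_of_nonneg_left m2 hC₂
    linarith
  have hΦ : Φ' ≤ Φ + C₁ * (b + a + (C₂ + 1) * N) - c₁ * g := by
    have m2 : κ ^ (-t - 1) ≤ N := hle (by linarith)
    have m3 := mul_le_mul_of_nonneg_left
      (add_le_add (add_le_add (le_refl b) hu) m2) hC₁
    linarith
  have hdrop : a + b + c₁ / 2 * g ≤
      (Φ + A * κ ^ (-2 * t) * δ + E * κ ^ (-6 * t) * w)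
        - (Φ' + A * κ ^ (-2 * t) * δ' + E * κ ^ (-6 * t) * w')
      + (C₁ * (C₂ + 1) + A * ((1 + c₂ / 2) * C₂ + C₃) + E * C₄) * N := by
    have k1 := mul_le_mul_of_nonneg_left hδ' hA0
    have k2 := mul_le_mul_of_nonneg_left hw' hE0
    -- The drift terms in `g` carry an extra `κ^(-2t)`, so for large `κ` half of `c₁ g` absorbs
    -- them.
    have k3 := mul_le_mul_of_nonneg_right hlarge hg0
    have m1 : A * (c₂ / 2 * a) = (C₁ + 1) * a := by rw [hA]; field_simp
    have m2 : E * (c₄ * b) = (C₁ + 1) * b := by rw [hE]; field_simp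
    linear_combination k1 + k2 + k3 + hΦ - m1 - m2
  have hQ : κ ^ (-(6 * t + s)) * (Q + δ) ≤ C₅ * (g + b + a + C₂ * N) + a := by
    have k1 := mul_le_mul_of_nonneg_left h₅ (hp (-(6 * t + s))).le
    have m1 : κ ^ (-(6 * t + s)) * κ ^ (12 * t + 2 * s) = κ ^ (6 * t + s) := hmul (by ring)
    have m2 : κ ^ (-(6 * t + s)) = κ ^ (-6 * t - s) := by congr 1; ring
    have m3 : κ ^ (-(6 * t + s)) * κ ^ (2 * t) = κ ^ (-4 * t - s) := hmul (by ring)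
    have m4 : κ ^ (-(6 * t + s)) * δ ≤ a := mul_le_mul_of_nonneg_right (hle (by linarith)) hδ
    have m5 := mul_le_mul_of_nonneg_left hu hC₅
    have e : κ ^ (-(6 * t + s)) * (C₅ * (κ ^ (12 * t + 2 * s) * S + w + κ ^ (2 * t) * u))
        = C₅ * (g + b + κ ^ (-4 * t - s) * u) := by
      rw [hg, hb, ← m1, ← m2, ← m3]; ring
    rw [e] at k1
    linarith
  have hM : 0 ≤ C₅ + 1 + 2 * C₅ / c₁ := by positivity
  have k1 := mul_le_mul_of_nonneg_left hdrop hM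
  have k2 : C₅ * (g + b + a) + a ≤ (C₅ + 1 + 2 * C₅ / c₁) * (a + b + c₁ / 2 * g) := by
    have e : (C₅ + 1 + 2 * C₅ / c₁) * (a + b + c₁ / 2 * g) = C₅ * (g + b + a) + a + b
        + (2 * C₅ / c₁ * (a + b) + (C₅ + 1) * (c₁ / 2 * g)) := by field_simp; ring
    rw [e]
    have : 0 ≤ 2 * C₅ / c₁ * (a + b) + (C₅ + 1) * (c₁ / 2 * g) := by positivity
    linarith
  linarith

end Rates

end SPACO

namespace SPACO
open Set Filter Topology
open scoped RealInnerProductSpace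

/-! ### Increments of power schedules. -/

section Schedules

lemma schedule_of_pos (a e : ℝ) {k : ℕ} (hk : 1 ≤ k) : schedule a e k = a * (k : ℝ) ^ e := by
  rw [schedule, if_neg (by omega)]

lemma schedule_pos {a : ℝ} (ha : 0 < a) (e : ℝ) (k : ℕ) : 0 < schedule a e k := by
  rcases Nat.eq_zero_or_pos k with rfl | hk
  · simpa [schedule] using ha
  · rw [schedule_of_pos a e hk]
    have : (0 : ℝ) < k := by exact_mod_cast hk
    positivity

lemma schedule_le {a e : ℝ} (ha : 0 < a) (he : e ≤ 0) (k : ℕ) : schedule a e k ≤ a := by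
  rcases Nat.eq_zero_or_pos k with rfl | hk
  · simp [schedule]
  · rw [schedule_of_pos a e hk]
    exact mul_le_of_le_one_right ha.le
      (Real.rpow_le_one_of_one_le_of_nonpos (by exact_mod_cast hk) he)

variable {k : ℕ} {t : ℝ}

/-- Bernoulli's inequality, `(1 + 1/k)^t ≤ 1 + t/k ≤ 1 + 1/k`. -/
lemma rpow_succ_le_mul (hk : 1 ≤ k) (ht : 0 ≤ t) (ht1 : t ≤ 1) :
    ((k + 1 : ℕ) : ℝ) ^ t ≤ (k : ℝ) ^ t * (1 + 1 / k) := by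
  have hk0 : (0 : ℝ) < k := by exact_mod_cast hk
  have e : ((k + 1 : ℕ) : ℝ) = k * (1 + 1 / k) := by
    rw [mul_add, mul_one_div_cancel hk0.ne']; push_cast; ring
  rw [e, Real.mul_rpow hk0.le (by positivity)]
  refine mul_le_mul_of_nonneg_left ?_ (by positivity)
  have h1 : (0 : ℝ) < 1 / k := by positivity
  refine (rpow_one_add_le_one_add_mul_self (s := 1 / (k : ℝ)) (by linarith) ht ht1).trans ?_
  nlinarith

lemma rpow_succ_sub_le (hk : 1 ≤ k) (ht : 0 ≤ t) (ht1 : t ≤ 1) :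
    ((k + 1 : ℕ) : ℝ) ^ t - (k : ℝ) ^ t ≤ (k : ℝ) ^ (t - 1) := by
  have hk0 : (0 : ℝ) < k := by exact_mod_cast hk
  have h := rpow_succ_le_mul hk ht ht1
  rw [Real.rpow_sub_one hk0.ne']
  have e : (k : ℝ) ^ t * (1 + 1 / k) = (k : ℝ) ^ t + (k : ℝ) ^ t / k := by ring
  linarith

/-- Invert the bound on `(k+1)^t` and use `1/(1+h) ≥ 1 - h` with `h = 1/k`. -/
lemma rpow_neg_sub_succ_le (hk : 1 ≤ k) (ht : 0 ≤ t) (ht1 : t ≤ 1) :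
    (k : ℝ) ^ (-t) - ((k + 1 : ℕ) : ℝ) ^ (-t) ≤ (k : ℝ) ^ (-t - 1) := by
  have hk0 : (0 : ℝ) < k := by exact_mod_cast hk
  have hk1 : (0 : ℝ) < ((k + 1 : ℕ) : ℝ) := by positivity
  have h := rpow_succ_le_mul hk ht ht1
  rw [Real.rpow_sub_one hk0.ne', Real.rpow_neg hk0.le, Real.rpow_neg hk1.le]
  have ha : 0 < (k : ℝ) ^ t := by positivity
  have hb : 0 < ((k + 1 : ℕ) : ℝ) ^ t := by positivity
  set a := (k : ℝ) ^ t
  set b := ((k + 1 : ℕ) : ℝ) ^ t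
  have h1 : (a * (1 + 1 / (k : ℝ)))⁻¹ ≤ b⁻¹ := inv_anti₀ hb h
  have h2 : a⁻¹ * (1 - 1 / k) ≤ (a * (1 + 1 / (k : ℝ)))⁻¹ := by
    rw [mul_inv]
    refine mul_le_mul_of_nonneg_left ?_ (by positivity)
    rw [← one_div, le_div_iff₀ (by positivity)]
    have : 0 ≤ 1 / (k : ℝ) * (1 / k) := by positivity
    linarith
  have e : a⁻¹ * (1 - 1 / (k : ℝ)) = a⁻¹ - a⁻¹ / k := by ring
  linarith

lemma rpow_succ_le (hk : 1 ≤ k) {e : ℝ} (he : e ≤ 0) :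
    ((k + 1 : ℕ) : ℝ) ^ e ≤ (k : ℝ) ^ e :=
  Real.rpow_le_rpow_of_nonpos (by exact_mod_cast hk) (by push_cast; linarith) he

lemma half_rpow_le_rpow_succ (hk : 1 ≤ k) (ht : 0 ≤ t) (ht1 : t ≤ 1) :
    (k : ℝ) ^ (-t) / 2 ≤ ((k + 1 : ℕ) : ℝ) ^ (-t) := by
  have hk0 : (0 : ℝ) < k := by exact_mod_cast hk
  have hk1 : (1 : ℝ) ≤ k := by exact_mod_cast hk
  calc (k : ℝ) ^ (-t) / 2 ≤ (k : ℝ) ^ (-t) * 2 ^ (-t) := by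
        rw [div_eq_mul_inv]
        refine mul_le_mul_of_nonneg_left ?_ (by positivity)
        rw [← Real.rpow_neg_one]
        exact Real.rpow_le_rpow_of_exponent_le (by norm_num) (by linarith)
    _ = (2 * (k : ℝ)) ^ (-t) := by rw [mul_comm, Real.mul_rpow (by norm_num) hk0.le]
    _ ≤ _ := Real.rpow_le_rpow_of_nonpos (by positivity) (by push_cast; linarith) (by linarith)

end Schedules

/-! ### Polynomial parameters and the eventual step-size conditions. -/

section Rate

variable {n m p : ℕ} {Ω Ξ : Type*} {mΩ : MeasurableSpace Ω} [MeasurableSpace Ξ]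
  {X : Set (Eu n)} {Y : Set (Eu m)} {f : Eu n → Eu m → ℝ} {c : Eu n → Eu m → Eu p}
  {B K : ℝ} {D : Measure Ξ} {F : Ξ → Eu n → Eu m → ℝ} {ρ σ α β η : ℕ → ℝ} {P : Measure Ω}
  {ξx ξy : ℕ → Ω → Ξ} {x₀ : Eu n} {y₀ : Eu m} {x : ℕ → Ω → Eu n} {y : ℕ → Ω → Eu m}
  {d : ℕ → Ω → Eu n}

/-- The polynomial parameter choice, with admissible exponents. -/
structure PolyParams (ρ₀ σ₀ α₀ β₀ η₀ t s : ℝ) (ρ σ α β η : ℕ → ℝ) : Prop where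
  ρ₀_pos : 0 < ρ₀
  σ₀_pos : 0 < σ₀
  α₀_pos : 0 < α₀
  β₀_pos : 0 < β₀
  η₀_pos : 0 < η₀
  η₀_le : η₀ ≤ 1
  t_pos : 0 < t
  s_pos : 0 < s
  lt_s : 3 * t < s
  add_lt : 8 * t + s < 1
  σ_eq : σ = schedule σ₀ (-t)
  ρ_eq : ρ = schedule ρ₀ t
  α_eq : α = schedule α₀ (-6 * t - s)
  β_eq : β = schedule β₀ (-t - s)
  η_eq : η = schedule η₀ (-s)

variable {ρ₀ σ₀ α₀ β₀ η₀ t s : ℝ}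

namespace PolyParams

variable {k : ℕ}

lemma ρ_at (hp : PolyParams ρ₀ σ₀ α₀ β₀ η₀ t s ρ σ α β η) (hk : 1 ≤ k) :
    ρ k = ρ₀ * (k : ℝ) ^ t := by rw [hp.ρ_eq, schedule_of_pos _ _ hk]

lemma σ_at (hp : PolyParams ρ₀ σ₀ α₀ β₀ η₀ t s ρ σ α β η) (hk : 1 ≤ k) :
    σ k = σ₀ * (k : ℝ) ^ (-t) := by rw [hp.σ_eq, schedule_of_pos _ _ hk]

lemma α_at (hp : PolyParams ρ₀ σ₀ α₀ β₀ η₀ t s ρ σ α β η) (hk : 1 ≤ k) :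
    α k = α₀ * (k : ℝ) ^ (-6 * t - s) := by rw [hp.α_eq, schedule_of_pos _ _ hk]

lemma β_at (hp : PolyParams ρ₀ σ₀ α₀ β₀ η₀ t s ρ σ α β η) (hk : 1 ≤ k) :
    β k = β₀ * (k : ℝ) ^ (-t - s) := by rw [hp.β_eq, schedule_of_pos _ _ hk]

lemma η_at (hp : PolyParams ρ₀ σ₀ α₀ β₀ η₀ t s ρ σ α β η) (hk : 1 ≤ k) :
    η k = η₀ * (k : ℝ) ^ (-s) := by rw [hp.η_eq, schedule_of_pos _ _ hk]

lemma σ_le (hp : PolyParams ρ₀ σ₀ α₀ β₀ η₀ t s ρ σ α β η) (k : ℕ) : σ k ≤ σ₀ := by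
  rw [hp.σ_eq]
  exact schedule_le hp.σ₀_pos (by linarith [hp.t_pos]) k

lemma one_add_ρ_le (hp : PolyParams ρ₀ σ₀ α₀ β₀ η₀ t s ρ σ α β η) (hk : 1 ≤ k) :
    1 + ρ k ≤ (1 + ρ₀) * (k : ℝ) ^ t := by
  have h1 : 1 ≤ (k : ℝ) ^ t := Real.one_le_rpow (by exact_mod_cast hk) hp.t_pos.le
  rw [hp.ρ_at hk]
  linarith

lemma one_add_ρ_add_σ_le (hp : PolyParams ρ₀ σ₀ α₀ β₀ η₀ t s ρ σ α β η) (hk : 1 ≤ k) :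
    1 + ρ k + σ k ≤ (1 + ρ₀ + σ₀) * (k : ℝ) ^ t := by
  have h1 : 1 ≤ (k : ℝ) ^ t := Real.one_le_rpow (by exact_mod_cast hk) hp.t_pos.le
  have h2 := hp.one_add_ρ_le hk
  have h3 := hp.σ_le k
  have h4 := hp.σ₀_pos
  nlinarith

lemma ρ_mono (hp : PolyParams ρ₀ σ₀ α₀ β₀ η₀ t s ρ σ α β η) (hk : 1 ≤ k) :
    ρ k ≤ ρ (k + 1) := by
  rw [hp.ρ_at hk, hp.ρ_at (by omega)]
  exact mul_le_mul_of_nonneg_left (Real.rpow_le_rpow (by positivity) (by push_cast; linarith)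
    hp.t_pos.le) hp.ρ₀_pos.le

lemma σ_anti (hp : PolyParams ρ₀ σ₀ α₀ β₀ η₀ t s ρ σ α β η) (hk : 1 ≤ k) :
    σ (k + 1) ≤ σ k := by
  rw [hp.σ_at hk, hp.σ_at (by omega)]
  exact mul_le_mul_of_nonneg_left (rpow_succ_le hk (by linarith [hp.t_pos])) hp.σ₀_pos.le

lemma ρ_succ_sub_le (hp : PolyParams ρ₀ σ₀ α₀ β₀ η₀ t s ρ σ α β η) (hk : 1 ≤ k) :
    ρ (k + 1) - ρ k ≤ ρ₀ * (k : ℝ) ^ (t - 1) := by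
  rw [hp.ρ_at hk, hp.ρ_at (by omega), ← mul_sub]
  exact mul_le_mul_of_nonneg_left (rpow_succ_sub_le hk hp.t_pos.le
    (by linarith [hp.add_lt, hp.s_pos, hp.t_pos])) hp.ρ₀_pos.le

lemma σ_sub_succ_le (hp : PolyParams ρ₀ σ₀ α₀ β₀ η₀ t s ρ σ α β η) (hk : 1 ≤ k) :
    σ k - σ (k + 1) ≤ σ₀ * (k : ℝ) ^ (-t - 1) := by
  rw [hp.σ_at hk, hp.σ_at (by omega), ← mul_sub]
  exact mul_le_mul_of_nonneg_left (rpow_neg_sub_succ_le hk hp.t_pos.le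
    (by linarith [hp.add_lt, hp.s_pos, hp.t_pos])) hp.σ₀_pos.le

/-- The left side is the Lipschitz constant of `y_k*`, given by `lip_maximizer`. -/
lemma condition_le (hp : PolyParams ρ₀ σ₀ α₀ β₀ η₀ t s ρ σ α β η) (hB : 0 ≤ B) (hk : 1 ≤ k) :
    B * (1 + ρ k) / σ k ≤ B * (1 + ρ₀) / σ₀ * (k : ℝ) ^ (2 * t) := by
  have hk0 : (0 : ℝ) < k := by exact_mod_cast hk
  have hσ := hp.σ₀_pos
  have h1 := hp.one_add_ρ_le hk
  have e : (k : ℝ) ^ (2 * t) * (k : ℝ) ^ (-t) = (k : ℝ) ^ t := by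
    rw [← Real.rpow_add hk0]; congr 1; ring
  rw [hp.σ_at hk, div_le_iff₀ (by positivity)]
  calc B * (1 + ρ k) ≤ B * ((1 + ρ₀) * (k : ℝ) ^ t) := mul_le_mul_of_nonneg_left h1 hB
    _ = _ := by rw [← e]; field_simp

/-- The curvature constant of `φ_k` grows like `k^(3t)`, slower than `1/α_k ~ k^(6t+s)`. -/
lemma eventually_α_small (hp : PolyParams ρ₀ σ₀ α₀ β₀ η₀ t s ρ σ α β η) (hB : 0 ≤ B) :
    ∀ᶠ k : ℕ in atTop,
      B * (1 + ρ k) * (B * (1 + ρ k) / σ k) + B * (1 + ρ k) ≤ 1 / (4 * α k) := by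
  have hα := hp.α₀_pos
  have hσ := hp.σ₀_pos
  have hρ := hp.ρ₀_pos
  filter_upwards [eventually_ge_atTop 1, eventually_mul_rpow_le
    (4 * α₀ * (B * (1 + ρ₀) * (B * (1 + ρ₀) / σ₀) + B * (1 + ρ₀)))
    (by linarith [hp.t_pos, hp.s_pos] : 3 * t < 6 * t + s)] with k hk h
  have hk0 : (0 : ℝ) < k := by exact_mod_cast hk
  have hk1 : (1 : ℝ) ≤ k := by exact_mod_cast hk
  have h1 := mul_le_mul_of_nonneg_left (hp.one_add_ρ_le hk) hB
  have h2 := hp.condition_le hB hk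
  have hρk : 0 ≤ 1 + ρ k := by
    rw [hp.ρ_at hk]; positivity
  have hσk : 0 < σ k := by rw [hp.σ_at hk]; positivity
  have h3 : B * (1 + ρ k) * (B * (1 + ρ k) / σ k)
      ≤ B * (1 + ρ₀) * (B * (1 + ρ₀) / σ₀) * (k : ℝ) ^ (3 * t) := by
    refine (mul_le_mul h1 h2 (by positivity) (by positivity)).trans (le_of_eq ?_)
    have e : (k : ℝ) ^ (3 * t) = (k : ℝ) ^ t * (k : ℝ) ^ (2 * t) := by
      rw [← Real.rpow_add hk0]; congr 1; ring
    rw [e]; ring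
  have h4 : B * (1 + ρ k) ≤ B * (1 + ρ₀) * (k : ℝ) ^ (3 * t) := by
    refine h1.trans ?_
    rw [← mul_assoc]
    exact mul_le_mul_of_nonneg_left (Real.rpow_le_rpow_of_exponent_le hk1
      (by linarith [hp.t_pos])) (by positivity)
  have e : 1 / (4 * α k) = (k : ℝ) ^ (6 * t + s) / (4 * α₀) := by
    rw [hp.α_at hk, (by ring : -6 * t - s = -(6 * t + s)), Real.rpow_neg hk0.le]
    field_simp
  rw [e, le_div_iff₀ (by positivity)]
  refine le_trans ?_ h
  have h5 := mul_le_mul_of_nonneg_right (add_le_add h3 h4) (by positivity : 0 ≤ 4 * α₀)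
  linarith

/-- After division by `β_k` this compares `k^(t-s)` with `k^(-t)`, so `s > 2t` is what matters. It
keeps half of the `2β_kσ_k` in the contraction factor. -/
lemma eventually_β_small (hp : PolyParams ρ₀ σ₀ α₀ β₀ η₀ t s ρ σ α β η) (hB : 0 ≤ B) :
    ∀ᶠ k : ℕ in atTop, β k ^ 2 * (B * (1 + ρ k + σ k)) ^ 2 ≤ β k * σ k := by
  have hβ := hp.β₀_pos
  have hσ := hp.σ₀_pos
  have hρ := hp.ρ₀_pos
  filter_upwards [eventually_ge_atTop 1, eventually_mul_rpow_le
    (β₀ / σ₀ * (B * (1 + ρ₀ + σ₀)) ^ 2)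
    (by linarith [hp.lt_s, hp.t_pos] : t - s < -t)] with k hk h
  have hk0 : (0 : ℝ) < k := by exact_mod_cast hk
  have h1 := mul_le_mul_of_nonneg_left (hp.one_add_ρ_add_σ_le hk) hB
  have hρk : 0 ≤ ρ k := by rw [hp.ρ_at hk]; positivity
  have hσk : 0 < σ k := by rw [hp.σ_at hk]; positivity
  have hβk : 0 < β k := by rw [hp.β_at hk]; positivity
  have h2 := pow_le_pow_left₀ (by positivity) h1 2
  have h3 : β k * (B * (1 + ρ k + σ k)) ^ 2 ≤ σ k := by
    refine (mul_le_mul_of_nonneg_left h2 hβk.le).trans ?_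
    have e1 : β k * (B * ((1 + ρ₀ + σ₀) * (k : ℝ) ^ t)) ^ 2
        = σ₀ * (β₀ / σ₀ * (B * (1 + ρ₀ + σ₀)) ^ 2 * (k : ℝ) ^ (t - s)) := by
      have e : (k : ℝ) ^ (t - s) = (k : ℝ) ^ (-t - s) * ((k : ℝ) ^ t) ^ 2 := by
        rw [pow_two, ← Real.rpow_add hk0, ← Real.rpow_add hk0]
        congr 1; ring
      rw [hp.β_at hk, e]
      field_simp
    rw [e1, hp.σ_at hk]
    exact mul_le_mul_of_nonneg_left h hσ.le
  have h4 := mul_le_mul_of_nonneg_left h3 hβk.le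
  linarith

end PolyParams

end Rate

end SPACO

namespace SPACO
open Set Filter Topology
open scoped RealInnerProductSpace

/-! ### The recursions in powers of `k`, and the rate for stationarity and tracking. -/

section Rate

variable {n m p : ℕ} {Ω Ξ : Type*} {mΩ : MeasurableSpace Ω} [MeasurableSpace Ξ]
  {X : Set (Eu n)} {Y : Set (Eu m)} {f : Eu n → Eu m → ℝ} {c : Eu n → Eu m → Eu p}
  {B K : ℝ} {D : Measure Ξ} {F : Ξ → Eu n → Eu m → ℝ} {ρ σ α β η : ℕ → ℝ} {P : Measure Ω}
  {ξx ξy : ℕ → Ω → Ξ} {x₀ : Eu n} {y₀ : Eu m} {x : ℕ → Ω → Eu n} {y : ℕ → Ω → Eu m}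
  {d : ℕ → Ω → Eu n} {ρ₀ σ₀ α₀ β₀ η₀ t s : ℝ}

namespace AdmissibleRun

variable {k : ℕ}

lemma sq_smooth_le (h : AdmissibleRun X Y f c B K D F ρ σ α β η P ξx ξy x₀ y₀ x y d)
    (hp : PolyParams ρ₀ σ₀ α₀ β₀ η₀ t s ρ σ α β η) (hk : 1 ≤ k) :
    (B * (1 + ρ k)) ^ 2 ≤ (B * (1 + ρ₀)) ^ 2 * (k : ℝ) ^ (2 * t) := by
  have hk0 : (0 : ℝ) < k := by exact_mod_cast hk
  have hB := h.regular.nonneg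
  have hρk := h.ρ_pos k
  have e : (k : ℝ) ^ (2 * t) = ((k : ℝ) ^ t) ^ 2 := by
    rw [pow_two, ← Real.rpow_add hk0]; congr 1; ring
  rw [e, ← mul_pow]
  refine pow_le_pow_left₀ (by positivity) ?_ 2
  rw [mul_assoc]
  exact mul_le_mul_of_nonneg_left (hp.one_add_ρ_le hk) hB

variable [IsProbabilityMeasure P]

lemma rate_tracking (h : AdmissibleRun X Y f c B K D F ρ σ α β η P ξx ξy x₀ y₀ x y d)
    (hp : PolyParams ρ₀ σ₀ α₀ β₀ η₀ t s ρ σ α β η) (hk : 1 ≤ k) :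
    ∫ ω, ‖y (k + 1) ω - innerMax Y f c ρ σ x (k + 1) ω‖ ^ 2 ∂P
      ≤ (1 + β₀ * σ₀ / 2 * (k : ℝ) ^ (-2 * t - s))
          * ∫ ω, ‖y (k + 1) ω - innerMax Y f c ρ σ x k ω‖ ^ 2 ∂P
        + (1 + 2 / (β₀ * σ₀)) * (2 * (B * (1 + ρ₀) / σ₀) ^ 2 + 2 * (B * (ρ₀ + σ₀) / σ₀) ^ 2)
          * ((k : ℝ) ^ (6 * t + s) * ∫ ω, ‖x (k + 1) ω - x k ω‖ ^ 2 ∂P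
            + (k : ℝ) ^ (6 * t + s - 2)) := by
  have hk0 : (0 : ℝ) < k := by exact_mod_cast hk
  have hk1 : (1 : ℝ) ≤ k := by exact_mod_cast hk
  have hβ := hp.β₀_pos
  have hσ := hp.σ₀_pos
  have hρ := hp.ρ₀_pos
  have ht := hp.t_pos
  have hs := hp.s_pos
  have hB := h.regular.nonneg
  -- The Young parameter is half the contraction rate `β_kσ_k`. Its inverse costs `k^(2t+s)`, which
  -- turns the squared drifts `k^(4t)` and `k^(4t-2)` into `k^(6t+s)` and `k^(6t+s-2)`.
  have hr : 0 < β₀ * σ₀ / 2 * (k : ℝ) ^ (-2 * t - s) := by positivity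
  have hmain := h.integral_tracking k hr
  have hS0 : 0 ≤ ∫ ω, ‖x (k + 1) ω - x k ω‖ ^ 2 ∂P := integral_nonneg fun _ => sq_nonneg _
  set S := ∫ ω, ‖x (k + 1) ω - x k ω‖ ^ 2 ∂P
  refine hmain.trans (add_le_add le_rfl ?_)
  have h1 : 1 + 1 / (β₀ * σ₀ / 2 * (k : ℝ) ^ (-2 * t - s))
      ≤ (1 + 2 / (β₀ * σ₀)) * (k : ℝ) ^ (2 * t + s) := by
    have e : 1 / (β₀ * σ₀ / 2 * (k : ℝ) ^ (-2 * t - s)) = 2 / (β₀ * σ₀) * (k : ℝ) ^ (2 * t + s) := by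
      rw [(by ring : -2 * t - s = -(2 * t + s)), Real.rpow_neg hk0.le]
      field_simp
    have h2 : 1 ≤ (k : ℝ) ^ (2 * t + s) := Real.one_le_rpow hk1 (by linarith)
    rw [e]; linarith
  have hσk := h.σ_pos k
  have hρk := h.ρ_pos k
  have h2 : (B * (1 + ρ k) / σ k) ^ 2 ≤ (B * (1 + ρ₀) / σ₀) ^ 2 * (k : ℝ) ^ (4 * t) := by
    have h3 := pow_le_pow_left₀ (by positivity) (hp.condition_le hB hk) 2
    have e : (k : ℝ) ^ (4 * t) = ((k : ℝ) ^ (2 * t)) ^ 2 := by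
      rw [pow_two, ← Real.rpow_add hk0]; congr 1; ring
    rwa [e, ← mul_pow]
  have h3 : (B * (|ρ (k + 1) - ρ k| + |σ (k + 1) - σ k|) / σ k) ^ 2
      ≤ (B * (ρ₀ + σ₀) / σ₀) ^ 2 * (k : ℝ) ^ (4 * t - 2) := by
    have e : (k : ℝ) ^ (4 * t - 2) = ((k : ℝ) ^ (2 * t - 1)) ^ 2 := by
      rw [pow_two, ← Real.rpow_add hk0]; congr 1; ring
    rw [e, ← mul_pow]
    refine pow_le_pow_left₀ (by positivity) ?_ 2
    have h4 := hp.ρ_succ_sub_le hk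
    have h5 := hp.σ_sub_succ_le hk
    have h6 : (k : ℝ) ^ (-t - 1) ≤ (k : ℝ) ^ (t - 1) :=
      Real.rpow_le_rpow_of_exponent_le hk1 (by linarith)
    have h7 := mul_le_mul_of_nonneg_left h6 hσ.le
    rw [abs_of_nonneg (by linarith [hp.ρ_mono hk]), abs_of_nonpos (by linarith [hp.σ_anti hk]),
      div_le_iff₀ hσk]
    have e2 : (k : ℝ) ^ (2 * t - 1) * (k : ℝ) ^ (-t) = (k : ℝ) ^ (t - 1) := by
      rw [← Real.rpow_add hk0]; congr 1; ring
    calc B * (ρ (k + 1) - ρ k + -(σ (k + 1) - σ k))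
        ≤ B * ((ρ₀ + σ₀) * (k : ℝ) ^ (t - 1)) := mul_le_mul_of_nonneg_left (by linarith) hB
      _ = _ := by rw [hp.σ_at hk, ← e2]; field_simp
  have h4 : 2 * (B * (1 + ρ k) / σ k) ^ 2 * S
      + 2 * (B * (|ρ (k + 1) - ρ k| + |σ (k + 1) - σ k|) / σ k) ^ 2
      ≤ (2 * (B * (1 + ρ₀) / σ₀) ^ 2 + 2 * (B * (ρ₀ + σ₀) / σ₀) ^ 2)
        * ((k : ℝ) ^ (4 * t) * S + (k : ℝ) ^ (4 * t - 2)) := by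
    have h5 := mul_le_mul_of_nonneg_right h2 hS0
    have h6 : 0 ≤ (B * (1 + ρ₀) / σ₀) ^ 2 * (k : ℝ) ^ (4 * t - 2) := by positivity
    have h7 : 0 ≤ (B * (ρ₀ + σ₀) / σ₀) ^ 2 * ((k : ℝ) ^ (4 * t) * S) := by positivity
    linarith
  refine (mul_le_mul h1 h4 (by positivity) (by positivity)).trans (le_of_eq ?_)
  have e1 : (k : ℝ) ^ (6 * t + s) = (k : ℝ) ^ (2 * t + s) * (k : ℝ) ^ (4 * t) := by
    rw [← Real.rpow_add hk0]; congr 1; ring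
  have e2 : (k : ℝ) ^ (6 * t + s - 2) = (k : ℝ) ^ (2 * t + s) * (k : ℝ) ^ (4 * t - 2) := by
    rw [← Real.rpow_add hk0]; congr 1; ring
  rw [e1, e2]; ring

variable [IsProbabilityMeasure D]

lemma rate_descent (h : AdmissibleRun X Y f c B K D F ρ σ α β η P ξx ξy x₀ y₀ x y d)
    (hp : PolyParams ρ₀ σ₀ α₀ β₀ η₀ t s ρ σ α β η) (hk : 1 ≤ k)
    (hα : B * (1 + ρ k) * (B * (1 + ρ k) / σ k) + B * (1 + ρ k) ≤ 1 / (4 * α k)) :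
    ∫ ω, maxValue Y (penalized f c (ρ (k + 1)) (σ (k + 1))) (x (k + 1) ω) ∂P
      ≤ ∫ ω, maxValue Y (penalized f c (ρ k) (σ k)) (x k ω) ∂P
        + (2 * α₀ + 2 * α₀ * (B * (1 + ρ₀)) ^ 2 + σ₀ / 2 * B ^ 2)
          * ((k : ℝ) ^ (-6 * t - s) * ∫ ω, ‖dirError f c ρ σ x y d k ω‖ ^ 2 ∂P
            + (k : ℝ) ^ (-4 * t - s) * ∫ ω, ‖y (k + 1) ω - innerMax Y f c ρ σ x k ω‖ ^ 2 ∂P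
            + (k : ℝ) ^ (-t - 1))
        - 1 / (2 * α₀) * ((k : ℝ) ^ (6 * t + s) * ∫ ω, ‖x (k + 1) ω - x k ω‖ ^ 2 ∂P) := by
  have hk0 : (0 : ℝ) < k := by exact_mod_cast hk
  have hα₀ := hp.α₀_pos
  have hσ₀ := hp.σ₀_pos
  have hmain := h.integral_descent k (hp.ρ_mono hk) (hp.σ_anti hk) hα
  have hw0 : 0 ≤ ∫ ω, ‖dirError f c ρ σ x y d k ω‖ ^ 2 ∂P := integral_nonneg fun _ => sq_nonneg _
  have hu0 : 0 ≤ ∫ ω, ‖y (k + 1) ω - innerMax Y f c ρ σ x k ω‖ ^ 2 ∂P :=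
    integral_nonneg fun _ => sq_nonneg _
  set w := ∫ ω, ‖dirError f c ρ σ x y d k ω‖ ^ 2 ∂P
  set u := ∫ ω, ‖y (k + 1) ω - innerMax Y f c ρ σ x k ω‖ ^ 2 ∂P
  set S := ∫ ω, ‖x (k + 1) ω - x k ω‖ ^ 2 ∂P
  have e1 : 1 / (2 * α k) * S = 1 / (2 * α₀) * ((k : ℝ) ^ (6 * t + s) * S) := by
    rw [hp.α_at hk, (by ring : -6 * t - s = -(6 * t + s)), Real.rpow_neg hk0.le]
    field_simp
  have h1 : α k * (2 * (B * (1 + ρ k)) ^ 2 * u)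
      ≤ 2 * α₀ * (B * (1 + ρ₀)) ^ 2 * ((k : ℝ) ^ (-4 * t - s) * u) := by
    have h2 := mul_le_mul_of_nonneg_left
      (mul_le_mul_of_nonneg_right (h.sq_smooth_le hp hk) hu0) (by positivity :
        0 ≤ 2 * α₀ * (k : ℝ) ^ (-6 * t - s))
    have e : (k : ℝ) ^ (-4 * t - s) = (k : ℝ) ^ (-6 * t - s) * (k : ℝ) ^ (2 * t) := by
      rw [← Real.rpow_add hk0]; congr 1; ring
    rw [hp.α_at hk, e]
    linarith
  have h2 : α k * (2 * w) = 2 * α₀ * ((k : ℝ) ^ (-6 * t - s) * w) := by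
    rw [hp.α_at hk]; ring
  have h3 : (σ k - σ (k + 1)) / 2 * B ^ 2 ≤ σ₀ / 2 * B ^ 2 * (k : ℝ) ^ (-t - 1) := by
    have h4 := mul_le_mul_of_nonneg_right (hp.σ_sub_succ_le hk)
      (by positivity : 0 ≤ 1 / 2 * B ^ 2)
    linarith
  have q1 : 0 ≤ (k : ℝ) ^ (-6 * t - s) * w := by positivity
  have q2 : 0 ≤ (k : ℝ) ^ (-4 * t - s) * u := by positivity
  have q3 : 0 ≤ (k : ℝ) ^ (-t - 1) := by positivity
  rw [e1, mul_add, h2] at hmain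
  set a := (k : ℝ) ^ (-6 * t - s) * w
  set b := (k : ℝ) ^ (-4 * t - s) * u
  set r := (k : ℝ) ^ (-t - 1)
  have p1 : 0 ≤ (2 * α₀ * (B * (1 + ρ₀)) ^ 2 + σ₀ / 2 * B ^ 2) * a := by positivity
  have p2 : 0 ≤ (2 * α₀ + σ₀ / 2 * B ^ 2) * b := by positivity
  have p3 : 0 ≤ (2 * α₀ + 2 * α₀ * (B * (1 + ρ₀)) ^ 2) * r := by positivity
  linarith

lemma rate_contraction (h : AdmissibleRun X Y f c B K D F ρ σ α β η P ξx ξy x₀ y₀ x y d)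
    (hp : PolyParams ρ₀ σ₀ α₀ β₀ η₀ t s ρ σ α β η) (hk : 1 ≤ k)
    (hβ : β k ^ 2 * (B * (1 + ρ k + σ k)) ^ 2 ≤ β k * σ k) :
    ∫ ω, ‖y (k + 1) ω - innerMax Y f c ρ σ x k ω‖ ^ 2 ∂P
      ≤ (1 - β₀ * σ₀ * (k : ℝ) ^ (-2 * t - s))
          * ∫ ω, ‖y k ω - innerMax Y f c ρ σ x k ω‖ ^ 2 ∂P
        + β₀ ^ 2 * K * (k : ℝ) ^ (-2 * t - 2 * s) := by
  have hk0 : (0 : ℝ) < k := by exact_mod_cast hk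
  have e1 : β k * σ k = β₀ * σ₀ * (k : ℝ) ^ (-2 * t - s) := by
    have e : (k : ℝ) ^ (-2 * t - s) = (k : ℝ) ^ (-t - s) * (k : ℝ) ^ (-t) := by
      rw [← Real.rpow_add hk0]; congr 1; ring
    rw [hp.β_at hk, hp.σ_at hk, e]; ring
  have e2 : β k ^ 2 * K = β₀ ^ 2 * K * (k : ℝ) ^ (-2 * t - 2 * s) := by
    have e : (k : ℝ) ^ (-2 * t - 2 * s) = (k : ℝ) ^ (-t - s) * (k : ℝ) ^ (-t - s) := by
      rw [← Real.rpow_add hk0]; congr 1; ring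
    rw [hp.β_at hk, e]; ring
  refine (h.integral_contraction k).trans (add_le_add ?_ e2.le)
  rw [← e1]
  exact mul_le_mul_of_nonneg_right (by linarith) (integral_nonneg fun _ => sq_nonneg _)

lemma rate_dirError (h : AdmissibleRun X Y f c B K D F ρ σ α β η P ξx ξy x₀ y₀ x y d)
    (hp : PolyParams ρ₀ σ₀ α₀ β₀ η₀ t s ρ σ α β η) (hk : 1 ≤ k) :
    ∫ ω, ‖dirError f c ρ σ x y d (k + 1) ω‖ ^ 2 ∂P
      ≤ (1 - η₀ / 2 * (k : ℝ) ^ (-s)) * ∫ ω, ‖dirError f c ρ σ x y d k ω‖ ^ 2 ∂P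
        + (2 * η₀ ^ 2 * K + (4 * K + 8 * B ^ 2)
            * (1 + β₀ ^ 2 * ((B * (1 + ρ₀ + σ₀)) ^ 2 + K)))
          * (∫ ω, ‖x (k + 1) ω - x k ω‖ ^ 2 ∂P + (k : ℝ) ^ (-2 * s)) := by
  have hk0 : (0 : ℝ) < k := by exact_mod_cast hk
  have hj0 : (0 : ℝ) < ((k + 1 : ℕ) : ℝ) := by positivity
  have hj1 : (1 : ℝ) ≤ ((k + 1 : ℕ) : ℝ) := by push_cast; linarith
  have hk' : 1 ≤ k + 1 := by omega
  have hB := h.regular.nonneg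
  have hK := h.oracle.nonneg
  have ht := hp.t_pos
  have hs := hp.s_pos
  have hρ₀ := hp.ρ₀_pos
  have hσ₀ := hp.σ₀_pos
  have hρk := h.ρ_pos (k + 1)
  have hσk := h.σ_pos (k + 1)
  have hS0 : 0 ≤ ∫ ω, ‖x (k + 1) ω - x k ω‖ ^ 2 ∂P := integral_nonneg fun _ => sq_nonneg _
  have hw0 : 0 ≤ ∫ ω, ‖dirError f c ρ σ x y d k ω‖ ^ 2 ∂P := integral_nonneg fun _ => sq_nonneg _
  refine (h.integral_dirError_succ k).trans ?_
  set S := ∫ ω, ‖x (k + 1) ω - x k ω‖ ^ 2 ∂P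
  set w := ∫ ω, ‖dirError f c ρ σ x y d k ω‖ ^ 2 ∂P
  have h2s : ((k + 1 : ℕ) : ℝ) ^ (-2 * s) ≤ (k : ℝ) ^ (-2 * s) := rpow_succ_le hk (by linarith)
  have h1 : η₀ / 2 * (k : ℝ) ^ (-s) ≤ η (k + 1) := by
    rw [hp.η_at hk']
    have := mul_le_mul_of_nonneg_left (half_rpow_le_rpow_succ hk hs.le
      (by linarith [hp.add_lt])) hp.η₀_pos.le
    linarith
  have h2 : η (k + 1) ^ 2 ≤ η₀ ^ 2 * (k : ℝ) ^ (-2 * s) := by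
    have e : ((k + 1 : ℕ) : ℝ) ^ (-2 * s)
        = ((k + 1 : ℕ) : ℝ) ^ (-s) * ((k + 1 : ℕ) : ℝ) ^ (-s) := by
      rw [← Real.rpow_add hj0]; congr 1; ring
    have := mul_le_mul_of_nonneg_left h2s (sq_nonneg η₀)
    rw [e] at this
    rw [hp.η_at hk']
    linarith
  -- The factor `k^(-t)` in `β` offsets the growth of `ρ`, so the `y`-displacement has the order
  -- `k^(-2s)` of `η²`.
  have h3 : β (k + 1) ^ 2 * ((B * (1 + ρ (k + 1) + σ (k + 1))) ^ 2 + K)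
      ≤ β₀ ^ 2 * ((B * (1 + ρ₀ + σ₀)) ^ 2 + K) * (k : ℝ) ^ (-2 * s) := by
    have h4 := mul_le_mul_of_nonneg_left (hp.one_add_ρ_add_σ_le hk') hB
    have h5 := pow_le_pow_left₀ (by positivity) h4 2
    have e : ((k + 1 : ℕ) : ℝ) ^ (-2 * s)
        = (((k + 1 : ℕ) : ℝ) ^ (-t - s)) ^ 2 * (((k + 1 : ℕ) : ℝ) ^ t) ^ 2 := by
      rw [pow_two, pow_two, ← Real.rpow_add hj0, ← Real.rpow_add hj0, ← Real.rpow_add hj0]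
      congr 1; ring
    have h6 : 1 ≤ (((k + 1 : ℕ) : ℝ) ^ t) ^ 2 := one_le_pow₀ (Real.one_le_rpow hj1 ht.le)
    have h7 : (B * (1 + ρ (k + 1) + σ (k + 1))) ^ 2 + K
        ≤ ((B * (1 + ρ₀ + σ₀)) ^ 2 + K) * (((k + 1 : ℕ) : ℝ) ^ t) ^ 2 := by
      have h8 := mul_le_mul_of_nonneg_left h6 hK
      linarith
    have h9 := mul_le_mul_of_nonneg_left h7 (sq_nonneg (β (k + 1)))
    have h10 := mul_le_mul_of_nonneg_left h2s
      (by positivity : 0 ≤ β₀ ^ 2 * ((B * (1 + ρ₀ + σ₀)) ^ 2 + K))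
    refine h9.trans (le_trans (le_of_eq ?_) h10)
    rw [hp.β_at hk', e]; ring
  have p1 := mul_le_mul_of_nonneg_right h1 hw0
  have p2 := mul_le_mul_of_nonneg_right h2 hK
  have p3 := mul_le_mul_of_nonneg_left h3 (by positivity : 0 ≤ 4 * K + 8 * B ^ 2)
  have q3 : 0 ≤ (k : ℝ) ^ (-2 * s) := by positivity
  have p4 : 0 ≤ (2 * η₀ ^ 2 * K + (4 * K + 8 * B ^ 2)
      * (β₀ ^ 2 * ((B * (1 + ρ₀ + σ₀)) ^ 2 + K))) * S := by positivity
  have p5 : 0 ≤ (4 * K + 8 * B ^ 2) * (k : ℝ) ^ (-2 * s) := by positivity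
  linarith

lemma rate_residual (h : AdmissibleRun X Y f c B K D F ρ σ α β η P ξx ξy x₀ y₀ x y d)
    (hp : PolyParams ρ₀ σ₀ α₀ β₀ η₀ t s ρ σ α β η) (hk : 1 ≤ k) :
    ∫ ω, ‖residual X (maxValue Y (penalized f c (ρ k) (σ k))) (α k) (x k ω)‖ ^ 2 ∂P
      ≤ (2 / α₀ ^ 2 + 4 + 4 * (B * (1 + ρ₀)) ^ 2)
        * ((k : ℝ) ^ (12 * t + 2 * s) * ∫ ω, ‖x (k + 1) ω - x k ω‖ ^ 2 ∂P
          + ∫ ω, ‖dirError f c ρ σ x y d k ω‖ ^ 2 ∂P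
          + (k : ℝ) ^ (2 * t) * ∫ ω, ‖y (k + 1) ω - innerMax Y f c ρ σ x k ω‖ ^ 2 ∂P) := by
  have hk0 : (0 : ℝ) < k := by exact_mod_cast hk
  have hα₀ := hp.α₀_pos
  refine (h.integral_residual_sq k).2.trans ?_
  have hw0 : 0 ≤ ∫ ω, ‖dirError f c ρ σ x y d k ω‖ ^ 2 ∂P := integral_nonneg fun _ => sq_nonneg _
  have hu0 : 0 ≤ ∫ ω, ‖y (k + 1) ω - innerMax Y f c ρ σ x k ω‖ ^ 2 ∂P :=
    integral_nonneg fun _ => sq_nonneg _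
  have hS0 : 0 ≤ ∫ ω, ‖x (k + 1) ω - x k ω‖ ^ 2 ∂P := integral_nonneg fun _ => sq_nonneg _
  set w := ∫ ω, ‖dirError f c ρ σ x y d k ω‖ ^ 2 ∂P
  set u := ∫ ω, ‖y (k + 1) ω - innerMax Y f c ρ σ x k ω‖ ^ 2 ∂P
  set S := ∫ ω, ‖x (k + 1) ω - x k ω‖ ^ 2 ∂P
  have e1 : 2 / α k ^ 2 * S = 2 / α₀ ^ 2 * ((k : ℝ) ^ (12 * t + 2 * s) * S) := by
    have e : (k : ℝ) ^ (12 * t + 2 * s) = ((k : ℝ) ^ (6 * t + s)) ^ 2 := by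
      rw [pow_two, ← Real.rpow_add hk0]; congr 1; ring
    rw [hp.α_at hk, (by ring : -6 * t - s = -(6 * t + s)), Real.rpow_neg hk0.le, e]
    field_simp
  have h1 := mul_le_mul_of_nonneg_right (h.sq_smooth_le hp hk) hu0
  have p1 : 0 ≤ (4 + 4 * (B * (1 + ρ₀)) ^ 2) * ((k : ℝ) ^ (12 * t + 2 * s) * S) := by positivity
  have p2 : 0 ≤ (2 / α₀ ^ 2 + 4 * (B * (1 + ρ₀)) ^ 2) * w := by positivity
  have p3 : 0 ≤ (2 / α₀ ^ 2 + 4) * ((k : ℝ) ^ (2 * t) * u) := by positivity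
  rw [e1]
  linarith

/-- In every late enough dyadic window some iterate has small stationarity and tracking errors. -/
lemma exists_rate (h : AdmissibleRun X Y f c B K D F ρ σ α β η P ξx ξy x₀ y₀ x y d)
    (hp : PolyParams ρ₀ σ₀ α₀ β₀ η₀ t s ρ σ α β η) {θ : ℝ} (hθ : 0 ≤ θ)
    (hθ₁ : θ ≤ 1 - 8 * t - s) (hθ₂ : θ ≤ s - 3 * t) :
    ∃ C', 0 < C' ∧ ∃ k₀ : ℕ, 1 ≤ k₀ ∧ ∀ N : ℕ, k₀ ≤ N → ∃ k, N ≤ k ∧ k < 2 * N ∧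
      ∫ ω, ‖residual X (maxValue Y (penalized f c (ρ k) (σ k))) (α k) (x k ω)‖ ^ 2 ∂P
        + ∫ ω, ‖y k ω - innerMax Y f c ρ σ x k ω‖ ^ 2 ∂P ≤ C' * (N : ℝ) ^ (-θ) := by
  have hB := h.regular.nonneg
  have hK := h.oracle.nonneg
  have ht := hp.t_pos
  have hs := hp.s_pos
  have hρ₀ := hp.ρ₀_pos
  have hσ₀ := hp.σ₀_pos
  have hα₀ := hp.α₀_pos
  have hβ₀ := hp.β₀_pos
  have hη₀ := hp.η₀_pos
  set c₁ := 1 / (2 * α₀) with hc₁d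
  set c₂ := β₀ * σ₀ with hc₂d
  set c₄ := η₀ / 2 with hc₄d
  set C₁ := 2 * α₀ + 2 * α₀ * (B * (1 + ρ₀)) ^ 2 + σ₀ / 2 * B ^ 2 with hC₁d
  set C₂ := β₀ ^ 2 * K with hC₂d
  set C₃ := (1 + 2 / (β₀ * σ₀))
    * (2 * (B * (1 + ρ₀) / σ₀) ^ 2 + 2 * (B * (ρ₀ + σ₀) / σ₀) ^ 2) with hC₃d
  set C₄ := 2 * η₀ ^ 2 * K + (4 * K + 8 * B ^ 2)
    * (1 + β₀ ^ 2 * ((B * (1 + ρ₀ + σ₀)) ^ 2 + K)) with hC₄d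
  set C₅ := 2 / α₀ ^ 2 + 4 + 4 * (B * (1 + ρ₀)) ^ 2 with hC₅d
  have hc₁ : 0 < c₁ := by positivity
  have hc₂ : 0 < c₂ := by positivity
  have hc₄ : 0 < c₄ := by positivity
  have hC₁ : 0 ≤ C₁ := by positivity
  have hC₂ : 0 ≤ C₂ := by positivity
  have hC₃ : 0 ≤ C₃ := by positivity
  have hC₄ : 0 ≤ C₄ := by positivity
  have hC₅ : 0 ≤ C₅ := by positivity
  set A := 2 * (C₁ + 1) / c₂ with hA
  set E := (C₁ + 1) / c₄ with hE
  have hA0 : 0 ≤ A := by positivity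
  have hE0 : 0 ≤ E := by positivity
  have hlarge : ∀ᶠ k : ℕ in atTop, (C₃ * A + C₄ * E) * (k : ℝ) ^ (-2 * t) ≤ c₁ / 2 := by
    filter_upwards [eventually_mul_rpow_le (2 / c₁ * (C₃ * A + C₄ * E))
      (by linarith : -2 * t < 0)] with k hk
    rw [Real.rpow_zero] at hk
    have := mul_le_mul_of_nonneg_left hk (by positivity : 0 ≤ c₁ / 2)
    have e : c₁ / 2 * (2 / c₁ * (C₃ * A + C₄ * E) * (k : ℝ) ^ (-2 * t))
        = (C₃ * A + C₄ * E) * (k : ℝ) ^ (-2 * t) := by field_simp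
    linarith
  obtain ⟨k₁, hk₁⟩ := eventually_atTop.1
    ((hlarge.and (hp.eventually_α_small hB)).and (hp.eventually_β_small hB))
  set k₀ := max k₁ 1
  set Φ : ℕ → ℝ := fun k => ∫ ω, maxValue Y (penalized f c (ρ k) (σ k)) (x k ω) ∂P with hΦ
  set δ : ℕ → ℝ := fun k => ∫ ω, ‖y k ω - innerMax Y f c ρ σ x k ω‖ ^ 2 ∂P with hδ
  set w : ℕ → ℝ := fun k => ∫ ω, ‖dirError f c ρ σ x y d k ω‖ ^ 2 ∂P with hw
  set Q : ℕ → ℝ := fun k =>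
    ∫ ω, ‖residual X (maxValue Y (penalized f c (ρ k) (σ k))) (α k) (x k ω)‖ ^ 2 ∂P with hQ
  have hδ0 : ∀ k, 0 ≤ δ k := fun k => integral_nonneg fun _ => sq_nonneg _
  have hw0 : ∀ k, 0 ≤ w k := fun k => integral_nonneg fun _ => sq_nonneg _
  have hQ0 : ∀ k, 0 ≤ Q k := fun k => integral_nonneg fun _ => sq_nonneg _
  set V : ℕ → ℝ := fun k => Φ k + A * (k : ℝ) ^ (-2 * t) * δ k + E * (k : ℝ) ^ (-6 * t) * w k
    with hVd
  have hVlow : ∀ k, -(B + σ₀ / 2 * B ^ 2) ≤ V k := fun k => by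
    have h1 := h.neg_le_integral_maxValue k
    have h2 := mul_le_mul_of_nonneg_right (hp.σ_le k) (by positivity : 0 ≤ 1 / 2 * B ^ 2)
    have h3 : 0 ≤ A * (k : ℝ) ^ (-2 * t) * δ k := mul_nonneg (by positivity) (hδ0 k)
    have h4 : 0 ≤ E * (k : ℝ) ^ (-6 * t) * w k := mul_nonneg (by positivity) (hw0 k)
    simp only [hVd, hΦ]
    linarith
  set M₁ := C₅ + 1 + 2 * C₅ / c₁ with hM₁
  have hM₁0 : 0 ≤ M₁ := by positivity
  set C₆ := M₁ * (C₁ * (C₂ + 1) + A * ((1 + c₂ / 2) * C₂ + C₃) + E * C₄) + C₅ * C₂ with hC₆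
  have hC₆0 : 0 ≤ C₆ := by positivity
  obtain ⟨C', hC', hfin⟩ := exists_le_of_lyapunov (e := 6 * t + s) (θ := θ)
    (T := fun k => Q k + δ k) (V := V) (k₀ := k₀) (by linarith) (by linarith [hp.add_lt]) hθ
    (by linarith) hM₁0 hC₆0 hVlow (le_max_right _ _)
    (fun k _ => add_nonneg (hQ0 k) (hδ0 k)) (fun k hk => by
      have hk1 : 1 ≤ k := (le_max_right _ _).trans hk
      have hk0 : (0 : ℝ) < k := by exact_mod_cast hk1
      obtain ⟨⟨g1, g2⟩, g3⟩ := hk₁ k ((le_max_left _ _).trans hk)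
      have hstep := lyapunov_step (κ := (k : ℝ)) (θ := θ) (by exact_mod_cast hk1) ht hs hp.add_lt
        hθ₁ hθ₂ hc₁ hc₂ hc₄ hC₁ hC₂ hC₃ hC₄ hC₅ (hδ0 k)
        (integral_nonneg fun _ => sq_nonneg _) (hw0 k) (h.rate_descent hp hk1 g2)
        (h.rate_contraction hp hk1 g3) (h.rate_tracking hp hk1) (h.rate_dirError hp hk1)
        (h.rate_residual hp hk1) g1
      refine hstep.trans (add_le_add (mul_le_mul_of_nonneg_left ?_ hM₁0) le_rfl)
      -- `lyapunov_step` weights both times with powers of `k`, while `V (k + 1)` uses the smaller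
      -- powers of `k + 1`; shrinking the weights only lowers `V (k + 1)`.
      refine sub_le_sub_left ?_ _
      have h1 := rpow_succ_le hk1 (by linarith : -2 * t ≤ 0)
      have h2 := rpow_succ_le hk1 (by linarith : -6 * t ≤ 0)
      exact add_le_add (add_le_add le_rfl
        (mul_le_mul_of_nonneg_right (mul_le_mul_of_nonneg_left h1 hA0) (hδ0 _)))
        (mul_le_mul_of_nonneg_right (mul_le_mul_of_nonneg_left h2 hE0) (hw0 _)))
  exact ⟨C', hC', k₀, le_max_right _ _, hfin⟩

end AdmissibleRun

end Rate

end SPACO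

namespace SPACO
open Set Filter Topology

/-! ### All three criteria at once, and the complexity bound. -/

section Main

variable {n m p : ℕ} {Ω Ξ : Type*} {mΩ : MeasurableSpace Ω} [MeasurableSpace Ξ]
  {X : Set (Eu n)} {Y : Set (Eu m)} {f : Eu n → Eu m → ℝ} {c : Eu n → Eu m → Eu p}
  {B K : ℝ} {D : Measure Ξ} {F : Ξ → Eu n → Eu m → ℝ} {ρ σ α β η : ℕ → ℝ} {P : Measure Ω}
  {ξx ξy : ℕ → Ω → Ξ} {x₀ : Eu n} {y₀ : Eu m} {x : ℕ → Ω → Eu n} {y : ℕ → Ω → Eu m}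
  {d : ℕ → Ω → Eu n} {ρ₀ σ₀ α₀ β₀ η₀ t s : ℝ}

lemma PolyParams.admissibleRun (hp : PolyParams ρ₀ σ₀ α₀ β₀ η₀ t s ρ σ α β η)
    (hr : Regular X Y f c B) (ho : OracleBound D X Y f F K) (hs : IsSampling P D ξx ξy)
    (hrun : IsRun X Y c F ρ σ α β η ξx ξy x₀ y₀ x y d) (hx₀ : x₀ ∈ X) (hy₀ : y₀ ∈ Y) :
    AdmissibleRun X Y f c B K D F ρ σ α β η P ξx ξy x₀ y₀ x y d where
  regular := hr
  oracle := ho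
  sampling := hs
  run := hrun
  x₀_mem := hx₀
  y₀_mem := hy₀
  ρ_pos k := by rw [hp.ρ_eq]; exact schedule_pos hp.ρ₀_pos _ k
  σ_pos k := by rw [hp.σ_eq]; exact schedule_pos hp.σ₀_pos _ k
  α_pos k := by rw [hp.α_eq]; exact schedule_pos hp.α₀_pos _ k
  β_pos k := by rw [hp.β_eq]; exact schedule_pos hp.β₀_pos _ k
  η_nonneg k := by rw [hp.η_eq]; exact (schedule_pos hp.η₀_pos _ k).le
  η_le_one k := by
    rw [hp.η_eq]; exact (schedule_le hp.η₀_pos (by linarith [hp.s_pos]) k).trans hp.η₀_le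

variable [IsProbabilityMeasure P] [IsProbabilityMeasure D]

/-- In every late enough dyadic window some iterate has all three errors of order `N ^ (-τ)`. -/
lemma AdmissibleRun.exists_iterate
    (h : AdmissibleRun X Y f c B K D F ρ σ α β η P ξx ξy x₀ y₀ x y d)
    (hp : PolyParams ρ₀ σ₀ α₀ β₀ η₀ t s ρ σ α β η) {τ : ℝ} (hτ : 0 < τ)
    (hτ₁ : 2 * τ ≤ 1 - 8 * t - s) (hτ₂ : 2 * τ ≤ s - 3 * t) (hτ₃ : 2 * τ ≤ t) :
    ∃ C', 1 ≤ C' ∧ ∃ k₀ : ℕ, 1 ≤ k₀ ∧ ∀ N : ℕ, k₀ ≤ N → ∃ k, N ≤ k ∧ k < 2 * N ∧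
      (Integrable (fun ω =>
          ‖residual X (maxValue Y (penalized f c (ρ k) (σ k))) (α k) (x k ω)‖) P ∧
        ∫ ω, ‖residual X (maxValue Y (penalized f c (ρ k) (σ k))) (α k) (x k ω)‖ ∂P
          ≤ C' * (N : ℝ) ^ (-τ)) ∧
      (Integrable (fun ω => ‖y k ω - innerMax Y f c ρ σ x k ω‖) P ∧
        ∫ ω, ‖y k ω - innerMax Y f c ρ σ x k ω‖ ∂P ≤ C' * (N : ℝ) ^ (-τ)) ∧
      (Integrable (fun ω => ‖posPart (c (x k ω) (y k ω))‖) P ∧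
        ∫ ω, ‖posPart (c (x k ω) (y k ω))‖ ∂P ≤ C' * (N : ℝ) ^ (-τ)) := by
  have hB := h.regular.nonneg
  have hσ₀ := hp.σ₀_pos
  have hρ₀ := hp.ρ₀_pos
  obtain ⟨C, hC, k₀, hk₀, hN⟩ := h.exists_rate hp (by linarith) hτ₁ hτ₂
  set r := Real.sqrt C
  set M := Real.sqrt ((4 * B + σ₀ * B ^ 2) / ρ₀)
  have hr0 : 0 ≤ r := Real.sqrt_nonneg _
  have hM0 : 0 ≤ M := Real.sqrt_nonneg _
  have hBr : 0 ≤ B * r := mul_nonneg hB hr0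
  -- `r` bounds the residual and the tracking error after Jensen, `M + B r` the constraint
  -- violation; the `1` secures `1 ≤ C'`.
  refine ⟨1 + r + M + B * r, by linarith, k₀, hk₀, fun N hNk => ?_⟩
  obtain ⟨k, hk1, hk2, hk⟩ := hN N hNk
  refine ⟨k, hk1, hk2, ?_⟩
  have hN1 : (1 : ℝ) ≤ N := by exact_mod_cast hk₀.trans hNk
  have hN0 : (0 : ℝ) < N := by linarith
  have hkN : (N : ℝ) ≤ k := by exact_mod_cast hk1
  have hk1' : 1 ≤ k := hk₀.trans (hNk.trans hk1)
  set g := (N : ℝ) ^ (-τ) with hg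
  have hg0 : 0 < g := by positivity
  have hg2 : (N : ℝ) ^ (-(2 * τ)) = g ^ 2 := by
    rw [pow_two, hg, ← Real.rpow_add hN0]; congr 1; ring
  have hrg : C * (N : ℝ) ^ (-(2 * τ)) = (r * g) ^ 2 := by
    rw [hg2, mul_pow, Real.sq_sqrt hC.le]
  rw [hrg] at hk
  have hQ0 : 0 ≤ ∫ ω, ‖residual X (maxValue Y (penalized f c (ρ k) (σ k))) (α k) (x k ω)‖ ^ 2 ∂P :=
    integral_nonneg fun _ => sq_nonneg _
  have hδ0 : 0 ≤ ∫ ω, ‖y k ω - innerMax Y f c ρ σ x k ω‖ ^ 2 ∂P :=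
    integral_nonneg fun _ => sq_nonneg _
  have b1 := integral_norm_le_of_sq (h.measurable_residual k) (by positivity)
    (h.integral_residual_sq k).1 (by linarith : _ ≤ (r * g) ^ 2)
  have b2 := integral_norm_le_of_sq (g := fun ω => y k ω - innerMax Y f c ρ σ x k ω)
    ((h.measurable_y k).sub (h.measurable_innerMax k)) (by positivity)
    (h.integrable_y_sub_innerMax k k) (by linarith : _ ≤ (r * g) ^ 2)
  have hMk : 2 * (2 * B + σ k / 2 * B ^ 2) ≤ ρ k * (M * g) ^ 2 := by
    -- This is where `2τ ≤ t` enters: the growth of `ρ_k` must beat the square of the target rate.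
    have h1 : (1 : ℝ) ≤ (k : ℝ) ^ t * g ^ 2 := by
      rw [← hg2]
      calc (1 : ℝ) ≤ (N : ℝ) ^ (t - 2 * τ) := Real.one_le_rpow hN1 (by linarith)
        _ = (N : ℝ) ^ t * (N : ℝ) ^ (-(2 * τ)) := by
          rw [← Real.rpow_add hN0]; congr 1
        _ ≤ _ := mul_le_mul_of_nonneg_right
          (Real.rpow_le_rpow hN0.le hkN hp.t_pos.le) (by positivity)
    have h2 : 0 ≤ 4 * B + σ₀ * B ^ 2 := by positivity
    have h3 := mul_le_mul_of_nonneg_right (hp.σ_le k) (sq_nonneg B)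
    have h4 := le_mul_of_one_le_right h2 h1
    have e : ρ k * (M * g) ^ 2 = (4 * B + σ₀ * B ^ 2) * ((k : ℝ) ^ t * g ^ 2) := by
      rw [hp.ρ_at hk1', mul_pow, Real.sq_sqrt (by positivity)]
      field_simp
    rw [e]
    linarith
  have b3 := h.integral_constraint k (by positivity) hMk b2.1
  have hBb := mul_le_mul_of_nonneg_left b2.2 hB
  have p1 : 0 ≤ r * g := by positivity
  have p2 : 0 ≤ M * g := by positivity
  have p3 : 0 ≤ B * r * g := by positivity
  refine ⟨⟨b1.1, b1.2.trans ?_⟩, ⟨b2.1, b2.2.trans ?_⟩, ⟨b3.1, b3.2.trans ?_⟩⟩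
  · linarith
  · linarith
  · linarith

/-- Turns an error bound `C N ^ (-τ)` along dyadic windows into an iteration complexity. -/
lemma exists_window_of_rate {C τ : ℝ} (hC : 1 ≤ C) (hτ : 0 < τ) (k₀ : ℕ) :
    ∃ C', 0 < C' ∧ ∀ ε : ℝ, 0 < ε → ε ≤ 1 → ∃ N : ℕ, k₀ ≤ N ∧ C * (N : ℝ) ^ (-τ) ≤ ε ∧
      ∀ k : ℕ, k < 2 * N → (k : ℝ) ≤ C' * ε ^ (-(1 / τ)) := by
  have hC0 : 0 < C := by linarith
  refine ⟨2 * (k₀ + C ^ (1 / τ) + 1), by positivity, fun ε hε hε1 => ?_⟩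
  have hz : 1 ≤ ε ^ (-(1 / τ)) :=
    Real.one_le_rpow_of_pos_of_le_one_of_nonpos hε hε1 (by
      have : 0 < 1 / τ := by positivity
      linarith)
  set z := ε ^ (-(1 / τ)) with hzd
  have hz0 : 0 < z := by linarith
  set a := C ^ (1 / τ) * z
  have ha : 0 < a := by positivity
  -- `a` solves `C a^(-τ) = ε`. As `ε ≤ 1` gives `z ≥ 1`, the threshold `k₀` and the rounding are
  -- absorbed into a multiple of `z`.
  refine ⟨max k₀ ⌈a⌉₊, le_max_left _ _, ?_, fun k hk => ?_⟩
  · have h1 : a ≤ ((max k₀ ⌈a⌉₊ : ℕ) : ℝ) :=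
      (Nat.le_ceil a).trans (by exact_mod_cast le_max_right _ _)
    have h2 : ((max k₀ ⌈a⌉₊ : ℕ) : ℝ) ^ (-τ) ≤ a ^ (-τ) :=
      Real.rpow_le_rpow_of_nonpos ha h1 (by linarith)
    have h3 : a ^ (-τ) = C⁻¹ * ε := by
      rw [Real.mul_rpow (by positivity) hz0.le, hzd, ← Real.rpow_mul hC0.le,
        ← Real.rpow_mul hε.le]
      have e1 : 1 / τ * -τ = -1 := by field_simp
      have e2 : -(1 / τ) * -τ = 1 := by field_simp
      rw [e1, e2, Real.rpow_one, Real.rpow_neg_one]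
    have h4 := mul_le_mul_of_nonneg_left h2 hC0.le
    rwa [h3, mul_inv_cancel_left₀ hC0.ne'] at h4
  · have h1 : (k : ℝ) ≤ 2 * ((max k₀ ⌈a⌉₊ : ℕ) : ℝ) := by exact_mod_cast hk.le
    have h2 : ((max k₀ ⌈a⌉₊ : ℕ) : ℝ) ≤ k₀ + (a + 1) := by
      have h3 := Nat.ceil_lt_add_one ha.le
      push_cast
      exact max_le (by linarith) (by linarith [Nat.cast_nonneg (α := ℝ) k₀])
    have h3 : (k₀ : ℝ) + 1 ≤ (k₀ + 1) * z := le_mul_of_one_le_right (by positivity) hz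
    have e : 2 * (k₀ + C ^ (1 / τ) + 1) * z = 2 * ((k₀ + 1) * z + a) := by
      simp only [a]; ring
    linarith

end Main

end SPACO

theorem mainTheorem1 {n m p : ℕ} (X : Set (SPACO.Eu n)) (Y : Set (SPACO.Eu m))
    (f : SPACO.Eu n → SPACO.Eu m → ℝ) (c : SPACO.Eu n → SPACO.Eu m → SPACO.Eu p)
    (hprob : SPACO.StandingAssumptions X Y f c)
    (ρ₀ σ₀ : ℝ) (hρ₀ : 0 < ρ₀) (hσ₀ : 0 < σ₀) :
    -- for every `ρ, σ > 0` the smooth approximation and its inner maximizer are well defined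
    (∀ ρ σ : ℝ, 0 < ρ → 0 < σ →
      (∀ x ∈ X, ∃! y, y ∈ Y ∧ IsMaxOn (fun y' => SPACO.penalized f c ρ σ x y') Y y) ∧
      DifferentiableOn ℝ (SPACO.maxValue Y (SPACO.penalized f c ρ σ)) X) ∧
    -- how small `β₀` has to be depends only on the problem and on `ρ₀`, `σ₀`
    ∃ βmax : ℝ, 0 < βmax ∧
      ∀ {Ξ : Type*} [MeasurableSpace Ξ] (D : Measure Ξ) [IsProbabilityMeasure D]
        (F : Ξ → SPACO.Eu n → SPACO.Eu m → ℝ), SPACO.OracleAssumptions D X Y f F →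
      ∀ t s α₀ β₀ η₀ : ℝ, 0 < t → t < 1 → 0 < s → s < 1 → 3 * t < s → 8 * t + s < 1 →
        0 < α₀ → 0 < β₀ → β₀ ≤ βmax → 0 < η₀ → η₀ ≤ 1 →
      ∀ ρ σ α β η : ℕ → ℝ,
        σ = SPACO.schedule σ₀ (-t) → ρ = SPACO.schedule ρ₀ t →
        α = SPACO.schedule α₀ (-6 * t - s) → β = SPACO.schedule β₀ (-t - s) →
        η = SPACO.schedule η₀ (-s) →
      ∀ {Ω : Type*} [MeasurableSpace Ω] (P : Measure Ω) [IsProbabilityMeasure P]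
        (ξx ξy : ℕ → Ω → Ξ), SPACO.IsSampling P D ξx ξy →
      ∀ x₀ ∈ X, ∀ y₀ ∈ Y,
      ∀ (x : ℕ → Ω → SPACO.Eu n) (y : ℕ → Ω → SPACO.Eu m) (d : ℕ → Ω → SPACO.Eu n),
        SPACO.IsRun X Y c F ρ σ α β η ξx ξy x₀ y₀ x y d →
      ∃ C : ℝ, 0 < C ∧ ∀ ε : ℝ, 0 < ε → ε ≤ 1 →
        ∃ k : ℕ, 1 ≤ k ∧
          (k : ℝ) ≤ C * ε ^ (-(1 / min (min ((1 - 8 * t - s) / 2) ((s - 3 * t) / 2)) (t / 2))) ∧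
          (Integrable (fun ω => ‖SPACO.residual X
              (SPACO.maxValue Y (SPACO.penalized f c (ρ k) (σ k))) (α k) (x k ω)‖) P ∧
            ∫ ω, ‖SPACO.residual X
              (SPACO.maxValue Y (SPACO.penalized f c (ρ k) (σ k))) (α k) (x k ω)‖ ∂P ≤ ε) ∧
          (Integrable (fun ω => ‖y k ω -
              SPACO.maximizer Y (SPACO.penalized f c (ρ k) (σ k)) (x k ω)‖) P ∧
            ∫ ω, ‖y k ω -
              SPACO.maximizer Y (SPACO.penalized f c (ρ k) (σ k)) (x k ω)‖ ∂P ≤ ε) ∧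
          (Integrable (fun ω => ‖SPACO.posPart (c (x k ω) (y k ω))‖) P ∧
            ∫ ω, ‖SPACO.posPart (c (x k ω) (y k ω))‖ ∂P ≤ ε) := by
  obtain ⟨B, hr⟩ := hprob.exists_regular
  -- The witness `1` for `βmax` is a convenient choice: `eventually_β_small` rests on the exponents,
  -- and how late it sets in only affects `C`.
  refine ⟨fun ρ σ hρ hσ => ⟨fun x hx => hr.existsUnique_maximizer hρ hσ hx,
    hr.differentiableOn_maxValue hρ hσ⟩, 1, one_pos, ?_⟩
  intro Ξ _ D _ F hF t s α₀ β₀ η₀ ht _ hs _ hts hts' hα₀ hβ₀ _ hη₀ hη₁ ρ σ α β η hσ hρ hα hβ hη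
    Ω _ P _ ξx ξy hsam x₀ hx₀ y₀ hy₀ x y d hrun
  obtain ⟨K, hK⟩ := hF.exists_bound
  have hp : SPACO.PolyParams ρ₀ σ₀ α₀ β₀ η₀ t s ρ σ α β η :=
    ⟨hρ₀, hσ₀, hα₀, hβ₀, hη₀, hη₁, ht, hs, hts, hts', hσ, hρ, hα, hβ, hη⟩
  have h := hp.admissibleRun hr hK hsam hrun hx₀ hy₀
  set τ := min (min ((1 - 8 * t - s) / 2) ((s - 3 * t) / 2)) (t / 2)
  have hτ : 0 < τ := lt_min (lt_min (by linarith) (by linarith)) (by linarith)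
  have hτ₁ : τ ≤ (1 - 8 * t - s) / 2 := (min_le_left _ _).trans (min_le_left _ _)
  have hτ₂ : τ ≤ (s - 3 * t) / 2 := (min_le_left _ _).trans (min_le_right _ _)
  have hτ₃ : τ ≤ t / 2 := min_le_right _ _
  obtain ⟨C, hC, k₀, hk₀, hwin⟩ :=
    h.exists_iterate hp hτ (by linarith) (by linarith) (by linarith)
  obtain ⟨C', hC', hε⟩ := SPACO.exists_window_of_rate hC hτ k₀
  refine ⟨C', hC', fun ε hε0 hε1 => ?_⟩
  obtain ⟨N, hN, hle, hk⟩ := hε ε hε0 hε1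
  obtain ⟨k, hk1, hk2, ⟨i1, l1⟩, ⟨i2, l2⟩, ⟨i3, l3⟩⟩ := hwin N hN
  exact ⟨k, hk₀.trans (hN.trans hk1), hk k hk2, ⟨i1, l1.trans hle⟩, ⟨i2, l2.trans hle⟩,
    ⟨i3, l3.trans hle⟩⟩
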